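/- **Setting.** Let $k\ge 1$ and let $\Lambda$ be a finite, strongly connected $k$-graph with vertex matrices $A_1,\dots,A_k$, $A_i(v,w)=|v\Lambda^{e_i}w|$, whose spectral radii satisfy $\rho_i>1$ for all $i$. Let $\kappa\in(0,\infty)^{\Lambda^0}$ be the Perron–Frobenius eigenvector: $A_i\kappa=\rho_i\kappa$ for all $i$, $\sum_v\kappa_v=1$. Let $\mathcal B_\Lambda$ be the stationary $k$-Bratteli diagram: $V_n=\Lambda^0$ for $n\ge 0$, and there are $A_i(p,q)$ edges with range $p\in V_{n-1}$ and source $q\in V_n$ if $n\equiv i\pmod k$. Let $\partial\mathcal B_\Lambda$ be its space of infinite paths with range in $V_0$, with the topology generated by the cylinder sets $[\gamma]$ (the set of infinite paths with initial sub-path $\gamma$), where $\gamma$ runs over the set $F$ consisting of all finite paths with range in $V_0$ and of the empty path $\emptyset$, with $[\emptyset]=\partial\mathcal B_\Lambda$. For $x\ne y$ let $x\wedge y\in F$ be the longest common initial sub-path ($\emptyset$ if $r(x)\ne r(y)$). For $\gamma\in F$ let $\operatorname{ext}_1(\gamma)$ be the set of ordered pairs of distinct one-step extensions of $\gamma$ (by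 edges with range $s(\gamma)$; by the vertices of $V_0$ if $\gamma=\emptyset$). For $n=qk+t$, $0\le t<k$, put $R_n=\rho_1^{q+1}\cdots\rho_t^{q+1}\rho_{t+1}^{q}\cdots\rho_k^{q}$. Let $\mu$ be the Borel probability measure with $\mu[\eta]=R_{|\eta|}^{-1}\kappa_{s(\eta)}$ for every finite path $\eta$. Fix $\delta\in(0,1)$, let $w(\eta)=R_{|\eta|}^{-1/\delta}\kappa_{s(\eta)}$, $w(\emptyset)=1$, let $d_w(x,x)=0$ and $d_w(x,y)=w(x\wedge y)$ for $x\neq y$, and suppose that $\operatorname{diam}_{d_w}[\eta]=w(\eta)$ for every finite path $\eta$. Let $s<2+\delta$ and $$Q_s(f,g)=\tfrac12\int \operatorname{Tr}\bigl(|D|^{-s}[D,\pi_\phi(f)]^*[D,\pi_\phi(g)]\bigr)\,d\nu(\phi)$$ on $\operatorname{Dom}(Q_s)=\operatorname{span}\{\chi_{[\gamma]}\}$. Here $\phi$ runs over the choice functions, $\gamma\mapsto\phi(\gamma)=(\phi_1(\gamma),\phi_2(\gamma))\in[\gamma]\times[\gamma]$ with $d_w(\phi_1(\gamma),\phi_2(\gamma))=\operatorname{diam}[\gamma]$,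 for those $\gamma\in F$ with $\operatorname{ext}_1(\gamma)\neq\varnothing$; $D$ and $\pi_\phi(f)$ are block diagonal with blocks $w(\gamma)^{-1}\begin{pmatrix}0&1\\1&0\end{pmatrix}$ and $\operatorname{diag}(f(\phi_1(\gamma)),f(\phi_2(\gamma)))$; and $\nu$ is the product of the measures $\nu_\gamma=\mu\times\mu\big/\sum_{(e,e')\in\operatorname{ext}_1(\gamma)}\mu[\gamma e]\mu[\gamma e']$ on the possible values of $\phi(\gamma)$. For $\gamma\in F$ with initial sub-paths $\emptyset=\gamma_0,\gamma_1,\dots,\gamma_n=\gamma$ ($\gamma_1$ being a vertex of $V_0$) put $$G_s(\gamma)=\tfrac12 w(\gamma)^{2-s}\!\!\sum_{(e,e')\in\operatorname{ext}_1(\gamma)}\!\!\mu[\gamma e]\mu[\gamma e'],\qquad \lambda_{s,\gamma}=\sum_{j=0}^{n-1}\frac{\mu[\gamma_{j+1}]-\mu[\gamma_j]}{G_s(\gamma_j)}-\frac{\mu[\gamma]}{G_s(\gamma)}$$ (if $\Lambda$ has only one vertex, the terms with denominator $G_s(\emptyset)=0$ are omitted). Let $\{\psi_{\gamma,j}\}_j$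 be an orthonormal basis of $E_{s,\gamma}=\operatorname{span}\{\chi_{[\gamma e]}/\mu[\gamma e]-\chi_{[\gamma e']}/\mu[\gamma e'] : (e,e')\in\operatorname{ext}_1(\gamma)\}$ in $L^2(\mu)$, and put $$p(t,x,y)=1+\sum_{\gamma\in F}e^{\lambda_{s,\gamma}t}\sum_j\psi_{\gamma,j}(x)\psi_{\gamma,j}(y).$$ Let $d^{(s)}(x,x)=0$, $d^{(s)}(x,y)=-1/\lambda_{s,x\wedge y}$ for $x\ne y$, and $B_s(x,a)=\{y: d^{(s)}(x,y)<a\}$. **Theorem.** The series for $p(t,x,y)$ converges (unconditionally) for all $t>0$ and all $x,y$, and $p$ is the heat kernel of $Q_s$: each $p(t,x,\cdot)$ is $\mu$-integrable, and for every $f\in\operatorname{Dom}(Q_s)$ the functions $u(t)=\int p(t,\cdot,y)f(y)\,d\mu(y)$, $t>0$, belong to $\operatorname{Dom}(Q_s)$, satisfy $\frac{d}{dt}\langle g,u(t)\rangle=-Q_s(g,u(t))$ for all $g\in\operatorname{Dom}(Q_s)$, and converge to $f$ in $L^2(\mu)$ as $t\downarrow 0$. The function $p$ is continuous on $(0,\infty)\times\partial\mathcal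 B_\Lambda\times\partial\mathcal B_\Lambda$, and there are constants $c_1,c_2>0$ such that for all $t>0$ and $x,y\in\partial\mathcal B_\Lambda$ $$\frac{c_1\,t}{d^{(s)}(x,y)\,\mu[x\wedge y]}\le p(t,x,y)\le\frac{c_2\,t}{d^{(s)}(x,y)\,\mu[x\wedge y]}\quad\text{if } t\le d^{(s)}(x,y),$$ $$\frac{c_1}{\mu(B_s(x,t))}\le p(t,x,y)\le\frac{c_2}{\mu(B_s(x,t))}\quad\text{if } t>d^{(s)}(x,y).$$ -/

import Mathlib

open MeasureTheory CategoryTheory Filter Topology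

namespace KGraphHeat

/-! ### Higher-rank graphs -/

/-- A `k`-graph: a small category `V` with a degree functor to `ℕ^k` satisfying the factorization
property. The objects are the vertices; a morphism `f : a ⟶ b` is a path with source `a` and
range `b`, so the path `μν` (first `ν`, then `μ`) is `ν ≫ μ`. -/
structure KGraph (k : ℕ) (V : Type*) [SmallCategory V] where
  degree : ∀ {a b : V}, (a ⟶ b) → (Fin k → ℕ)
  degree_id : ∀ a : V, degree (𝟙 a) = 0
  degree_comp : ∀ {a b c : V} (f : a ⟶ b) (g : b ⟶ c), degree (f ≫ g) = degree g + degree f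
  factorization : ∀ {a b : V} (f : a ⟶ b) (m n : Fin k → ℕ), degree f = m + n →
    ∃! p : Σ c : V, (a ⟶ c) × (c ⟶ b),
      degree p.2.2 = m ∧ degree p.2.1 = n ∧ p.2.1 ≫ p.2.2 = f

variable {k : ℕ} {V : Type*}

/-- There are only finitely many paths of each degree. -/
def KGraph.IsFinite [SmallCategory V] (Λ : KGraph k V) : Prop :=
  ∀ n : Fin k → ℕ, Finite {f : Σ (a : V) (b : V), (a ⟶ b) // Λ.degree f.2.2 = n}

/-- `v Λ w ≠ ∅` for all vertices `v`, `w`. -/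
def KGraph.IsStronglyConnected [SmallCategory V] (_ : KGraph k V) : Prop :=
  ∀ v w : V, Nonempty (w ⟶ v)

/-- The vertex matrices `A_i(v, w) = |v Λ^{e_i} w|`. -/
noncomputable def KGraph.vertexMatrix [SmallCategory V] (Λ : KGraph k V) (i : Fin k) :
    Matrix V V ℕ :=
  fun v w => Nat.card {f : w ⟶ v // Λ.degree f = Pi.single i 1}

/-- The spectral radius `ρ_i` of the matrix `A_i`. -/
noncomputable def rho [Fintype V] (A : Fin k → Matrix V V ℕ) (i : Fin k) : ℝ :=
  letI := Classical.decEq V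
  (spectralRadius ℂ ((A i).map (fun n : ℕ => (n : ℂ)))).toReal

/-- `κ` is the unimodular Perron-Frobenius eigenvector of the family `A`. -/
structure IsPerronFrobenius [Fintype V] (A : Fin k → Matrix V V ℕ) (κ : V → ℝ) : Prop where
  pos : ∀ v, 0 < κ v
  sum_eq_one : ∑ v, κ v = 1
  eigen : ∀ i v, ∑ w, (A i v w : ℝ) * κ w = rho A i * κ v

/-! ### The stationary `k`-Bratteli diagram -/

/-- The matrix index used between the levels `V_n` and `V_{n+1}`: the matrices
`A_1, …, A_k, A_1, …` are used cyclically. -/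
def cyc (k : ℕ) [NeZero k] (n : ℕ) : Fin k := ⟨n % k, Nat.mod_lt _ (NeZero.pos k)⟩

/-- Finite paths `η` of the stationary `k`-Bratteli diagram with range in `V_0`, indexed by their
length `n` and by their source in `V_n = V`. There are `A_{n mod k}(u, w)` edges
with range `u ∈ V_n` and source `w ∈ V_{n+1}`. -/
inductive FinPath [NeZero k] (A : Fin k → Matrix V V ℕ) : ℕ → V → Type _
  | vertex (v : V) : FinPath A 0 v
  | snoc {n : ℕ} {u : V} (η : FinPath A n u) (w : V) (e : Fin (A (cyc k n) u w)) :
      FinPath A (n + 1) w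

/-- The finite paths starting in `V_0`, together with the empty path (the root of the tree). -/
inductive Node [NeZero k] (A : Fin k → Matrix V V ℕ) : Type _
  | empty : Node A
  | path {n : ℕ} {v : V} (η : FinPath A n v) : Node A

/-- The infinite path space of the stationary `k`-Bratteli diagram. -/
@[ext] structure InfPath [NeZero k] (A : Fin k → Matrix V V ℕ) where
  vert : ℕ → V
  edge : ∀ n, Fin (A (cyc k n) (vert n) (vert (n + 1)))

variable [NeZero k] {A : Fin k → Matrix V V ℕ}

/-- The initial sub-path `x(0,n)`. -/
def InfPath.trunc (x : InfPath A) : (n : ℕ) → FinPath A n (x.vert n)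
  | 0 => .vertex (x.vert 0)
  | n + 1 => .snoc (x.trunc n) (x.vert (n + 1)) (x.edge n)

/-- The initial sub-paths of `x` in increasing order: the empty path, `x(0,0)`, `x(0,1)`, … -/
def InfPath.node (x : InfPath A) : ℕ → Node A
  | 0 => .empty
  | n + 1 => .path (x.trunc n)

/-- The cylinder set `[γ]` of all infinite paths with initial sub-path `γ`;
`[∅]` is the whole space. -/
def cyl (γ : Node A) : Set (InfPath A) := {x | ∃ n, x.node n = γ}

/-- The longest common initial sub-path `x ∧ y` of two distinct infinite paths; it is the empty
path if `r(x) ≠ r(y)`. (The value for `x = y` is irrelevant.) -/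
noncomputable def meet (x y : InfPath A) : Node A := x.node (sSup {n | x.node n = y.node n})

instance : TopologicalSpace (InfPath A) := TopologicalSpace.generateFrom (Set.range cyl)

instance : MeasurableSpace (InfPath A) := borel _

instance : BorelSpace (InfPath A) := ⟨rfl⟩

/-- The one-generation extensions of `γ`: the edges with range `s(γ)`, and for the empty path
the vertices of `V_0`. -/
def Child : Node A → Type _
  | .empty => V
  | @Node.path _ _ _ _ n u _ => Σ w : V, Fin (A (cyc k n) u w)

/-- The extended path `γe`. -/
def extend : (γ : Node A) → Child γ → Node A
  | .empty, v => .path (.vertex v)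
  | .path η, e => .path (.snoc η e.1 e.2)

instance [Fintype V] : (γ : Node A) → Fintype (Child γ)
  | .empty => inferInstanceAs (Fintype V)
  | @Node.path _ _ _ _ n u _ => inferInstanceAs (Fintype (Σ w : V, Fin (A (cyc k n) u w)))

/-! ### Measure, weight and ultrametric -/

section Fintype

variable [Fintype V]

/-- For `n = qk + t` with `0 ≤ t < k` this is `ρ_1^{q+1} ⋯ ρ_t^{q+1} ρ_{t+1}^q ⋯ ρ_k^q`. -/
noncomputable def rhoProd (A : Fin k → Matrix V V ℕ) (n : ℕ) : ℝ :=
  ∏ j ∈ Finset.range n, rho A (cyc k j)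

/-- `μ` is the self-similar measure: `μ[η] = (ρ^q ρ_1 ⋯ ρ_t)⁻¹ κ_{s(η)}` for `|η| = qk + t`. -/
def IsSelfSimilar (κ : V → ℝ) (μ : Measure (InfPath A)) : Prop :=
  IsProbabilityMeasure μ ∧
    ∀ {n : ℕ} {v : V} (η : FinPath A n v), μ.real (cyl (.path η)) = (rhoProd A n)⁻¹ * κ v

/-- The weight `w_δ`, with value `1` at the empty path. -/
noncomputable def weight (κ : V → ℝ) (δ : ℝ) : Node A → ℝ
  | .empty => 1
  | @Node.path _ _ _ _ n v _ => rhoProd A n ^ (-1 / δ) * κ v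

open Classical in
/-- The ultrametric `d_{w_δ}`. -/
noncomputable def dWeight (κ : V → ℝ) (δ : ℝ) (x y : InfPath A) : ℝ :=
  if x = y then 0 else weight κ δ (meet x y)

/-- The diameter of `[γ]` with respect to `d_{w_δ}`. -/
noncomputable def diamCyl (κ : V → ℝ) (δ : ℝ) (γ : Node A) : ℝ :=
  sSup {r | ∃ x ∈ cyl γ, ∃ y ∈ cyl γ, r = dWeight κ δ x y}

open Classical in
/-- `∑_{(e,e') ∈ ext₁(γ)} μ[γe] μ[γe']`. -/
noncomputable def extSum (μ : Measure (InfPath A)) (γ : Node A) : ℝ :=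
  ∑ p : Child γ × Child γ with p.1 ≠ p.2,
    μ.real (cyl (extend γ p.1)) * μ.real (cyl (extend γ p.2))

/-! ### The Dirichlet form of the spectral triple -/

/-- The nodes with at least two extensions. -/
abbrev Branching (A : Fin k → Matrix V V ℕ) : Type _ := {γ : Node A // Nontrivial (Child γ)}

/-- The possible values at `γ` of a choice function. -/
def choiceSet (κ : V → ℝ) (δ : ℝ) (γ : Node A) : Set (InfPath A × InfPath A) :=
  {z | z.1 ∈ cyl γ ∧ z.2 ∈ cyl γ ∧ dWeight κ δ z.1 z.2 = diamCyl κ δ γ}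

/-- The normalized measure `ν_γ`, that is `μ × μ` on the possible values at `γ` of a choice
function, divided by `∑_{(e,e') ∈ ext₁(γ)} μ[γe] μ[γe']`. -/
noncomputable def nuAt (κ : V → ℝ) (δ : ℝ) (μ : Measure (InfPath A)) (γ : Node A) :
    Measure (InfPath A × InfPath A) :=
  (ENNReal.ofReal (extSum μ γ))⁻¹ • (μ.prod μ).restrict (choiceSet κ δ γ)

/-- The measure `ν` on choice functions: the product of the measures `ν_γ`. -/
noncomputable def nu (κ : V → ℝ) (δ : ℝ) (μ : Measure (InfPath A)) :
    Measure (Branching A → InfPath A × InfPath A) :=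
  Measure.infinitePi fun γ => nuAt κ δ μ γ.1

/-- The block at `γ` of the Dirac operator `D` on `ℓ² ⊗ ℂ²`. -/
noncomputable def diracBlock (κ : V → ℝ) (δ : ℝ) (γ : Node A) : Matrix (Fin 2) (Fin 2) ℂ :=
  ((weight κ δ γ)⁻¹ : ℂ) • !![0, 1; 1, 0]

/-- The block at `γ` of `|D|^{-s}`. -/
noncomputable def absDiracPowBlock (κ : V → ℝ) (δ s : ℝ) (γ : Node A) :
    Matrix (Fin 2) (Fin 2) ℂ :=
  ((weight κ δ γ ^ s : ℝ) : ℂ) • 1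

/-- The block of `π_φ(f)` at a node where the choice function `φ` takes the value `z`. -/
def repBlock (f : InfPath A → ℂ) (z : InfPath A × InfPath A) : Matrix (Fin 2) (Fin 2) ℂ :=
  !![f z.1, 0; 0, f z.2]

/-- The block of the commutator `[D, π_φ(f)]`. -/
noncomputable def commBlock (κ : V → ℝ) (δ : ℝ) (f : InfPath A → ℂ) (γ : Node A)
    (z : InfPath A × InfPath A) : Matrix (Fin 2) (Fin 2) ℂ :=
  diracBlock κ δ γ * repBlock f z - repBlock f z * diracBlock κ δ γ

open Matrix in
/-- `Q_s(f,g) = ½ ∫ Tr(|D|^{-s} [D, π_φ(f)]^* [D, π_φ(g)]) dν(φ)`; all operators are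
block diagonal, and the trace is the sum of the traces of the blocks. -/
noncomputable def formQ (κ : V → ℝ) (δ s : ℝ) (μ : Measure (InfPath A))
    (f g : InfPath A → ℂ) : ℂ :=
  (1 / 2 : ℂ) * ∫ φ : Branching A → InfPath A × InfPath A,
    (∑' γ : Branching A, Matrix.trace
      (absDiracPowBlock κ δ s γ.1 * (commBlock κ δ f γ.1 (φ γ))ᴴ * commBlock κ δ g γ.1 (φ γ)))
    ∂(nu κ δ μ)

/-- `Dom(Q_s)`: the linear span of the indicator functions of cylinder sets. -/
noncomputable def domQ (A : Fin k → Matrix V V ℕ) : Submodule ℂ (InfPath A → ℂ) :=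
  Submodule.span ℂ (Set.range fun γ : Node A => (cyl γ).indicator fun _ => (1 : ℂ))

/-- The integral operator with kernel `p(t,·,·)`. -/
noncomputable def kernelOp (μ : Measure (InfPath A)) (p : ℝ → InfPath A → InfPath A → ℝ) (t : ℝ)
    (f : InfPath A → ℂ) : InfPath A → ℂ :=
  fun x => ∫ y, (p t x y : ℂ) * f y ∂μ

/-- `p` is the heat kernel of `Q_s`: for every `f` in `Dom(Q_s)` the functions
`u(t) = ∫ p(t,·,y) f(y) dμ(y)` lie in `Dom(Q_s)`, solve the heat equation
`d/dt ⟨g, u(t)⟩ = -Q_s(g, u(t))` for all `g` in `Dom(Q_s)`, and converge to `f` in `L²`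
as `t → 0`. -/
def IsHeatKernel (κ : V → ℝ) (δ s : ℝ) (μ : Measure (InfPath A))
    (p : ℝ → InfPath A → InfPath A → ℝ) : Prop :=
  (∀ t > 0, ∀ x, Integrable (p t x) μ) ∧
  ∀ f ∈ domQ A,
    (∀ t > 0, kernelOp μ p t f ∈ domQ A) ∧
    (∀ g ∈ domQ A, ∀ t > 0,
      HasDerivAt (fun r => ∫ x, (starRingEnd ℂ) (g x) * kernelOp μ p r f x ∂μ)
        (-formQ κ δ s μ g (kernelOp μ p t f)) t) ∧
    Tendsto (fun t => ∫ x, ‖kernelOp μ p t f x - f x‖ ^ 2 ∂μ) (𝓝[>] 0) (𝓝 0)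

/-! ### Eigenvalues, eigenspaces, intrinsic metric and heat kernel -/

/-- `G_s(γ) = ½ w_δ(γ)^{2-s} ∑_{(e,e') ∈ ext₁(γ)} μ[γe] μ[γe']`. -/
noncomputable def G (κ : V → ℝ) (δ s : ℝ) (μ : Measure (InfPath A)) (γ : Node A) : ℝ :=
  1 / 2 * weight κ δ γ ^ (2 - s) * extSum μ γ

/-- The sum of `(μ[γ_{j+1}] - μ[γ_j]) / G_s(γ_j)` over the proper initial sub-paths `γ_j` of the
finite path, starting with the empty path. If there is only one vertex then the first summand
is `0 / 0 = 0`. -/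
noncomputable def pathSum (κ : V → ℝ) (δ s : ℝ) (μ : Measure (InfPath A)) :
    {n : ℕ} → {v : V} → FinPath A n v → ℝ
  | _, _, .vertex v =>
      (μ.real (cyl (.path (.vertex v))) - μ.real (cyl .empty)) / G κ δ s μ .empty
  | _, _, .snoc η w e =>
      pathSum κ δ s μ η
        + (μ.real (cyl (.path (.snoc η w e))) - μ.real (cyl (.path η))) / G κ δ s μ (.path η)

/-- The sum over proper initial sub-paths, for a node. -/
noncomputable def nodeSum (κ : V → ℝ) (δ s : ℝ) (μ : Measure (InfPath A)) : Node A → ℝ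
  | .empty => 0
  | .path η => pathSum κ δ s μ η

/-- The eigenvalue
`λ_{s,γ} = ∑_j (μ[γ_{j+1}] - μ[γ_j]) / G_s(γ_j) - μ[γ] / G_s(γ)`. -/
noncomputable def eigenvalue (κ : V → ℝ) (δ s : ℝ) (μ : Measure (InfPath A)) (γ : Node A) : ℝ :=
  nodeSum κ δ s μ γ - μ.real (cyl γ) / G κ δ s μ γ

/-- The eigenspace `E_{s,γ}`, spanned by the functions `χ_{γe} / μ[γe] - χ_{γe'} / μ[γe']`
with `(e,e') ∈ ext₁(γ)`. -/
noncomputable def eigenspace (μ : Measure (InfPath A)) (γ : Node A) :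
    Submodule ℝ (InfPath A → ℝ) :=
  Submodule.span ℝ {f | ∃ e e' : Child γ, e ≠ e' ∧
    f = fun x => (cyl (extend γ e)).indicator 1 x / μ.real (cyl (extend γ e))
      - (cyl (extend γ e')).indicator 1 x / μ.real (cyl (extend γ e'))}

/-- For every node `γ`, the functions `ψ_{γ,j}` form an orthonormal basis of `E_{s,γ}`. -/
def IsEigenbasis (μ : Measure (InfPath A)) (m : Node A → ℕ)
    (ψ : (γ : Node A) → Fin (m γ) → InfPath A → ℝ) : Prop :=
  ∀ γ, Submodule.span ℝ (Set.range (ψ γ)) = eigenspace μ γ ∧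
    ∀ i j, ∫ x, ψ γ i x * ψ γ j x ∂μ = if i = j then 1 else 0

/-- The summand at `γ` of the series for the heat kernel. -/
noncomputable def heatTerm (κ : V → ℝ) (δ s : ℝ) (μ : Measure (InfPath A)) {m : Node A → ℕ}
    (ψ : (γ : Node A) → Fin (m γ) → InfPath A → ℝ) (t : ℝ) (x y : InfPath A) (γ : Node A) : ℝ :=
  Real.exp (eigenvalue κ δ s μ γ * t) * ∑ j, ψ γ j x * ψ γ j y

/-- The heat kernel `p(t,x,y) = 1 + ∑_γ e^{λ_{s,γ} t} ∑_j ψ_{γ,j}(x) ψ_{γ,j}(y)`. -/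
noncomputable def heatKernel (κ : V → ℝ) (δ s : ℝ) (μ : Measure (InfPath A)) {m : Node A → ℕ}
    (ψ : (γ : Node A) → Fin (m γ) → InfPath A → ℝ) (t : ℝ) (x y : InfPath A) : ℝ :=
  1 + ∑' γ, heatTerm κ δ s μ ψ t x y γ

open Classical in
/-- The intrinsic metric `d^{(s)}`. -/
noncomputable def dIntrinsic (κ : V → ℝ) (δ s : ℝ) (μ : Measure (InfPath A))
    (x y : InfPath A) : ℝ :=
  if x = y then 0 else -1 / eigenvalue κ δ s μ (meet x y)

/-- The open ball `B_s(x,a)` of the intrinsic metric. -/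
def ballS (κ : V → ℝ) (δ s : ℝ) (μ : Measure (InfPath A)) (x : InfPath A) (a : ℝ) :
    Set (InfPath A) :=
  {y | dIntrinsic κ δ s μ x y < a}

end Fintype

end KGraphHeat

/-! The finite paths form a rooted tree, and for fixed `x` only the branch of initial sub-paths x_n
of `x` matters. The sum of ψ_j(x)ψ_j(y) over an orthonormal basis of E_γ is the kernel of an
orthogonal projection, so it does not depend on the basis (`sum_eigenbasis`). It vanishes if γ is
not on the branch of `x`; at γ = x_n it is the difference of the averaging kernels of two
consecutive levels (`projKernel_node`). Hence p is a series over levels.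

Put a_n = μ[x_n], g_n = a_n / G(x_n), and let S_n be minus the sum over proper initial sub-paths, so
that the eigenvalue at x_n is -(S_n + g_n). On the diagonal p is the limit of D_n = 1 + ∑_{j<n}
e^{-(S_j+g_j)t}(1/a_{j+1} - 1/a_j). If x and y part after level N, the series stops and p = D_N -
e^{-(S_N+g_N)t}/a_N (`heatKernel_of_ne`).

Heat equation: almost every choice function picks separated pairs at all branching nodes, so for
functions of finite level the form is a finite sum of pair integrals weighted by 1/G
(`formQ_eq_sum`). Applied to an element of E_γ, the levels above γ and γ itself contribute exactly
the summands of -λ_γ, and deeper levels contribute nothing (`sum_integral_sepInd_mul`). Cylinder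
indicators are finite combinations of 1 and such eigenfunctions (`hasEigenExpansion`), so the heat
equation reduces to scalar exponentials.

Estimates: w(γ) is comparable to μ[γ]^{1/δ}, whence G(γ) is comparable to μ[γ]^{1+θ} with θ = 1 +
(2-s)/δ > 0 at branching nodes. The a_n decay geometrically from level 1 on, because the diameter
condition makes every nonempty path branch, and they shrink by at most a fixed factor per level
(`exists_profile`). Therefore S_n + g_n is comparable to a_n^{-θ}. With t = u^θ, both D_n (once a_n
≤ u) and 1/μ(B_s(x,t)) are comparable to 1 + 1/u. Off the diagonal, the key is that a_n D_n is an
iterated average: convexity of exp gives e^{-S_n t} ≤ a_n D_n ≤ 1, which sandwiches p between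
e^{-S_N t}(1 - e^{-g_N t})/a_N and t(S_N + g_N)/a_N. -/

namespace KGraphHeat

/-! ### Combinatorics of the tree of finite paths and of its boundary. -/

section Tree

variable {k : ℕ} [NeZero k] {V : Type*} {A : Fin k → Matrix V V ℕ}

/-- The level of a node in the tree of finite paths; the empty path has level `0`. -/
def Node.level : Node A → ℕ
  | .empty => 0
  | @Node.path _ _ _ _ n _ _ => n + 1

/-- The node obtained by removing the last edge; the parent of a vertex is the empty path. -/
def Node.parent : Node A → Node A
  | .empty => .empty
  | .path (.vertex _) => .empty
  | .path (.snoc η _ _) => .path η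

lemma level_extend (γ : Node A) (e : Child γ) : (extend γ e).level = γ.level + 1 := by
  cases γ <;> rfl

lemma parent_extend (γ : Node A) (e : Child γ) : (extend γ e).parent = γ := by
  cases γ <;> rfl

lemma extend_injective (γ : Node A) : Function.Injective (extend γ) := by
  intro e e' h
  cases γ with
  | empty => injection h with _ h
  | path η =>
    obtain ⟨w, e⟩ := e
    obtain ⟨w', e'⟩ := e'
    simp only [extend, Node.path.injEq] at h
    obtain ⟨-, rfl, h⟩ := h
    have := eq_of_heq h
    simp only [FinPath.snoc.injEq] at this
    obtain ⟨-, -, h⟩ := this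
    exact congrArg (Sigma.mk _) (eq_of_heq h)

lemma Node.extend_induction {p : Node A → Prop} (empty : p .empty)
    (extend : ∀ γ e, p γ → p (extend γ e)) (γ : Node A) : p γ := by
  cases γ with
  | empty => exact empty
  | path η =>
    induction η with
    | vertex v => exact extend .empty v empty
    | snoc η w e ih => exact extend (.path η) ⟨w, e⟩ ih

/-- The extension step of `x` after its initial sub-path `x.node n`. -/
def InfPath.child (x : InfPath A) : (n : ℕ) → Child (x.node n)
  | 0 => x.vert 0
  | n + 1 => ⟨x.vert (n + 1), x.edge n⟩

lemma node_succ (x : InfPath A) (n : ℕ) : x.node (n + 1) = extend (x.node n) (x.child n) := by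
  cases n <;> rfl

lemma level_node (x : InfPath A) (n : ℕ) : (x.node n).level = n := by
  cases n <;> rfl

lemma parent_node_succ (x : InfPath A) (n : ℕ) : (x.node (n + 1)).parent = x.node n := by
  rw [node_succ, parent_extend]

lemma node_injective (x : InfPath A) : Function.Injective x.node := fun m n h => by
  rw [← level_node x m, h, level_node]

lemma mem_cyl_iff {x : InfPath A} {γ : Node A} : x ∈ cyl γ ↔ x.node γ.level = γ := by
  constructor
  · rintro ⟨n, rfl⟩
    rw [level_node]
  · exact fun h => ⟨_, h⟩

lemma mem_cyl_node {x y : InfPath A} {n : ℕ} : y ∈ cyl (x.node n) ↔ y.node n = x.node n := by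
  rw [mem_cyl_iff, level_node]

lemma self_mem_cyl_node (x : InfPath A) (n : ℕ) : x ∈ cyl (x.node n) := ⟨n, rfl⟩

lemma cyl_empty : cyl (.empty : Node A) = Set.univ :=
  Set.eq_univ_of_forall fun _ => ⟨0, rfl⟩

lemma node_eq_of_le {x y : InfPath A} {m n : ℕ} (hmn : m ≤ n) (h : x.node n = y.node n) :
    x.node m = y.node m := by
  induction n, hmn using Nat.le_induction with
  | base => exact h
  | succ n _ ih => exact ih (by rw [← parent_node_succ x, h, parent_node_succ])

lemma cyl_extend_subset (γ : Node A) (e : Child γ) : cyl (extend γ e) ⊆ cyl γ := by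
  intro x hx
  rw [mem_cyl_iff, level_extend] at hx
  rw [mem_cyl_iff, ← parent_node_succ, hx, parent_extend]

lemma exists_mem_cyl_extend {x : InfPath A} {γ : Node A} (hx : x ∈ cyl γ) :
    ∃ e, x ∈ cyl (extend γ e) := by
  obtain ⟨n, rfl⟩ := hx
  exact ⟨x.child n, n + 1, node_succ x n⟩

lemma child_eq_of_mem {x : InfPath A} {γ : Node A} {e e' : Child γ}
    (h : x ∈ cyl (extend γ e)) (h' : x ∈ cyl (extend γ e')) : e = e' := by
  rw [mem_cyl_iff, level_extend] at h h'
  exact extend_injective γ (h.symm.trans h')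

lemma iUnion_cyl_extend (γ : Node A) : ⋃ e, cyl (extend γ e) = cyl γ := by
  ext x
  simp only [Set.mem_iUnion]
  exact ⟨fun ⟨e, he⟩ => cyl_extend_subset γ e he, exists_mem_cyl_extend⟩

lemma pairwise_disjoint_cyl_extend (γ : Node A) :
    Pairwise (Function.onFun Disjoint fun e => cyl (extend γ e)) := fun _ _ hne =>
  Set.disjoint_left.2 fun _ h h' => hne (child_eq_of_mem h h')

lemma vert_eq_of_node_eq {x y : InfPath A} {n : ℕ} (h : x.node (n + 1) = y.node (n + 1)) :
    x.vert n = y.vert n := by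
  simp only [InfPath.node, Node.path.injEq] at h
  exact h.2.1

lemma InfPath.ext_node {x y : InfPath A} (h : ∀ n, x.node n = y.node n) : x = y := by
  have hv : x.vert = y.vert := funext fun n => vert_eq_of_node_eq (h (n + 1))
  obtain ⟨v, e⟩ := x
  obtain ⟨v', e'⟩ := y
  obtain rfl : v = v' := hv
  congr 1
  funext n
  have h2 := h (n + 2)
  simp only [InfPath.node, InfPath.trunc, Node.path.injEq] at h2
  have := eq_of_heq h2.2.2
  simp only [FinPath.snoc.injEq, heq_eq_eq, true_and] at this
  exact this.2

/-- Agreement at one level forces agreement at all earlier ones, so the levels of agreement form a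
bounded initial segment of ℕ and the supremum defining `meet` is attained. -/
lemma exists_meet {x y : InfPath A} (hxy : x ≠ y) :
    ∃ N, meet x y = x.node N ∧ ∀ n, x.node n = y.node n ↔ n ≤ N := by
  obtain ⟨n₀, hn₀⟩ : ∃ n, x.node n ≠ y.node n := by
    by_contra! h
    exact hxy (InfPath.ext_node h)
  have hbdd : BddAbove {n | x.node n = y.node n} :=
    ⟨n₀, fun n hn => le_of_not_ge fun h => hn₀ (node_eq_of_le h hn)⟩
  have hmem := Nat.sSup_mem (s := {n | x.node n = y.node n}) ⟨0, rfl⟩ hbdd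
  exact ⟨_, rfl, fun n => ⟨fun h => le_csSup hbdd h, fun h => node_eq_of_le h hmem⟩⟩

/-- `x` and `y` pass through distinct children of `γ`. -/
def Separates (γ : Node A) (x y : InfPath A) : Prop :=
  ∃ e e' : Child γ, e ≠ e' ∧ x ∈ cyl (extend γ e) ∧ y ∈ cyl (extend γ e')

/-- Translates the metric notion `meet` into membership in children's cylinders, which is what can
be integrated. -/
lemma separates_iff {γ : Node A} {x y : InfPath A} :
    Separates γ x y ↔ x ≠ y ∧ meet x y = γ := by
  constructor
  · rintro ⟨e, e', hne, hx, hy⟩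
    have hxy : x ≠ y := fun h => hne (child_eq_of_mem hx (h ▸ hy))
    refine ⟨hxy, ?_⟩
    obtain ⟨N, hN, hiff⟩ := exists_meet hxy
    have hx' := mem_cyl_iff.1 (cyl_extend_subset _ _ hx)
    have hy' := mem_cyl_iff.1 (cyl_extend_subset _ _ hy)
    have h1 := (hiff γ.level).1 (hx'.trans hy'.symm)
    rw [mem_cyl_iff, level_extend] at hx hy
    have h2 : ¬ γ.level + 1 ≤ N := fun h => hne (extend_injective γ (by
      rw [← hx, ← hy]; exact (hiff _).2 h))
    rw [hN, show N = γ.level by omega, hx']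
  · rintro ⟨hxy, rfl⟩
    obtain ⟨N, hN, hiff⟩ := exists_meet hxy
    have hxN : x ∈ cyl (meet x y) := hN ▸ self_mem_cyl_node x N
    have hyN : y ∈ cyl (meet x y) := by
      rw [hN, (hiff N).2 le_rfl]; exact self_mem_cyl_node y N
    obtain ⟨e, he⟩ := exists_mem_cyl_extend hxN
    obtain ⟨e', he'⟩ := exists_mem_cyl_extend hyN
    refine ⟨e, e', fun h => ?_, he, he'⟩
    subst h
    rw [mem_cyl_iff, level_extend] at he he'
    have := (hiff _).1 (he.trans he'.symm)
    rw [hN, level_node] at this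
    omega

lemma Separates.nontrivial {γ : Node A} {x y : InfPath A} (h : Separates γ x y) :
    Nontrivial (Child γ) := by
  obtain ⟨e, e', hne, -⟩ := h
  exact ⟨e, e', hne⟩

lemma separates_meet {x y : InfPath A} (hxy : x ≠ y) : Separates (meet x y) x y :=
  separates_iff.2 ⟨hxy, rfl⟩

lemma finite_level [Finite V] (n : ℕ) : {γ : Node A | γ.level = n}.Finite := by
  have := Fintype.ofFinite V
  induction n with
  | zero =>
    refine (Set.finite_singleton Node.empty).subset fun γ hγ => ?_
    cases γ with
    | empty => rfl
    | path η => simp [Node.level] at hγ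
  | succ n ih =>
    refine (ih.biUnion fun γ _ => Set.finite_range (extend γ)).subset fun γ => ?_
    refine Node.extend_induction (p := fun γ => γ.level = n + 1 → _) ?_ ?_ γ
    · simp [Node.level]
    · intro γ e _ h
      rw [level_extend] at h
      simp only [Set.mem_iUnion]
      exact ⟨γ, by simpa using h, e, rfl⟩

instance [Finite V] : Countable (Node A) := by
  rw [← Set.countable_univ_iff, show (Set.univ : Set (Node A)) = ⋃ n, {γ | γ.level = n} by
    ext γ; simp]
  exact Set.countable_iUnion fun n => (finite_level n).countable

lemma isOpen_cyl (γ : Node A) : IsOpen (cyl γ) :=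
  TopologicalSpace.isOpen_generateFrom_of_mem ⟨γ, rfl⟩

lemma measurableSet_cyl (γ : Node A) : MeasurableSet (cyl γ) := (isOpen_cyl γ).measurableSet

/-- The source of all continuity statements: a quantity depending on finitely many initial sub-paths
is continuous because cylinders are open. -/
lemma isLocallyConstant_node (n : ℕ) : IsLocallyConstant fun x : InfPath A => x.node n := by
  rw [IsLocallyConstant.iff_eventually_eq]
  intro x
  filter_upwards [(isOpen_cyl (x.node n)).mem_nhds (self_mem_cyl_node x n)] with y hy
  exact mem_cyl_node.1 hy

end Tree

/-! ### Real-variable estimates along a single branch. -/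

section Profile

/-- Data along an infinite path: the measures `a n` of the cylinder sets, the ratios
`g n = a n / G n`, and the sums `S n` entering the eigenvalues `-(S n + g n)`. -/
structure IsProfile (b c C θ : ℝ) (a g S : ℕ → ℝ) : Prop where
  zero : a 0 = 1
  pos : ∀ n, 0 < a n
  mul_le_succ : ∀ n, b * a n ≤ a (n + 1)
  succ_le : ∀ n, a (n + 1) ≤ a n
  -- Level 0 is excluded here and in the lower bound on `g`: with a single vertex the root does not
  -- branch, so `a 1 = a 0` and `g 0 = 0`.
  succ_le_mul : ∀ n, 1 ≤ n → a (n + 1) ≤ (1 - b) * a n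
  nonneg : ∀ n, 0 ≤ g n
  le : ∀ n, g n ≤ C * a n ^ (-θ)
  ge : ∀ n, 1 ≤ n → c * a n ^ (-θ) ≤ g n
  sum_zero : S 0 = 0
  sum_succ : ∀ n, S (n + 1) = S n + (1 - a (n + 1) / a n) * g n

/-- The partial sums of the on-diagonal heat kernel. -/
noncomputable def diagSum (a g S : ℕ → ℝ) (t : ℝ) (n : ℕ) : ℝ :=
  1 + ∑ j ∈ Finset.range n, Real.exp (-(S j + g j) * t) * (1 / a (j + 1) - 1 / a j)

/-- The heat kernel at two points whose common initial sub-path has level `n`. -/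
noncomputable def offDiag (a g S : ℕ → ℝ) (t : ℝ) (n : ℕ) : ℝ :=
  diagSum a g S t n - Real.exp (-(S n + g n) * t) / a n

variable {b c C θ : ℝ} {a g S : ℕ → ℝ}

lemma diagSum_zero (t : ℝ) : diagSum a g S t 0 = 1 := by simp [diagSum]

lemma diagSum_succ (t : ℝ) (n : ℕ) : diagSum a g S t (n + 1) =
    diagSum a g S t n + Real.exp (-(S n + g n) * t) * (1 / a (n + 1) - 1 / a n) := by
  rw [diagSum, Finset.sum_range_succ, ← add_assoc, ← diagSum]

namespace IsProfile

variable (h : IsProfile b c C θ a g S)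
include h

lemma ratio_nonneg (n : ℕ) : 0 ≤ 1 - a (n + 1) / a n := by
  rw [sub_nonneg, div_le_one (h.pos n)]
  exact h.succ_le n

lemma sum_nonneg (n : ℕ) : 0 ≤ S n := by
  induction n with
  | zero => exact h.sum_zero.ge
  | succ n ih =>
    rw [h.sum_succ]
    exact add_nonneg ih (mul_nonneg (h.ratio_nonneg n) (h.nonneg n))

lemma a_le_one (n : ℕ) : a n ≤ 1 := by
  induction n with
  | zero => exact h.zero.le
  | succ n ih => exact (h.succ_le n).trans ih

lemma inv_sub_nonneg (n : ℕ) : 0 ≤ 1 / a (n + 1) - 1 / a n :=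
  sub_nonneg.2 (one_div_le_one_div_of_le (h.pos _) (h.succ_le n))

lemma diagSum_mono (t : ℝ) : Monotone (diagSum a g S t) :=
  monotone_nat_of_le_succ fun n => by
    rw [diagSum_succ]
    have := mul_nonneg (Real.exp_pos (-(S n + g n) * t)).le (h.inv_sub_nonneg n)
    linarith

lemma one_le_diagSum (t : ℝ) (n : ℕ) : 1 ≤ diagSum a g S t n :=
  (diagSum_zero t).ge.trans (h.diagSum_mono t n.zero_le)

/-- With q = a_{n+1}/a_n, the quantity a_n D_n is updated by averaging it with e^{-(S_n+g_n)t} with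
weights q and 1-q. The same weights average S_n and S_n + g_n to S_{n+1}. -/
lemma mul_diagSum_succ (t : ℝ) (n : ℕ) : a (n + 1) * diagSum a g S t (n + 1) =
    a (n + 1) / a n * (a n * diagSum a g S t n)
      + (1 - a (n + 1) / a n) * Real.exp (-(S n + g n) * t) := by
  rw [diagSum_succ]
  have h1 := (h.pos n).ne'
  have h2 := (h.pos (n + 1)).ne'
  field_simp

/-- Jensen's inequality for exp, applied at each averaging step. -/
lemma exp_neg_sum_le (t : ℝ) (n : ℕ) : Real.exp (-S n * t) ≤ a n * diagSum a g S t n := by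
  induction n with
  | zero => simp [h.sum_zero, h.zero, diagSum_zero]
  | succ n ih =>
    rw [h.mul_diagSum_succ]
    have hq : 0 ≤ a (n + 1) / a n := (div_pos (h.pos _) (h.pos _)).le
    have hconv := convexOn_exp.2 (Set.mem_univ (-S n * t)) (Set.mem_univ (-(S n + g n) * t)) hq
      (h.ratio_nonneg n) (by ring)
    simp only [smul_eq_mul] at hconv
    rw [show -S (n + 1) * t = a (n + 1) / a n * (-S n * t)
      + (1 - a (n + 1) / a n) * (-(S n + g n) * t) by rw [h.sum_succ]; ring]
    exact hconv.trans (by gcongr)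

lemma mul_diagSum_le_one {t : ℝ} (ht : 0 ≤ t) (n : ℕ) : a n * diagSum a g S t n ≤ 1 := by
  induction n with
  | zero => simp [h.zero, diagSum_zero]
  | succ n ih =>
    rw [h.mul_diagSum_succ]
    have hq : 0 ≤ a (n + 1) / a n := (div_pos (h.pos _) (h.pos _)).le
    have he : Real.exp (-(S n + g n) * t) ≤ 1 := Real.exp_le_one_iff.2 (by
      have := mul_nonneg (add_nonneg (h.sum_nonneg n) (h.nonneg n)) ht
      linarith)
    have h1 := mul_le_mul_of_nonneg_left ih hq
    have h2 := mul_le_mul_of_nonneg_left he (h.ratio_nonneg n)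
    linarith

/-- Follows from a_n D_n ≤ 1 and 1 - e^{-z} ≤ z. -/
lemma offDiag_le {t : ℝ} (ht : 0 ≤ t) (n : ℕ) : offDiag a g S t n ≤ t * (S n + g n) / a n := by
  have h1 := h.mul_diagSum_le_one ht n
  have h2 := Real.add_one_le_exp (-(S n + g n) * t)
  have h3 := h.pos n
  rw [offDiag, le_div_iff₀ h3, sub_mul, div_mul_cancel₀ _ h3.ne']
  linarith

lemma le_offDiag (t : ℝ) (n : ℕ) :
    Real.exp (-S n * t) * (1 - Real.exp (-(g n * t))) / a n ≤ offDiag a g S t n := by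
  have h1 := h.exp_neg_sum_le t n
  have h3 := h.pos n
  rw [offDiag, div_le_iff₀ h3, sub_mul, div_mul_cancel₀ _ h3.ne', mul_sub, ← Real.exp_add,
    show -S n * t + -(g n * t) = -(S n + g n) * t by ring]
  linarith

lemma offDiag_le_diagSum (t : ℝ) (n : ℕ) : offDiag a g S t n ≤ diagSum a g S t n :=
  sub_le_self _ (div_nonneg (Real.exp_pos _).le (h.pos n).le)

lemma one_le_rpow (hθ : 0 < θ) (n : ℕ) : 1 ≤ a n ^ (-θ) :=
  Real.one_le_rpow_of_pos_of_le_one_of_nonpos (h.pos n) (h.a_le_one n) (by linarith)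

lemma rpow_succ (hb : b < 1) (hθ : 0 < θ) (n : ℕ) (hn : 1 ≤ n) :
    a n ^ (-θ) ≤ (1 - b) ^ θ * a (n + 1) ^ (-θ) := by
  have h1 := h.succ_le_mul n hn
  have h2 := Real.rpow_le_rpow_of_nonpos (h.pos (n + 1)) h1 (show -θ ≤ 0 by linarith)
  have hb' : 0 < 1 - b := by linarith
  rw [Real.mul_rpow hb'.le (h.pos n).le] at h2
  calc a n ^ (-θ) = (1 - b) ^ θ * ((1 - b) ^ (-θ) * a n ^ (-θ)) := by
        rw [← mul_assoc, ← Real.rpow_add hb']; simp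
    _ ≤ _ := by gcongr

/-- The increments of S are at most C a_n^{-θ}, which grows geometrically from level 1 on, so the
sum is dominated by its last term. -/
lemma sum_le (hb₀ : 0 < b) (hb : b < 1) (hθ : 0 < θ) (hC : 0 ≤ C) (n : ℕ) :
    S n ≤ C / (1 - (1 - b) ^ θ) * a n ^ (-θ) := by
  set r := (1 - b) ^ θ with hr
  have hr0 : 0 < r := Real.rpow_pos_of_pos (by linarith) _
  have hr1 : r < 1 := Real.rpow_lt_one (by linarith) (by linarith) hθ
  have hK : C ≤ C / (1 - r) := by
    rw [le_div_iff₀ (by linarith)]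
    nlinarith
  induction n with
  | zero =>
    rw [h.sum_zero]
    have := h.pos 0
    have : 0 < 1 - r := by linarith
    positivity
  | succ n ih =>
    have hpos := h.one_le_rpow hθ (n + 1)
    have hg : (1 - a (n + 1) / a n) * g n ≤ C * a n ^ (-θ) := by
      have h1 : (1 - a (n + 1) / a n) * g n ≤ 1 * g n :=
        mul_le_mul_of_nonneg_right
          (by have := div_pos (h.pos (n + 1)) (h.pos n); linarith) (h.nonneg n)
      linarith [h.le n]
    rw [h.sum_succ]
    -- The step out of the root has no geometric gain; there `S 0 = 0` is used instead.
    rcases Nat.eq_zero_or_pos n with rfl | hn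
    · rw [h.sum_zero]
      rw [h.zero, Real.one_rpow] at hg
      rw [h.zero]
      nlinarith
    · have h1 := h.rpow_succ hb hθ n hn
      calc S n + (1 - a (n + 1) / a n) * g n ≤ (C / (1 - r) + C) * a n ^ (-θ) := by linarith
        _ ≤ (C / (1 - r) + C) * (r * a (n + 1) ^ (-θ)) :=
            mul_le_mul_of_nonneg_left h1 (by linarith)
        _ = ((C / (1 - r) + C) * r) * a (n + 1) ^ (-θ) := by ring
        _ ≤ C / (1 - r) * a (n + 1) ^ (-θ) := by
            refine mul_le_mul_of_nonneg_right ?_ (by linarith)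
            have h3 : 0 < 1 - r := by linarith
            rw [div_add' _ _ _ h3.ne', div_mul_eq_mul_div]
            refine div_le_div_of_nonneg_right ?_ h3.le
            -- The induction closes because r(2 - r) ≤ 1.
            nlinarith [mul_nonneg hC (sq_nonneg (1 - r))]

end IsProfile

lemma rpow_neg_mul_rpow {x u : ℝ} (hx : 0 < x) (hu : 0 < u) (θ : ℝ) :
    x ^ (-θ) * u ^ θ = (u / x) ^ θ := by
  rw [Real.div_rpow hu.le hx.le, Real.rpow_neg hx.le]
  ring

/-- A stretched exponential beats every power: compare with the term of degree m of the exponential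
series, where mθ ≥ 2. The square suffices later, since 1/(1+x)² is the derivative of x/(1+x). -/
lemma exists_exp_neg_rpow_le {c θ : ℝ} (hc : 0 < c) (hθ : 0 < θ) :
    ∃ K > 0, ∀ x : ℝ, 0 ≤ x → Real.exp (-(c * x ^ θ)) ≤ K / (1 + x) ^ 2 := by
  obtain ⟨m, hm⟩ := exists_nat_ge (2 / θ)
  rw [div_le_iff₀ hθ] at hm
  set M : ℝ := m.factorial / c ^ m
  have hM : 0 < M := by positivity
  refine ⟨4 * (1 + M), by positivity, fun x hx => ?_⟩
  rw [le_div_iff₀ (by positivity), Real.exp_neg, inv_mul_le_iff₀ (Real.exp_pos _)]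
  have h1 : 1 ≤ Real.exp (c * x ^ θ) := Real.one_le_exp (by positivity)
  rcases le_total x 1 with hx1 | hx1
  · nlinarith
  · have h2 := Real.pow_div_factorial_le_exp (c * x ^ θ) (by positivity) m
    have h3 : x ^ 2 ≤ (x ^ θ) ^ m := by
      rw [← Real.rpow_natCast, ← Real.rpow_natCast, ← Real.rpow_mul hx]
      exact Real.rpow_le_rpow_of_exponent_le hx1 (by push_cast; linarith)
    rw [mul_pow, div_le_iff₀ (by positivity)] at h2
    have h4 : (x ^ θ) ^ m ≤ M * Real.exp (c * x ^ θ) := by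
      rw [div_mul_eq_mul_div, le_div_iff₀ (by positivity)]
      linarith
    nlinarith

namespace IsProfile

/-- In the variable x_n = u/a_n the sum is a discretisation of u⁻¹ ∫ e^{-c x^θ} dx. Each term from
level 1 on is bounded by a multiple of 1/u times the increment of x/(1+x), and these telescope; the
root term is bounded by 1/b separately. -/
lemma exists_diagSum_le (hb₀ : 0 < b) (hb : b < 1) (hc : 0 < c) (hθ : 0 < θ) :
    ∃ K > 0, ∀ {a g S : ℕ → ℝ}, IsProfile b c C θ a g S → ∀ u > 0, ∀ n,
      diagSum a g S (u ^ θ) n ≤ K * (1 + 1 / u) := by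
  obtain ⟨K, hK, hexp⟩ := exists_exp_neg_rpow_le hc hθ
  set L := K / b ^ 2
  have hL : 0 < L := by positivity
  refine ⟨1 / b + L, by positivity, fun {a g S} h u hu n => ?_⟩
  have hb1 : 1 ≤ 1 / b := (one_le_div hb₀).2 hb.le
  have key : ∀ n, 1 ≤ n → diagSum a g S (u ^ θ) n ≤
      1 / b + L * (1 / u) * (u / a n / (1 + u / a n)) := by
    intro n hn
    induction n, hn using Nat.le_induction with
    | base =>
      have h0 : diagSum a g S (u ^ θ) 1 ≤ 1 / b := by
        rw [diagSum_succ, diagSum_zero, h.sum_zero, h.zero]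
        have h1 : Real.exp (-(0 + g 0) * u ^ θ) ≤ 1 := Real.exp_le_one_iff.2 (by
          have := mul_nonneg (h.nonneg 0) (Real.rpow_nonneg hu.le θ)
          linarith)
        have h2 := h.inv_sub_nonneg 0
        rw [h.zero] at h2
        have h3 := h.mul_le_succ 0
        rw [h.zero, mul_one] at h3
        have h4 := one_div_le_one_div_of_le hb₀ h3
        simp only [zero_add] at *
        nlinarith
      have := h.pos 1
      have : 0 ≤ L * (1 / u) * (u / a 1 / (1 + u / a 1)) := by positivity
      linarith
    | succ n hn ih =>
      rw [diagSum_succ]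
      have ha := h.pos n
      have ha' := h.pos (n + 1)
      have hS := h.sum_nonneg n
      set x := u / a n with hx
      set y := u / a (n + 1) with hy
      have hx0 : 0 < x := by positivity
      have hy0 : 0 < y := by positivity
      have h1 : 1 / a (n + 1) - 1 / a n = (1 / u) * (y - x) := by
        rw [hx, hy]; field_simp
      have hyx : x ≤ y := div_le_div_of_nonneg_left hu.le ha' (h.succ_le n)
      have hyx' : b * y ≤ x := by
        rw [hx, hy, ← mul_div_assoc, div_le_div_iff₀ ha' ha]
        nlinarith [h.mul_le_succ n]
      have h2 : Real.exp (-(S n + g n) * u ^ θ) ≤ K / (1 + x) ^ 2 := by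
        refine le_trans (Real.exp_le_exp.2 ?_) (hexp x hx0.le)
        rw [hx, ← rpow_neg_mul_rpow ha hu, ← mul_assoc]
        have := mul_le_mul_of_nonneg_right (h.ge n hn) (Real.rpow_nonneg hu.le θ)
        nlinarith [mul_nonneg hS (Real.rpow_nonneg hu.le θ)]
      have h3 : Real.exp (-(S n + g n) * u ^ θ) * (1 / a (n + 1) - 1 / a n) ≤
          L * (1 / u) * (y / (1 + y) - x / (1 + x)) := by
        rw [h1]
        have h4 : y / (1 + y) - x / (1 + x) = (y - x) / ((1 + x) * (1 + y)) := by
          field_simp; ring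
        -- Consecutive values of u/a_n are comparable, so one factor 1+x can be traded for 1+y,
        -- producing the telescoping form.
        have h5 : K / (1 + x) ^ 2 ≤ L / ((1 + x) * (1 + y)) := by
          rw [div_le_div_iff₀ (by positivity) (by positivity), div_mul_eq_mul_div,
            le_div_iff₀ (by positivity)]
          have h6 : b * (1 + y) ≤ 1 + x := by linarith
          have h7 : b ^ 2 * (1 + y) ≤ 1 + x := by nlinarith
          calc K * ((1 + x) * (1 + y)) * b ^ 2 = K * (1 + x) * (b ^ 2 * (1 + y)) := by ring
            _ ≤ K * (1 + x) * (1 + x) := by gcongr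
            _ = _ := by ring
        have h8 : 0 ≤ 1 / u * (y - x) := mul_nonneg (by positivity) (by linarith)
        rw [h4]
        calc _ ≤ L / ((1 + x) * (1 + y)) * (1 / u * (y - x)) :=
              mul_le_mul_of_nonneg_right (h2.trans h5) h8
          _ = _ := by ring
      nlinarith
  have hu' : 0 < 1 / u := by positivity
  rcases Nat.eq_zero_or_pos n with rfl | hn
  · rw [diagSum_zero]
    nlinarith
  · have hx : 0 < u / a n := div_pos hu (h.pos n)
    have h1 : u / a n / (1 + u / a n) ≤ 1 := (div_le_one (by positivity)).2 (by linarith)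
    have h2 := mul_le_mul_of_nonneg_left h1 (show 0 ≤ L * (1 / u) by positivity)
    have h3 := key n hn
    nlinarith [mul_pos (show 0 < 1 / b by positivity) hu']

lemma antitone (h : IsProfile b c C θ a g S) : Antitone a := antitone_nat_of_succ_le h.succ_le

lemma le_pow (h : IsProfile b c C θ a g S) (hb : b < 1) (n : ℕ) : a (n + 1) ≤ (1 - b) ^ n := by
  induction n with
  | zero => simpa using h.a_le_one 1
  | succ n ih =>
    rw [pow_succ']
    exact (h.succ_le_mul (n + 1) (by omega)).trans (mul_le_mul_of_nonneg_left ih (by linarith))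

lemma exists_le (h : IsProfile b c C θ a g S) (hb₀ : 0 < b) (hb : b < 1) {v : ℝ} (hv : 0 < v) :
    ∃ n, a n ≤ v := by
  obtain ⟨n, hn⟩ := exists_pow_lt_of_lt_one hv (show 1 - b < 1 by linarith)
  exact ⟨n + 1, (h.le_pow hb n).trans hn.le⟩

/-- Locates the level at which the cylinder measure passes the scale `v`. The measure drops by at
most the factor `b` per level, so at the first such level it is still at least `b * v`, unless that
level is the root. -/
lemma exists_first (h : IsProfile b c C θ a g S) (hb₀ : 0 < b) (hb : b < 1) {v : ℝ}
    (hv : 0 < v) : ∃ m, a m ≤ v ∧ (m = 0 ∨ b * v ≤ a m) ∧ ∀ j, a j ≤ v → m ≤ j := by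
  classical
  have hex := h.exists_le hb₀ hb hv
  refine ⟨Nat.find hex, Nat.find_spec hex, ?_, fun j hj => Nat.find_min' hex hj⟩
  rcases hm : Nat.find hex with _ | m
  · exact Or.inl rfl
  · refine Or.inr ?_
    have h1 := Nat.find_min hex (m := m) (by omega)
    have h2 := h.mul_le_succ m
    nlinarith

/-- At the first level m with a_m ≤ u, the exponent S_m u^θ is bounded because S_m is at most a
multiple of a_m^{-θ}. Then `exp_neg_sum_le` gives D_m ≥ L/a_m ≥ L/u, and D increases with the level.
-/
lemma exists_le_diagSum (hb₀ : 0 < b) (hb : b < 1) (hθ : 0 < θ) (hC : 0 ≤ C) :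
    ∃ L > 0, ∀ {a g S : ℕ → ℝ}, IsProfile b c C θ a g S → ∀ u > 0, ∀ n, a n ≤ u →
      L * (1 + 1 / u) ≤ diagSum a g S (u ^ θ) n := by
  set K := C / (1 - (1 - b) ^ θ) with hKdef
  have hr1 : (1 - b) ^ θ < 1 := Real.rpow_lt_one (by linarith) (by linarith) hθ
  have hK : 0 ≤ K := div_nonneg hC (by linarith)
  set L := Real.exp (-(K * (1 / b) ^ θ))
  have hL : 0 < L := Real.exp_pos _
  have hL1 : L ≤ 1 := Real.exp_le_one_iff.2 (by
    have : 0 ≤ K * (1 / b) ^ θ := by positivity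
    linarith)
  refine ⟨L / 2, by positivity, fun {a g S} h u hu n hn => ?_⟩
  have h1 := h.one_le_diagSum (u ^ θ) n
  have h2 : L * (1 / u) ≤ diagSum a g S (u ^ θ) n := by
    obtain ⟨m, hm, hm', hmin⟩ := h.exists_first hb₀ hb hu
    rcases hm' with rfl | hm'
    · rw [h.zero] at hm
      have : 1 / u ≤ 1 := (div_le_one hu).2 hm
      have : L * (1 / u) ≤ 1 * 1 := mul_le_mul hL1 this (by positivity) (by norm_num)
      linarith
    · refine le_trans ?_ (h.diagSum_mono _ (hmin n hn))
      have ha := h.pos m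
      have h3 := h.exp_neg_sum_le (u ^ θ) m
      have h4 : L ≤ Real.exp (-S m * u ^ θ) := by
        refine Real.exp_le_exp.2 ?_
        have h5 := mul_le_mul_of_nonneg_right (h.sum_le hb₀ hb hθ hC m) (Real.rpow_nonneg hu.le θ)
        rw [mul_assoc, rpow_neg_mul_rpow ha hu, ← hKdef] at h5
        have h6 : (u / a m) ^ θ ≤ (1 / b) ^ θ := by
          refine Real.rpow_le_rpow (by positivity) ?_ hθ.le
          rw [div_le_div_iff₀ ha hb₀]
          linarith
        have h7 := mul_le_mul_of_nonneg_left h6 hK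
        linarith
      have h5 : diagSum a g S (u ^ θ) m * a m ≤ diagSum a g S (u ^ θ) m * u :=
        mul_le_mul_of_nonneg_left hm (zero_le_one.trans (h.one_le_diagSum _ _))
      rw [mul_one_div, div_le_iff₀ hu]
      linarith
  have h3 : L * 1 ≤ 1 := by linarith
  linarith

lemma eig_le (h : IsProfile b c C θ a g S) (hb₀ : 0 < b) (hb : b < 1) (hθ : 0 < θ) (hC : 0 ≤ C)
    (n : ℕ) : S n + g n ≤ (C / (1 - (1 - b) ^ θ) + C) * a n ^ (-θ) := by
  rw [add_mul]
  exact add_le_add (h.sum_le hb₀ hb hθ hC n) (h.le n)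

/-- The last summand `g n` is a fixed fraction of the eigenvalue. The lower bound on `g n` is a
separate hypothesis so that a branching root is covered as well. -/
lemma exists_mul_eig_le (hb₀ : 0 < b) (hb : b < 1) (hc : 0 < c) (hθ : 0 < θ) (hC : 0 < C) :
    ∃ L > 0, ∀ {a g S : ℕ → ℝ}, IsProfile b c C θ a g S → ∀ n, c * a n ^ (-θ) ≤ g n →
      L * (S n + g n) ≤ g n := by
  have hr1 : (1 - b) ^ θ < 1 := Real.rpow_lt_one (by linarith) (by linarith) hθ
  set K := C / (1 - (1 - b) ^ θ) + C with hK
  have hK0 : 0 < K := add_pos (div_pos hC (by linarith)) hC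
  refine ⟨c / K, by positivity, fun {a g S} h n hn => ?_⟩
  have h1 := h.eig_le hb₀ hb hθ hC.le n
  rw [← hK] at h1
  refine le_trans ?_ hn
  rw [div_mul_eq_mul_div, div_le_iff₀ hK0]
  nlinarith

/-- For t(S_n + g_n) ≤ 1 the factor e^{-S_n t} is at least 1/e, and 1 - e^{-y} ≥ y/2 on [0,1]. -/
lemma exists_le_offDiag_of_le (hb₀ : 0 < b) (hb : b < 1) (hc : 0 < c) (hθ : 0 < θ) (hC : 0 < C) :
    ∃ L > 0, ∀ {a g S : ℕ → ℝ}, IsProfile b c C θ a g S → ∀ t > 0, ∀ n,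
      c * a n ^ (-θ) ≤ g n → t * (S n + g n) ≤ 1 →
        L * (t * (S n + g n) / a n) ≤ offDiag a g S t n := by
  obtain ⟨L, hL, hLg⟩ := exists_mul_eig_le hb₀ hb hc hθ hC
  refine ⟨Real.exp (-1) / 2 * L, by positivity, fun {a g S} h t ht n hn htn => ?_⟩
  refine le_trans ?_ (h.le_offDiag t n)
  have ha := h.pos n
  have hS := h.sum_nonneg n
  have hg := h.nonneg n
  rw [← mul_div_assoc]
  refine div_le_div_of_nonneg_right ?_ ha.le
  have h1 : Real.exp (-1) ≤ Real.exp (-S n * t) := Real.exp_le_exp.2 (by nlinarith)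
  have hy0 : 0 ≤ g n * t := by positivity
  have hy1 : g n * t ≤ 1 := by nlinarith
  have h2 : Real.exp (-(g n * t)) ≤ 1 / (1 + g n * t) := by
    rw [Real.exp_neg, inv_eq_one_div]
    exact one_div_le_one_div_of_le (by linarith) (by linarith [Real.add_one_le_exp (g n * t)])
  have h3 : 1 / (1 + g n * t) ≤ 1 - g n * t / 2 := by
    rw [div_le_iff₀ (by linarith)]
    nlinarith
  have h4 := hLg h n hn
  have h5 : L * (t * (S n + g n)) / 2 ≤ 1 - Real.exp (-(g n * t)) := by nlinarith
  calc Real.exp (-1) / 2 * L * (t * (S n + g n))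
      = Real.exp (-1) * (L * (t * (S n + g n)) / 2) := by ring
    _ ≤ _ := mul_le_mul h1 h5 (by positivity) (Real.exp_pos _).le

/-- Two regimes for x = u/a_n. For large x the subtracted term of `offDiag` is absorbed by the
diagonal lower bound. For bounded x, the assumption also keeps x away from 0, so a_n is comparable
to u and `le_offDiag` gives a bound of order 1/a_n. -/
lemma exists_le_offDiag_of_lt (hb₀ : 0 < b) (hb : b < 1) (hc : 0 < c) (hθ : 0 < θ) (hC : 0 < C) :
    ∃ L > 0, ∀ {a g S : ℕ → ℝ}, IsProfile b c C θ a g S → ∀ u > 0, ∀ n,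
      c * a n ^ (-θ) ≤ g n → 1 < u ^ θ * (S n + g n) →
        L * (1 + 1 / u) ≤ offDiag a g S (u ^ θ) n := by
  obtain ⟨L₁, hL₁, hdiag⟩ := exists_le_diagSum (c := c) hb₀ hb hθ hC.le
  obtain ⟨L₂, hL₂, hLg⟩ := exists_mul_eig_le hb₀ hb hc hθ hC
  obtain ⟨K₂, hK₂, hexp⟩ := exists_exp_neg_rpow_le hc hθ
  have hr1 : (1 - b) ^ θ < 1 := Real.rpow_lt_one (by linarith) (by linarith) hθ
  set K := C / (1 - (1 - b) ^ θ) with hKdef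
  have hK0 : 0 < K := div_pos hC (by linarith)
  -- Beyond `X`, K₂ x/(1+x)² ≤ L₁/2; moreover `X ≥ 1` ensures a_n ≤ u, as the diagonal bound
  -- requires.
  set X := max 1 (2 * K₂ / L₁)
  have hX1 : 1 ≤ X := le_max_left _ _
  have hX2 : 2 * K₂ / L₁ ≤ X := le_max_right _ _
  -- Since u^θ(S_n + g_n) ≤ (K + C) x^θ, the assumption forces x ≥ x₀.
  set x₀ := (1 / (K + C)) ^ θ⁻¹
  have hx₀ : 0 < x₀ := by positivity
  set E := Real.exp (-(K * X ^ θ)) * (1 - Real.exp (-L₂))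
  have hE : 0 < E := mul_pos (Real.exp_pos _) (sub_pos.2 (Real.exp_lt_one_iff.2 (by linarith)))
  refine ⟨min (L₁ / 2) (E * (min 1 x₀ / 2)), by positivity, fun {a g S} h u hu n hn hun => ?_⟩
  have ha := h.pos n
  have hu' : 0 < 1 + 1 / u := by positivity
  set x := u / a n with hx
  have hx0 : 0 < x := by positivity
  have hut : 0 < u ^ θ := Real.rpow_pos_of_pos hu θ
  rcases le_total X x with hXx | hxX
  · refine (mul_le_mul_of_nonneg_right (min_le_left _ _) hu'.le).trans ?_
    have hau : a n ≤ u := by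
      have := hX1.trans hXx
      rwa [hx, one_le_div ha] at this
    have h1 := hdiag h u hu n hau
    have h2 : Real.exp (-(S n + g n) * u ^ θ) ≤ K₂ / (1 + x) ^ 2 := by
      refine le_trans (Real.exp_le_exp.2 ?_) (hexp x hx0.le)
      rw [hx, ← rpow_neg_mul_rpow ha hu, ← mul_assoc]
      have := mul_le_mul_of_nonneg_right hn hut.le
      nlinarith [mul_nonneg (h.sum_nonneg n) hut.le]
    have h3 : Real.exp (-(S n + g n) * u ^ θ) / a n ≤ L₁ / 2 * (1 / u) := by
      have h4 : 1 / a n = x * (1 / u) := by rw [hx]; field_simp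
      rw [div_eq_mul_one_div, h4, ← mul_assoc]
      refine mul_le_mul_of_nonneg_right ?_ (by positivity)
      refine (mul_le_mul_of_nonneg_right h2 hx0.le).trans ?_
      rw [div_le_iff₀ hL₁] at hX2
      rw [div_mul_eq_mul_div, div_le_iff₀ (by positivity)]
      have h5 : 2 * K₂ ≤ x * L₁ := hX2.trans (by gcongr)
      nlinarith [mul_le_mul_of_nonneg_right h5 hx0.le, mul_pos hL₁ hx0]
    rw [offDiag]
    nlinarith
  · refine (mul_le_mul_of_nonneg_right (min_le_right _ _) hu'.le).trans ?_
    refine le_trans ?_ (h.le_offDiag _ n)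
    have h1 : Real.exp (-(K * X ^ θ)) ≤ Real.exp (-S n * u ^ θ) := by
      refine Real.exp_le_exp.2 ?_
      have h5 := mul_le_mul_of_nonneg_right (h.sum_le hb₀ hb hθ hC.le n) hut.le
      rw [mul_assoc, rpow_neg_mul_rpow ha hu, ← hKdef] at h5
      have h6 : (u / a n) ^ θ ≤ X ^ θ := Real.rpow_le_rpow hx0.le hxX hθ.le
      have h7 := mul_le_mul_of_nonneg_left h6 hK0.le
      linarith
    have h2 : Real.exp (-(g n * u ^ θ)) ≤ Real.exp (-L₂) := by
      refine Real.exp_le_exp.2 ?_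
      have := mul_le_mul_of_nonneg_right (hLg h n hn) hut.le
      nlinarith
    have h3 : min 1 x₀ / 2 * (1 + 1 / u) ≤ 1 / a n := by
      have h4 : 1 ≤ 1 / a n := (one_le_div ha).2 (h.a_le_one n)
      have h5 : x₀ * (1 / u) ≤ 1 / a n := by
        have h6 : x₀ ≤ x := by
          have h7 : 1 / (K + C) ≤ x ^ θ := by
            rw [div_le_iff₀ (by positivity), hx, ← rpow_neg_mul_rpow ha hu]
            have := mul_le_mul_of_nonneg_left (h.eig_le hb₀ hb hθ hC.le n) hut.le
            rw [← hKdef] at this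
            linarith
          have h8 := Real.rpow_le_rpow (by positivity) h7 (inv_nonneg.2 hθ.le)
          rwa [Real.rpow_rpow_inv hx0.le hθ.ne'] at h8
        have h9 : 1 / a n = x * (1 / u) := by rw [hx]; field_simp
        rw [h9]
        gcongr
      have h6 : min 1 x₀ ≤ 1 := min_le_left _ _
      have h7 : min 1 x₀ * (1 / u) ≤ x₀ * (1 / u) :=
        mul_le_mul_of_nonneg_right (min_le_right _ _) (by positivity)
      linarith
    rw [div_eq_mul_one_div _ (a n), mul_assoc]
    refine mul_le_mul ?_ h3 (by positivity) ?_
    · have h5 : 0 ≤ 1 - Real.exp (-L₂) := sub_nonneg.2 (Real.exp_le_one_iff.2 (by linarith))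
      exact mul_le_mul h1 (by linarith) h5 (Real.exp_pos _).le
    · have := Real.exp_le_one_iff.2 (show -L₂ ≤ 0 by linarith)
      exact mul_nonneg (Real.exp_pos _).le (by linarith)

/-- A summable majorant independent of the branch: (u/a_n)⁻² · a_n⁻¹ = a_n/u², and a_n decays
geometrically. -/
lemma exists_level_bound (hb₀ : 0 < b) (hb : b < 1) (hc : 0 < c) (hθ : 0 < θ) :
    ∃ K > 0, ∀ {a g S : ℕ → ℝ}, IsProfile b c C θ a g S → ∀ u > 0, ∀ n,
      Real.exp (-(S n + g n) * u ^ θ) * (1 / a (n + 1) + 1 / a n) ≤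
        K * (1 + 1 / u ^ 2) * (1 - b) ^ n := by
  obtain ⟨K, hK, hexp⟩ := exists_exp_neg_rpow_le hc hθ
  have hb' : 0 < 1 - b := by linarith
  refine ⟨2 / b * (1 + K / (1 - b)), by positivity, fun {a g S} h u hu n => ?_⟩
  have ha := h.pos n
  have hut : 0 < u ^ θ := Real.rpow_pos_of_pos hu θ
  have h1 : 1 / a (n + 1) + 1 / a n ≤ 2 / b * (1 / a n) := by
    have h2 : 1 / a (n + 1) ≤ 1 / (b * a n) :=
      one_div_le_one_div_of_le (by positivity) (h.mul_le_succ n)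
    have h3 : 1 / a n ≤ 1 / (b * a n) :=
      one_div_le_one_div_of_le (by positivity) (by nlinarith)
    calc _ ≤ 1 / (b * a n) + 1 / (b * a n) := add_le_add h2 h3
      _ = _ := by field_simp; ring
  have h2 : Real.exp (-(S n + g n) * u ^ θ) * (1 / a n) ≤
      (1 + K / (1 - b)) * (1 + 1 / u ^ 2) * (1 - b) ^ n := by
    rcases Nat.eq_zero_or_pos n with rfl | hn
    · rw [h.zero, pow_zero, mul_one, div_one, mul_one]
      have h3 : Real.exp (-(S 0 + g 0) * u ^ θ) ≤ 1 := Real.exp_le_one_iff.2 (by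
        have := mul_nonneg (add_nonneg (h.sum_nonneg 0) (h.nonneg 0)) hut.le
        linarith)
      have h4 : 0 < K / (1 - b) := by positivity
      have h5 : 0 < 1 / u ^ 2 := by positivity
      nlinarith [mul_pos h4 h5]
    · obtain ⟨n, rfl⟩ := Nat.exists_eq_succ_of_ne_zero hn.ne'
      rw [Nat.succ_eq_add_one] at *
      set x := u / a (n + 1) with hx
      have hx0 : 0 < x := by positivity
      have h3 : Real.exp (-(S (n + 1) + g (n + 1)) * u ^ θ) ≤ K / (1 + x) ^ 2 := by
        refine le_trans (Real.exp_le_exp.2 ?_) (hexp x hx0.le)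
        rw [hx, ← rpow_neg_mul_rpow ha hu, ← mul_assoc]
        have := mul_le_mul_of_nonneg_right (h.ge (n + 1) hn) hut.le
        nlinarith [mul_nonneg (h.sum_nonneg (n + 1)) hut.le]
      have h4 : K / (1 + x) ^ 2 ≤ K / x ^ 2 := by gcongr; linarith
      calc _ ≤ K / x ^ 2 * (1 / a (n + 1)) := by gcongr; exact h3.trans h4
        _ = K * (1 / u ^ 2) * a (n + 1) := by rw [hx]; field_simp
        _ ≤ K * (1 / u ^ 2) * (1 - b) ^ n := by gcongr; exact h.le_pow hb n
        _ = K / (1 - b) * (1 / u ^ 2) * (1 - b) ^ (n + 1) := by field_simp; ring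
        _ ≤ _ := by gcongr <;> linarith
  calc _ ≤ Real.exp (-(S n + g n) * u ^ θ) * (2 / b * (1 / a n)) := by gcongr
    _ = 2 / b * (Real.exp (-(S n + g n) * u ^ θ) * (1 / a n)) := by ring
    _ ≤ 2 / b * ((1 + K / (1 - b)) * (1 + 1 / u ^ 2) * (1 - b) ^ n) := by gcongr
    _ = _ := by ring

/-- Produces a cylinder inside the ball of radius t = u^θ: points parting from `x` at level m or
later are closer than t. -/
lemma exists_ball_lower (hb₀ : 0 < b) (hb : b < 1) (hc : 0 < c) (hθ : 0 < θ) :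
    ∃ L > 0, ∀ {a g S : ℕ → ℝ}, IsProfile b c C θ a g S → ∀ u > 0, ∃ m,
      L / (1 + 1 / u) ≤ a m ∧
        ∀ n, m ≤ n → c * a n ^ (-θ) ≤ g n → 1 / (S n + g n) < u ^ θ := by
  -- Chosen so that a_n ≤ c' u implies u^θ(S_n + g_n) ≥ 2, with room for the strict inequality.
  set c' := (c / 2) ^ θ⁻¹
  have hc' : 0 < c' := by positivity
  refine ⟨min 1 (b * c'), by positivity, fun {a g S} h u hu => ?_⟩
  obtain ⟨m, hm, hm', -⟩ := h.exists_first hb₀ hb (show 0 < c' * u by positivity)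
  refine ⟨m, ?_, fun n hmn hn => ?_⟩
  · rw [div_le_iff₀ (by positivity)]
    rcases hm' with rfl | hm'
    · rw [h.zero]
      have : 0 < 1 / u := by positivity
      have := min_le_left 1 (b * c')
      linarith
    · have h1 := min_le_right 1 (b * c')
      have h2 : a m * (1 + 1 / u) ≥ b * (c' * u) * (1 / u) := by
        refine mul_le_mul hm' (by linarith) (by positivity) (h.pos m).le
      have h3 : b * (c' * u) * (1 / u) = b * c' := by field_simp
      linarith
  · have ha := h.pos n
    have han : a n ≤ c' * u := (h.antitone hmn).trans hm
    have hut : 0 < u ^ θ := Real.rpow_pos_of_pos hu θ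
    have h1 : 2 / c ≤ (u / a n) ^ θ := by
      have h2 : 1 / c' ≤ u / a n := by
        rw [div_le_div_iff₀ hc' ha]
        linarith
      have h3 := Real.rpow_le_rpow (by positivity) h2 hθ.le
      rwa [Real.div_rpow zero_le_one hc'.le, Real.one_rpow,
        Real.rpow_inv_rpow (by positivity) hθ.ne', one_div_div] at h3
    rw [← rpow_neg_mul_rpow ha hu, div_le_iff₀ hc] at h1
    have h2 : c * a n ^ (-θ) ≤ S n + g n := by linarith [h.sum_nonneg n]
    have h3 : 0 < S n + g n := lt_of_lt_of_le (by positivity) h2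
    rw [div_lt_iff₀ h3]
    nlinarith [mul_le_mul_of_nonneg_right h2 hut.le]

/-- Produces a cylinder containing the ball: a distance below u^θ forces a_n ≤ l u, hence a parting
level not before the first level with that property. -/
lemma exists_ball_upper (hb₀ : 0 < b) (hb : b < 1) (hθ : 0 < θ) (hC : 0 < C) :
    ∃ K > 0, ∀ {a g S : ℕ → ℝ}, IsProfile b c C θ a g S → ∀ u > 0, ∃ m,
      a m ≤ K / (1 + 1 / u) ∧
        ∀ n, 0 < g n → 1 / (S n + g n) < u ^ θ → m ≤ n := by
  have hr1 : (1 - b) ^ θ < 1 := Real.rpow_lt_one (by linarith) (by linarith) hθ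
  set K := C / (1 - (1 - b) ^ θ) + C with hKdef
  have hK0 : 0 < K := add_pos (div_pos hC (by linarith)) hC
  set l := K ^ θ⁻¹
  have hl : 0 < l := by positivity
  refine ⟨1 + l, by positivity, fun {a g S} h u hu => ?_⟩
  obtain ⟨m, hm, -, hmin⟩ := h.exists_first hb₀ hb (show 0 < l * u by positivity)
  refine ⟨m, ?_, fun n hg hn => hmin n ?_⟩
  · rw [le_div_iff₀ (by positivity), mul_add, mul_one]
    have h1 := mul_le_mul_of_nonneg_right hm (show 0 ≤ 1 / u by positivity)
    rw [mul_assoc, mul_one_div_cancel hu.ne', mul_one] at h1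
    linarith [h.a_le_one m]
  · have ha := h.pos n
    rw [div_lt_iff₀ (by linarith [h.sum_nonneg n])] at hn
    have h1 := mul_le_mul_of_nonneg_left (h.eig_le hb₀ hb hθ hC.le n)
      (Real.rpow_nonneg hu.le θ)
    have h2 : 1 / K ≤ (u / a n) ^ θ := by
      rw [div_le_iff₀ hK0, ← rpow_neg_mul_rpow ha hu]
      rw [← hKdef] at h1
      linarith
    have h3 := Real.rpow_le_rpow (by positivity) h2 (inv_nonneg.2 hθ.le)
    rw [Real.rpow_rpow_inv (by positivity) hθ.ne', Real.div_rpow zero_le_one hK0.le,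
      Real.one_rpow, div_le_div_iff₀ hl ha] at h3
    linarith

end IsProfile

end Profile

/-! ### Measures, weights and branching: every branch gives a profile with uniform constants. -/

section Estimates

variable {k : ℕ} [NeZero k] {V : Type*} [Fintype V] {A : Fin k → Matrix V V ℕ} {κ : V → ℝ}
  {μ : Measure (InfPath A)} {δ s : ℝ}

/-- The standing assumptions on the stationary Bratteli diagram, its measure and its weight. -/
structure IsAdmissible (κ : V → ℝ) (μ : Measure (InfPath A)) (δ s : ℝ) : Prop where
  one_lt_rho : ∀ i, 1 < rho A i
  perronFrobenius : IsPerronFrobenius A κ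
  selfSimilar : IsSelfSimilar κ μ
  delta_pos : 0 < δ
  delta_lt_one : δ < 1
  s_lt : s < 2 + δ
  diam : ∀ (n : ℕ) (v : V) (η : FinPath A n v), diamCyl κ δ (.path η) = weight κ δ (.path η)

/-- The growth exponent of the eigenvalues with respect to the inverse measure of cylinder sets. -/
noncomputable def growthExp (δ s : ℝ) : ℝ := 1 + (2 - s) / δ

lemma rhoProd_succ (A : Fin k → Matrix V V ℕ) (n : ℕ) :
    rhoProd A (n + 1) = rhoProd A n * rho A (cyc k n) := Finset.prod_range_succ _ _

lemma extSum_eq (μ : Measure (InfPath A)) (γ : Node A) : extSum μ γ =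
    (∑ e, μ.real (cyl (extend γ e))) ^ 2 - ∑ e, μ.real (cyl (extend γ e)) ^ 2 := by
  classical
  have h : ∑ p : Child γ × Child γ with p.1 = p.2,
      μ.real (cyl (extend γ p.1)) * μ.real (cyl (extend γ p.2)) =
      ∑ e, μ.real (cyl (extend γ e)) ^ 2 := by
    refine (Finset.sum_bij (fun e _ => (e, e)) ?_ ?_ ?_ ?_).symm
    · simp
    · intro a _ b _ h; exact congrArg Prod.fst h
    · rintro ⟨a, b⟩ h
      simp only [Finset.mem_filter, Finset.mem_univ, true_and] at h
      exact ⟨a, Finset.mem_univ _, by rw [h]⟩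
    · intro a _; exact sq _
  rw [← h, sq, Finset.sum_mul_sum, ← Finset.sum_product', Finset.univ_product_univ,
    ← Finset.sum_filter_add_sum_filter_not Finset.univ
      (fun p : Child γ × Child γ => p.1 = p.2), add_sub_cancel_left]
  unfold extSum
  congr!

lemma sum_measureReal_extend (μ : Measure (InfPath A)) [IsFiniteMeasure μ] (γ : Node A) :
    ∑ e, μ.real (cyl (extend γ e)) = μ.real (cyl γ) := by
  rw [← iUnion_cyl_extend γ, measureReal_iUnion_fintype (pairwise_disjoint_cyl_extend γ)
    fun e => measurableSet_cyl _]

lemma nodeSum_node_succ (κ : V → ℝ) (δ s : ℝ) (μ : Measure (InfPath A)) (x : InfPath A) (n : ℕ) :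
    nodeSum κ δ s μ (x.node (n + 1)) = nodeSum κ δ s μ (x.node n) +
      (μ.real (cyl (x.node (n + 1))) - μ.real (cyl (x.node n))) / G κ δ s μ (x.node n) := by
  cases n with
  | zero => simp [InfPath.node, InfPath.trunc, nodeSum, pathSum]
  | succ n => rfl

omit [Fintype V] in
lemma measureReal_extend_le (μ : Measure (InfPath A)) [IsFiniteMeasure μ] (γ : Node A)
    (e : Child γ) : μ.real (cyl (extend γ e)) ≤ μ.real (cyl γ) :=
  measureReal_mono (cyl_extend_subset γ e)

lemma weight_vertex (κ : V → ℝ) (δ : ℝ) (v : V) : weight κ δ (.path (.vertex v) : Node A) = κ v := by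
  simp [weight, rhoProd]

lemma extSum_nonneg (μ : Measure (InfPath A)) (γ : Node A) : 0 ≤ extSum μ γ := by
  apply Finset.sum_nonneg
  exact fun _ _ => mul_nonneg measureReal_nonneg measureReal_nonneg

lemma extSum_eq_zero (μ : Measure (InfPath A)) (γ : Node A) (hγ : ¬ Nontrivial (Child γ)) :
    extSum μ γ = 0 := by
  classical
  refine Finset.sum_eq_zero fun p hp => absurd ?_ (Finset.mem_filter.1 hp).2
  have := not_nontrivial_iff_subsingleton.1 hγ
  exact Subsingleton.elim _ _

namespace IsAdmissible

variable (H : IsAdmissible κ μ δ s)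
include H

lemma isProbabilityMeasure : IsProbabilityMeasure μ := H.selfSimilar.1

lemma growthExp_pos : 0 < growthExp δ s := by
  have h := H.delta_pos
  have h2 := H.s_lt
  rw [growthExp, show 1 + (2 - s) / δ = (δ + 2 - s) / δ by field_simp; ring]
  exact div_pos (by linarith) h

lemma rhoProd_pos (n : ℕ) : 0 < rhoProd A n :=
  Finset.prod_pos fun _ _ => zero_lt_one.trans (H.one_lt_rho _)

lemma measure_path {n : ℕ} {v : V} (η : FinPath A n v) :
    μ.real (cyl (.path η)) = (rhoProd A n)⁻¹ * κ v := H.selfSimilar.2 η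

lemma measure_vertex (v : V) : μ.real (cyl (.path (.vertex v))) = κ v := by
  rw [H.measure_path]
  simp [rhoProd]

lemma measure_empty : μ.real (cyl .empty) = 1 := by
  have := H.isProbabilityMeasure
  rw [cyl_empty, probReal_univ]

lemma measure_pos (γ : Node A) : 0 < μ.real (cyl γ) := by
  cases γ with
  | empty => rw [H.measure_empty]; exact one_pos
  | path η =>
    rw [H.measure_path]
    exact mul_pos (inv_pos.2 (H.rhoProd_pos _)) (H.perronFrobenius.pos _)

lemma cyl_nonempty (γ : Node A) : (cyl γ).Nonempty := by
  by_contra h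
  have := H.measure_pos γ
  rw [Set.not_nonempty_iff_eq_empty.1 h, measureReal_empty] at this
  exact this.false

lemma exists_node (γ : Node A) : ∃ (x : InfPath A) (n : ℕ), x.node n = γ :=
  let ⟨x, n, h⟩ := H.cyl_nonempty γ
  ⟨x, n, h⟩

lemma kappa_le_one (v : V) : κ v ≤ 1 := by
  rw [← H.perronFrobenius.sum_eq_one]
  exact Finset.single_le_sum (fun w _ => (H.perronFrobenius.pos w).le) (Finset.mem_univ v)

lemma kappa_lt_one [Nontrivial V] (v : V) : κ v < 1 := by
  classical
  obtain ⟨w, hw⟩ := exists_ne v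
  rw [← H.perronFrobenius.sum_eq_one]
  exact Finset.single_lt_sum hw (Finset.mem_univ v) (Finset.mem_univ w)
    (H.perronFrobenius.pos w) fun u _ _ => (H.perronFrobenius.pos u).le

lemma nonempty_vertex : Nonempty V := by
  obtain ⟨x, -⟩ := H.cyl_nonempty .empty
  exact ⟨x.vert 0⟩

lemma exists_le_kappa : ∃ c > 0, c ≤ 1 ∧ ∀ v, c ≤ κ v := by
  have := H.nonempty_vertex
  obtain ⟨v, hv⟩ := Finite.exists_min κ
  exact ⟨κ v, H.perronFrobenius.pos v, H.kappa_le_one v, hv⟩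

/-- Below a nonempty path the ratio of measures is κ_w/(ρ_i κ_v), at least min κ / max ρ because κ ≤
1. -/
lemma exists_mul_le_measure_extend : ∃ b > 0, b < 1 ∧ ∀ (γ : Node A) (e : Child γ),
    b * μ.real (cyl γ) ≤ μ.real (cyl (extend γ e)) := by
  obtain ⟨c, hc, hc1, hcκ⟩ := H.exists_le_kappa
  obtain ⟨i, hi⟩ := Finite.exists_max (rho A)
  have hρ := H.one_lt_rho i
  refine ⟨c / rho A i, by positivity, (div_lt_one (by linarith)).2 (by linarith), fun γ e => ?_⟩
  cases γ with
  | empty =>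
    rw [H.measure_empty, mul_one]
    exact ((div_le_self hc.le hρ.le).trans (hcκ e)).trans_eq (H.measure_vertex e).symm
  | @path n v η =>
    obtain ⟨w, e⟩ := e
    change _ ≤ μ.real (cyl (.path (.snoc η w e)))
    rw [H.measure_path, H.measure_path, rhoProd_succ]
    have h1 := H.rhoProd_pos n
    have h2 := H.one_lt_rho (cyc k n)
    have h3 := hi (cyc k n)
    have h4 := H.kappa_le_one v
    have h5 := H.perronFrobenius.pos v
    have h6 := hcκ w
    have h7 : c / rho A i * κ v ≤ κ w / rho A (cyc k n) := by
      rw [div_mul_eq_mul_div]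
      exact div_le_div₀ (hc.le.trans h6) (by nlinarith) (by linarith) h3
    calc c / rho A i * ((rhoProd A n)⁻¹ * κ v) = (rhoProd A n)⁻¹ * (c / rho A i * κ v) := by ring
      _ ≤ (rhoProd A n)⁻¹ * (κ w / rho A (cyc k n)) := by gcongr
      _ = _ := by field_simp

lemma weight_pos (γ : Node A) : 0 < weight κ δ γ := by
  cases γ with
  | empty => exact one_pos
  | path η => exact mul_pos (Real.rpow_pos_of_pos (H.rhoProd_pos _) _) (H.perronFrobenius.pos _)

/-- Monotonicity of μ along the edge says κ_w ≤ ρ κ_v, and ρ^{-1/δ} ρ < 1 since ρ > 1 and δ < 1. -/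
lemma weight_extend_lt {n : ℕ} {v : V} (η : FinPath A n v) (e : Child (.path η)) :
    weight κ δ (extend (.path η) e) < weight κ δ (.path η) := by
  have := H.isProbabilityMeasure
  have h0 := measureReal_extend_le μ (.path η) e
  obtain ⟨w, e⟩ := e
  change μ.real (cyl (.path (.snoc η w e))) ≤ _ at h0
  change weight κ δ (.path (.snoc η w e)) < _
  rw [H.measure_path, H.measure_path, rhoProd_succ] at h0
  rw [weight, weight, rhoProd_succ]
  have h1 := H.rhoProd_pos n
  set ρ := rho A (cyc k n) with hρdef
  have h2 : 1 < ρ := H.one_lt_rho (cyc k n)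
  have hρ0 : 0 < ρ := by linarith
  rw [mul_inv, mul_assoc, mul_le_mul_iff_right₀ (inv_pos.2 h1), inv_mul_le_iff₀ hρ0] at h0
  rw [Real.mul_rpow h1.le hρ0.le, mul_assoc]
  refine mul_lt_mul_of_pos_left ?_ (Real.rpow_pos_of_pos h1 _)
  have hv := H.perronFrobenius.pos v
  have h3 : ρ ^ (-1 / δ) * ρ < 1 := by
    rw [← Real.rpow_add_one hρ0.ne']
    refine Real.rpow_lt_one_of_one_lt_of_neg h2 ?_
    rw [neg_div, neg_add_lt_iff_lt_add, add_zero]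
    exact (one_lt_div H.delta_pos).2 H.delta_lt_one
  calc ρ ^ (-1 / δ) * κ w ≤ ρ ^ (-1 / δ) * (ρ * κ v) := by gcongr
    _ = ρ ^ (-1 / δ) * ρ * κ v := by ring
    _ < 1 * κ v := by gcongr
    _ = κ v := one_mul _

lemma weight_extend_lt_of_nontrivial (γ : Node A) [Nontrivial (Child γ)] (e : Child γ) :
    weight κ δ (extend γ e) < weight κ δ γ := by
  cases γ with
  | empty =>
    have : Nontrivial V := ‹Nontrivial (Child (.empty : Node A))›
    exact (weight_vertex κ δ e).trans_lt (H.kappa_lt_one e)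
  | path η => exact H.weight_extend_lt η e

lemma weight_extend_le (γ : Node A) (e : Child γ) :
    weight κ δ (extend γ e) ≤ weight κ δ γ := by
  cases γ with
  | empty => exact (weight_vertex κ δ e).trans_le (H.kappa_le_one e)
  | path η => exact (H.weight_extend_lt η e).le

lemma weight_node_antitone (x : InfPath A) : Antitone fun n => weight κ δ (x.node n) :=
  antitone_nat_of_succ_le fun n => by
    rw [node_succ]
    exact H.weight_extend_le _ _

lemma dWeight_le {x y : InfPath A} {γ : Node A} (hx : x ∈ cyl γ) (hy : y ∈ cyl γ) :
    dWeight κ δ x y ≤ weight κ δ γ := by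
  rw [dWeight]
  split_ifs with hxy
  · exact (H.weight_pos γ).le
  · obtain ⟨N, hN, hiff⟩ := exists_meet hxy
    rw [mem_cyl_iff] at hx hy
    have h1 := (hiff γ.level).1 (hx.trans hy.symm)
    rw [hN]
    conv_rhs => rw [← hx]
    exact H.weight_node_antitone x h1

/-- Paths sharing a child of γ are at distance at most the weight of that child, which is strictly
smaller. Hence the diameter is attained exactly by pairs splitting at γ, which identifies the values
of choice functions. -/
lemma dWeight_eq_iff {x y : InfPath A} {γ : Node A} [Nontrivial (Child γ)] (hx : x ∈ cyl γ)
    (hy : y ∈ cyl γ) : dWeight κ δ x y = weight κ δ γ ↔ Separates γ x y := by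
  rw [separates_iff]
  constructor
  · intro h
    by_cases hxy : x = y
    · rw [dWeight, if_pos hxy] at h
      exact absurd h (H.weight_pos γ).ne
    refine ⟨hxy, by_contra fun hne => ?_⟩
    obtain ⟨e, he⟩ := exists_mem_cyl_extend hx
    obtain ⟨e', he'⟩ := exists_mem_cyl_extend hy
    have hee : e = e' := by
      by_contra hee
      exact hne (separates_iff.1 ⟨e, e', hee, he, he'⟩).2
    subst hee
    have h1 := H.dWeight_le he he'
    have h2 := H.weight_extend_lt_of_nontrivial γ e
    linarith
  · rintro ⟨hxy, hm⟩
    rw [dWeight, if_neg hxy, hm]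

lemma exists_separates (γ : Node A) [h : Nontrivial (Child γ)] :
    ∃ x ∈ cyl γ, ∃ y ∈ cyl γ, Separates γ x y := by
  obtain ⟨e, e', hne⟩ := h
  obtain ⟨x, hx⟩ := H.cyl_nonempty (extend γ e)
  obtain ⟨y, hy⟩ := H.cyl_nonempty (extend γ e')
  exact ⟨x, cyl_extend_subset _ _ hx, y, cyl_extend_subset _ _ hy, e, e', hne, hx, hy⟩

lemma diamCyl_eq (γ : Node A) [Nontrivial (Child γ)] : diamCyl κ δ γ = weight κ δ γ := by
  obtain ⟨x, hx, y, hy, hxy⟩ := H.exists_separates γ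
  refine IsGreatest.csSup_eq ⟨⟨x, hx, y, hy, ((H.dWeight_eq_iff hx hy).2 hxy).symm⟩, ?_⟩
  rintro r ⟨x, hx, y, hy, rfl⟩
  exact H.dWeight_le hx hy

lemma choiceSet_eq (γ : Node A) [Nontrivial (Child γ)] :
    choiceSet κ δ γ = {z | Separates γ z.1 z.2} := by
  ext z
  rw [choiceSet, Set.mem_ofPred_eq, Set.mem_ofPred_eq, H.diamCyl_eq]
  constructor
  · rintro ⟨hx, hy, h⟩
    exact (H.dWeight_eq_iff hx hy).1 h
  · intro h
    have h' := h
    obtain ⟨e, e', -, hx, hy⟩ := h'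
    have hx' := cyl_extend_subset _ _ hx
    have hy' := cyl_extend_subset _ _ hy
    exact ⟨hx', hy', (H.dWeight_eq_iff hx' hy').2 h⟩

/-- If there were a single child, the diameter of the cylinder would be at most the child's weight,
strictly below the value prescribed by the diameter condition. -/
lemma nontrivial_child {n : ℕ} {v : V} (η : FinPath A n v) : Nontrivial (Child (.path η)) := by
  by_contra hsub
  rw [not_nontrivial_iff_subsingleton] at hsub
  obtain ⟨x₀, hx₀⟩ := H.cyl_nonempty (.path η)
  obtain ⟨e, he⟩ := exists_mem_cyl_extend hx₀
  have h1 := H.weight_extend_lt η e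
  have h2 : diamCyl κ δ (.path η) ≤ weight κ δ (extend (.path η) e) := by
    refine csSup_le ⟨_, x₀, hx₀, x₀, hx₀, rfl⟩ ?_
    rintro r ⟨x, hx, y, hy, rfl⟩
    obtain ⟨e₁, he₁⟩ := exists_mem_cyl_extend hx
    obtain ⟨e₂, he₂⟩ := exists_mem_cyl_extend hy
    rw [Subsingleton.elim e₁ e] at he₁
    rw [Subsingleton.elim e₂ e] at he₂
    exact H.dWeight_le he₁ he₂
  rw [H.diam] at h2
  linarith

lemma nontrivial_child_node (x : InfPath A) (n : ℕ) : Nontrivial (Child (x.node (n + 1))) :=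
  H.nontrivial_child _

lemma extSum_le (γ : Node A) : extSum μ γ ≤ μ.real (cyl γ) ^ 2 := by
  have := H.isProbabilityMeasure
  rw [extSum_eq, sum_measureReal_extend]
  have : 0 ≤ ∑ e, μ.real (cyl (extend γ e)) ^ 2 := Finset.sum_nonneg fun e _ => sq_nonneg _
  linarith

lemma le_extSum {b : ℝ} (hb : 0 < b)
    (h : ∀ (γ : Node A) (e : Child γ), b * μ.real (cyl γ) ≤ μ.real (cyl (extend γ e)))
    (γ : Node A) [hγ : Nontrivial (Child γ)] : b ^ 2 * μ.real (cyl γ) ^ 2 ≤ extSum μ γ := by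
  classical
  obtain ⟨e, e', hne⟩ := hγ
  have hpos := H.measure_pos γ
  refine le_trans ?_ (Finset.single_le_sum (s := Finset.univ.filter
    (fun p : Child γ × Child γ => p.1 ≠ p.2)) (f := fun p => μ.real (cyl (extend γ p.1)) *
      μ.real (cyl (extend γ p.2))) (fun _ _ => mul_nonneg measureReal_nonneg measureReal_nonneg)
      (a := (e, e')) (by simpa using hne)) |>.trans_eq ?_
  · rw [← mul_pow, sq]
    exact mul_le_mul (h γ e) (h γ e') (by positivity) measureReal_nonneg
  · unfold extSum
    congr!

lemma G_nonneg (γ : Node A) : 0 ≤ G κ δ s μ γ := by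
  have := extSum_nonneg μ γ
  have := H.weight_pos γ
  unfold G
  positivity

/-- Eliminating R_n between the formulas for w and μ leaves the factor κ_v^{1-1/δ}, which lies in a
bounded range above 1 because the exponent is nonpositive and κ ≤ 1. -/
lemma exists_weight_eq : ∃ D ≥ 1, ∀ γ : Node A, ∃ d, 1 ≤ d ∧ d ≤ D ∧
    weight κ δ γ = d * μ.real (cyl γ) ^ (1 / δ) := by
  obtain ⟨c, hc, hc1, hcκ⟩ := H.exists_le_kappa
  have hδ := H.delta_pos
  have hexp : 1 - 1 / δ ≤ 0 := by
    rw [sub_nonpos]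
    exact (one_le_div hδ).2 H.delta_lt_one.le
  have hD : 1 ≤ c ^ (1 - 1 / δ) := Real.one_le_rpow_of_pos_of_le_one_of_nonpos hc hc1 hexp
  refine ⟨c ^ (1 - 1 / δ), hD, fun γ => ?_⟩
  cases γ with
  | empty => exact ⟨1, le_rfl, hD, by rw [H.measure_empty]; simp [weight]⟩
  | @path n v η =>
    have hv := H.perronFrobenius.pos v
    have hR := H.rhoProd_pos n
    refine ⟨κ v ^ (1 - 1 / δ),
      Real.one_le_rpow_of_pos_of_le_one_of_nonpos hv (H.kappa_le_one v) hexp,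
      Real.rpow_le_rpow_of_nonpos hc (hcκ v) hexp, ?_⟩
    rw [H.measure_path, weight, Real.mul_rpow (by positivity) hv.le, Real.inv_rpow hR.le,
      ← Real.rpow_neg hR.le, mul_left_comm, ← Real.rpow_add hv]
    simp [neg_div]

lemma exists_G_bounds : ∃ c > 0, ∃ C > 0, ∀ γ : Node A,
    G κ δ s μ γ ≤ C * μ.real (cyl γ) ^ (1 + growthExp δ s) ∧
    (Nontrivial (Child γ) → c * μ.real (cyl γ) ^ (1 + growthExp δ s) ≤ G κ δ s μ γ) := by
  obtain ⟨b, hb, -, hbM⟩ := H.exists_mul_le_measure_extend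
  obtain ⟨D, hD, hw⟩ := H.exists_weight_eq
  have hD0 : 0 < D := by linarith
  -- The absolute value handles both signs of 2 - s.
  refine ⟨1 / 2 * D ^ (-|2 - s|) * b ^ 2, by positivity, 1 / 2 * D ^ |2 - s|, by positivity,
    fun γ => ?_⟩
  obtain ⟨d, hd1, hdD, hd⟩ := hw γ
  have hM := H.measure_pos γ
  have hd0 : 0 < d := by linarith
  set M := μ.real (cyl γ)
  have h1 : weight κ δ γ ^ (2 - s) = d ^ (2 - s) * M ^ ((2 - s) / δ) := by
    rw [hd, Real.mul_rpow hd0.le (by positivity), ← Real.rpow_mul hM.le]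
    congr 2
    ring
  have h2 : M ^ (1 + growthExp δ s) = M ^ ((2 - s) / δ) * M ^ 2 := by
    rw [growthExp, ← Real.rpow_natCast M 2, ← Real.rpow_add hM]
    congr 1
    push_cast
    ring
  have h3 : d ^ (2 - s) ≤ D ^ |2 - s| :=
    (Real.rpow_le_rpow_of_exponent_le hd1 (le_abs_self _)).trans
      (Real.rpow_le_rpow hd0.le hdD (abs_nonneg _))
  have h4 : D ^ (-|2 - s|) ≤ d ^ (2 - s) :=
    (Real.rpow_le_rpow_of_nonpos hd0 hdD (by simp)).trans
      (Real.rpow_le_rpow_of_exponent_le hd1 (neg_abs_le _))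
  have hMδ : 0 < M ^ ((2 - s) / δ) := by positivity
  have hE := extSum_nonneg μ γ
  have hE' := H.extSum_le γ
  rw [G, h1, h2]
  constructor
  · calc 1 / 2 * (d ^ (2 - s) * M ^ ((2 - s) / δ)) * extSum μ γ
        ≤ 1 / 2 * (D ^ |2 - s| * M ^ ((2 - s) / δ)) * M ^ 2 := by
          gcongr
      _ = _ := by ring
  · intro hγ
    calc 1 / 2 * D ^ (-|2 - s|) * b ^ 2 * (M ^ ((2 - s) / δ) * M ^ 2)
        = 1 / 2 * (D ^ (-|2 - s|) * M ^ ((2 - s) / δ)) * (b ^ 2 * M ^ 2) := by ring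
      _ ≤ 1 / 2 * (d ^ (2 - s) * M ^ ((2 - s) / δ)) * extSum μ γ := by
          gcongr
          exact H.le_extSum hb hbM γ

lemma G_pos (γ : Node A) [hγ : Nontrivial (Child γ)] : 0 < G κ δ s μ γ := by
  obtain ⟨c, hc, _, _, h⟩ := H.exists_G_bounds
  have := H.measure_pos γ
  exact lt_of_lt_of_le (by positivity) ((h γ).2 hγ)

/-- The bridge to the abstract estimates; the constants do not depend on `x`. The extra lower bound
at branching nodes recovers the root when there are several vertices. -/
lemma exists_profile : ∃ b > 0, b < 1 ∧ ∃ c > 0, ∃ C > 0, ∀ x : InfPath A,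
    IsProfile b c C (growthExp δ s) (fun n => μ.real (cyl (x.node n)))
      (fun n => μ.real (cyl (x.node n)) / G κ δ s μ (x.node n))
      (fun n => -nodeSum κ δ s μ (x.node n)) ∧
    ∀ n, Nontrivial (Child (x.node n)) →
      c * μ.real (cyl (x.node n)) ^ (-growthExp δ s) ≤
        μ.real (cyl (x.node n)) / G κ δ s μ (x.node n) := by
  have := H.isProbabilityMeasure
  obtain ⟨b, hb, hb1, hbM⟩ := H.exists_mul_le_measure_extend
  obtain ⟨c, hc, C, hC, hG⟩ := H.exists_G_bounds
  have hrpow (γ : Node A) : μ.real (cyl γ) ^ (1 + growthExp δ s) *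
      μ.real (cyl γ) ^ (-growthExp δ s) = μ.real (cyl γ) := by
    rw [← Real.rpow_add (H.measure_pos γ)]
    simp
  have hge (γ : Node A) (hγ : Nontrivial (Child γ)) :
      1 / C * μ.real (cyl γ) ^ (-growthExp δ s) ≤ μ.real (cyl γ) / G κ δ s μ γ := by
    rw [le_div_iff₀ (H.G_pos γ), one_div, inv_mul_eq_div, div_mul_eq_mul_div, div_le_iff₀ hC]
    have hM := H.measure_pos γ
    calc _ ≤ μ.real (cyl γ) ^ (-growthExp δ s) * (C * μ.real (cyl γ) ^ (1 + growthExp δ s)) := by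
          gcongr
          exact (hG γ).1
      _ = C * (μ.real (cyl γ) ^ (1 + growthExp δ s) * μ.real (cyl γ) ^ (-growthExp δ s)) := by ring
      _ = _ := by rw [hrpow, mul_comm]
  refine ⟨b, hb, hb1, 1 / C, by positivity, 1 / c, by positivity, fun x =>
    ⟨⟨H.measure_empty, fun n => H.measure_pos _, fun n => ?_, fun n => ?_, fun n hn => ?_,
      fun n => div_nonneg measureReal_nonneg (H.G_nonneg _), fun n => ?_, fun n hn => hge _ ?_,
      ?_, fun n => ?_⟩, fun n => hge _⟩⟩
  · rw [node_succ]; exact hbM _ _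
  · rw [node_succ]; exact measureReal_extend_le _ _ _
  -- A sibling of the next node takes at least the fraction `b` of the mass.
  · obtain ⟨n, rfl⟩ := Nat.exists_eq_succ_of_ne_zero (by omega : n ≠ 0)
    have := H.nontrivial_child_node x n
    classical
    obtain ⟨e, he⟩ := exists_ne (x.child (n + 1))
    rw [node_succ]
    have h1 := sum_measureReal_extend μ (x.node (n + 1))
    have h2 : μ.real (cyl (extend _ (x.child (n + 1)))) + μ.real (cyl (extend _ e)) ≤
        ∑ e, μ.real (cyl (extend (x.node (n + 1)) e)) := by
      rw [← Finset.sum_pair (f := fun e => μ.real (cyl (extend (x.node (n + 1)) e))) he.symm]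
      exact Finset.sum_le_sum_of_subset_of_nonneg (Finset.subset_univ _)
        fun _ _ _ => measureReal_nonneg
    have h3 := hbM _ e
    rw [Nat.succ_eq_add_one]
    linarith
  · have hM := H.measure_pos (x.node n)
    by_cases hγ : Nontrivial (Child (x.node n))
    · rw [div_le_iff₀ (H.G_pos _)]
      have h1 := mul_le_mul_of_nonneg_left ((hG _).2 hγ)
        (show 0 ≤ 1 / c * μ.real (cyl (x.node n)) ^ (-growthExp δ s) by positivity)
      refine le_trans (le_of_eq ?_) h1
      conv_lhs => rw [← hrpow]
      field_simp
    · rw [G, extSum_eq_zero μ _ hγ, mul_zero, div_zero]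
      positivity
  · obtain ⟨n, rfl⟩ := Nat.exists_eq_succ_of_ne_zero (by omega : n ≠ 0)
    exact H.nontrivial_child_node x n
  · simp [InfPath.node, nodeSum]
  · have hM := (H.measure_pos (x.node n)).ne'
    rw [nodeSum_node_succ]
    field_simp
    ring

end IsAdmissible

end Estimates

/-! ### The eigenspaces and their projection kernels. -/

section Kernel

variable {k : ℕ} [NeZero k] {V : Type*} {A : Fin k → Matrix V V ℕ}

/-- The indicator function of a cylinder set. -/
noncomputable def cylInd (γ : Node A) : InfPath A → ℝ := (cyl γ).indicator 1

lemma cylInd_of_mem {γ : Node A} {x : InfPath A} (h : x ∈ cyl γ) : cylInd γ x = 1 :=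
  Set.indicator_of_mem h _

lemma cylInd_of_notMem {γ : Node A} {x : InfPath A} (h : x ∉ cyl γ) : cylInd γ x = 0 :=
  Set.indicator_of_notMem h _

lemma cylInd_nonneg (γ : Node A) (x : InfPath A) : 0 ≤ cylInd γ x :=
  Set.indicator_nonneg (fun _ _ => zero_le_one) _

lemma cylInd_le_one (γ : Node A) (x : InfPath A) : cylInd γ x ≤ 1 :=
  Set.indicator_le_self' (fun _ _ => zero_le_one) _

lemma cylInd_congr {γ : Node A} {x y : InfPath A} (h : x.node γ.level = y.node γ.level) :
    cylInd γ x = cylInd γ y := by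
  by_cases hx : x ∈ cyl γ
  · rw [cylInd_of_mem hx, cylInd_of_mem (mem_cyl_iff.2 (h ▸ mem_cyl_iff.1 hx))]
  · rw [cylInd_of_notMem hx, cylInd_of_notMem fun hy => hx (mem_cyl_iff.2 (h ▸ mem_cyl_iff.1 hy))]

lemma measurable_cylInd (γ : Node A) : Measurable (cylInd γ) :=
  measurable_one.indicator (measurableSet_cyl γ)

lemma integral_cylInd (μ : Measure (InfPath A)) (γ : Node A) :
    ∫ x, cylInd γ x ∂μ = μ.real (cyl γ) := integral_indicator_one (measurableSet_cyl γ)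

lemma cylInd_empty (x : InfPath A) : cylInd .empty x = 1 :=
  cylInd_of_mem (by rw [cyl_empty]; trivial)

variable [Fintype V]

lemma sum_cylInd_extend (γ : Node A) (x : InfPath A) :
    ∑ e, cylInd (extend γ e) x = cylInd γ x := by
  by_cases hx : x ∈ cyl γ
  · obtain ⟨e, he⟩ := exists_mem_cyl_extend hx
    rw [Finset.sum_eq_single e, cylInd_of_mem he, cylInd_of_mem hx]
    · exact fun e' _ hne => cylInd_of_notMem fun h => hne (child_eq_of_mem h he)
    · simp
  · rw [cylInd_of_notMem hx]
    exact Finset.sum_eq_zero fun e _ => cylInd_of_notMem fun h => hx (cyl_extend_subset _ _ h)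

lemma sum_mul_cylInd_of_mem {γ : Node A} {e : Child γ} {x : InfPath A} (hx : x ∈ cyl (extend γ e))
    (v : Child γ → ℝ) : ∑ e, v e * cylInd (extend γ e) x = v e := by
  rw [Finset.sum_eq_single e, cylInd_of_mem hx, mul_one]
  · exact fun e' _ hne => by rw [cylInd_of_notMem fun h => hne (child_eq_of_mem h hx), mul_zero]
  · simp

variable {κ : V → ℝ} {μ : Measure (InfPath A)} {δ s : ℝ}

/-- Elements of E_γ are mean-zero step functions on the children of γ; measurability, boundedness,
support and vanishing integral are all read off from this form. -/
lemma exists_coeff {γ : Node A} {f : InfPath A → ℝ} (hf : f ∈ eigenspace μ γ)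
    (hμ : ∀ e : Child γ, μ.real (cyl (extend γ e)) ≠ 0) :
    ∃ v : Child γ → ℝ, ∑ e, v e * μ.real (cyl (extend γ e)) = 0 ∧
      ∀ x, f x = ∑ e, v e * cylInd (extend γ e) x := by
  classical
  induction hf using Submodule.span_induction with
  | mem f hf =>
    obtain ⟨e, e', -, rfl⟩ := hf
    refine ⟨Pi.single e (μ.real (cyl (extend γ e)))⁻¹ - Pi.single e' (μ.real (cyl (extend γ e')))⁻¹,
      ?_, fun x => ?_⟩
    · simp [sub_mul, Finset.sum_sub_distrib, Pi.single_apply, hμ]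
    · simp [sub_mul, Finset.sum_sub_distrib, Pi.single_apply, cylInd, div_eq_inv_mul]
  | zero => exact ⟨0, by simp, by simp⟩
  | add f g _ _ hf hg =>
    obtain ⟨v, hv, hfv⟩ := hf
    obtain ⟨w, hw, hgw⟩ := hg
    exact ⟨v + w, by simp [add_mul, Finset.sum_add_distrib, hv, hw],
      fun x => by simp [add_mul, Finset.sum_add_distrib, hfv, hgw]⟩
  | smul c f _ hf =>
    obtain ⟨v, hv, hfv⟩ := hf
    exact ⟨c • v, by simp [mul_assoc, ← Finset.mul_sum, hv],
      fun x => by simp [mul_assoc, ← Finset.mul_sum, hfv]⟩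

/-- The kernel of the orthogonal projection onto the eigenspace of `γ`. -/
noncomputable def projKernel (μ : Measure (InfPath A)) (γ : Node A) (x y : InfPath A) : ℝ :=
  ∑ e, cylInd (extend γ e) x / μ.real (cyl (extend γ e)) * cylInd (extend γ e) y
    - cylInd γ x / μ.real (cyl γ) * cylInd γ y

lemma projKernel_node (μ : Measure (InfPath A)) (x y : InfPath A) (n : ℕ) :
    projKernel μ (x.node n) x y = cylInd (x.node (n + 1)) y / μ.real (cyl (x.node (n + 1)))
      - cylInd (x.node n) y / μ.real (cyl (x.node n)) := by
  have hx : x ∈ cyl (extend (x.node n) (x.child n)) := by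
    rw [← node_succ]; exact self_mem_cyl_node x _
  have h := sum_mul_cylInd_of_mem hx fun e =>
    cylInd (extend (x.node n) e) y / μ.real (cyl (extend (x.node n) e))
  rw [projKernel, node_succ, cylInd_of_mem (self_mem_cyl_node x n), ← h]
  congr 1
  · exact Finset.sum_congr rfl fun e _ => by ring
  · ring

lemma projKernel_eq_zero (μ : Measure (InfPath A)) {γ : Node A} {x : InfPath A} (hx : x ∉ cyl γ)
    (y : InfPath A) : projKernel μ γ x y = 0 := by
  rw [projKernel, cylInd_of_notMem hx, Finset.sum_eq_zero]
  · simp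
  · intro e _
    rw [cylInd_of_notMem fun h => hx (cyl_extend_subset _ _ h)]
    simp

/-- For x in [γe], the kernel is the average over e', with weights μ[γe']/μ[γ], of the spanning
functions for the pairs (e, e'). -/
lemma projKernel_mem (μ : Measure (InfPath A)) [IsFiniteMeasure μ]
    (hμ : ∀ γ : Node A, μ.real (cyl γ) ≠ 0) (γ : Node A) (x : InfPath A) :
    projKernel μ γ x ∈ eigenspace μ γ := by
  by_cases hx : x ∈ cyl γ
  · obtain ⟨e, he⟩ := exists_mem_cyl_extend hx
    have h : projKernel μ γ x = ∑ e', (μ.real (cyl (extend γ e')) / μ.real (cyl γ)) •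
        fun y => cylInd (extend γ e) y / μ.real (cyl (extend γ e)) -
          cylInd (extend γ e') y / μ.real (cyl (extend γ e')) := by
      funext y
      rw [projKernel, cylInd_of_mem hx, Finset.sum_apply, Finset.sum_eq_single e]
      · rw [cylInd_of_mem he]
        simp only [Pi.smul_apply, smul_eq_mul, mul_sub, Finset.sum_sub_distrib]
        rw [← Finset.sum_mul, ← Finset.sum_div, sum_measureReal_extend, div_self (hμ γ)]
        have h1 : ∀ e', μ.real (cyl (extend γ e')) / μ.real (cyl γ) *
            (cylInd (extend γ e') y / μ.real (cyl (extend γ e'))) =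
            cylInd (extend γ e') y / μ.real (cyl γ) := fun e' => by
          have := hμ (extend γ e')
          field_simp
        simp only [h1]
        rw [← Finset.sum_div, sum_cylInd_extend]
        ring
      · intro e' _ hne
        rw [cylInd_of_notMem fun h => hne (child_eq_of_mem h he)]
        simp
      · simp
    rw [h]
    refine Submodule.sum_mem _ fun e' _ => Submodule.smul_mem _ _ ?_
    by_cases hee : e = e'
    · subst hee
      simp only [sub_self]
      exact Submodule.zero_mem _
    · exact Submodule.subset_span ⟨e, e', hee, rfl⟩
  · rw [show projKernel μ γ x = 0 from funext fun y => projKernel_eq_zero μ hx y]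
    exact Submodule.zero_mem _

namespace IsAdmissible

variable (H : IsAdmissible κ μ δ s)
include H

lemma exists_coeff {γ : Node A} {f : InfPath A → ℝ} (hf : f ∈ eigenspace μ γ) :
    ∃ v : Child γ → ℝ, ∑ e, v e * μ.real (cyl (extend γ e)) = 0 ∧
      ∀ x, f x = ∑ e, v e * cylInd (extend γ e) x :=
  KGraphHeat.exists_coeff hf fun _ => (H.measure_pos _).ne'

lemma measurable_eigenspace {γ : Node A} {f : InfPath A → ℝ} (hf : f ∈ eigenspace μ γ) :
    Measurable f := by
  obtain ⟨v, -, hfv⟩ := H.exists_coeff hf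
  rw [funext hfv]
  exact Finset.measurable_fun_sum _ fun e _ => (measurable_cylInd _).const_mul _

lemma eigenspace_congr {γ : Node A} {f : InfPath A → ℝ} (hf : f ∈ eigenspace μ γ) {x y : InfPath A}
    (h : x.node (γ.level + 1) = y.node (γ.level + 1)) : f x = f y := by
  obtain ⟨v, -, hfv⟩ := H.exists_coeff hf
  rw [hfv, hfv]
  refine Finset.sum_congr rfl fun e _ => ?_
  rw [← level_extend γ e] at h
  rw [cylInd_congr h]

lemma eigenspace_eq_zero {γ : Node A} {f : InfPath A → ℝ} (hf : f ∈ eigenspace μ γ)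
    {x : InfPath A} (hx : x ∉ cyl γ) : f x = 0 := by
  obtain ⟨v, -, hfv⟩ := H.exists_coeff hf
  rw [hfv]
  exact Finset.sum_eq_zero fun e _ => by
    rw [cylInd_of_notMem fun h => hx (cyl_extend_subset _ _ h), mul_zero]

lemma eigenspace_bounded {γ : Node A} {f : InfPath A → ℝ} (hf : f ∈ eigenspace μ γ) :
    ∃ M, ∀ x, |f x| ≤ M := by
  obtain ⟨v, -, hfv⟩ := H.exists_coeff hf
  refine ⟨∑ e, |v e|, fun x => ?_⟩
  rw [hfv]
  refine (Finset.abs_sum_le_sum_abs _ _).trans (Finset.sum_le_sum fun e _ => ?_)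
  rw [abs_mul, abs_of_nonneg (cylInd_nonneg _ _)]
  exact mul_le_of_le_one_right (abs_nonneg _) (cylInd_le_one _ _)

lemma integrable_eigenspace {γ : Node A} {f : InfPath A → ℝ} (hf : f ∈ eigenspace μ γ) :
    Integrable f μ := by
  have := H.isProbabilityMeasure
  obtain ⟨M, hM⟩ := H.eigenspace_bounded hf
  exact Integrable.of_bound (H.measurable_eigenspace hf).aestronglyMeasurable M (ae_of_all _ hM)

lemma integral_eigenspace {γ : Node A} {f : InfPath A → ℝ} (hf : f ∈ eigenspace μ γ) :
    ∫ x, f x ∂μ = 0 := by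
  have := H.isProbabilityMeasure
  obtain ⟨v, hv, hfv⟩ := H.exists_coeff hf
  simp only [hfv]
  rw [integral_finsetSum _ fun e _ => Integrable.const_mul
    (Integrable.of_bound (measurable_cylInd _).aestronglyMeasurable 1 (ae_of_all _ fun x => by
      rw [Real.norm_of_nonneg (cylInd_nonneg _ _)]; exact cylInd_le_one _ _)) _]
  simp only [integral_const_mul, integral_cylInd, hv]

/-- The integral of an eigenfunction over a cylinder set. -/
lemma integral_cylInd_mul {γ : Node A} {f : InfPath A → ℝ} (hf : f ∈ eigenspace μ γ)
    (x : InfPath A) (n : ℕ) : ∫ y, cylInd (x.node n) y * f y ∂μ =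
      if γ.level < n then μ.real (cyl (x.node n)) * f x else 0 := by
  split_ifs with hn
  · have h : ∀ y, cylInd (x.node n) y * f y = cylInd (x.node n) y * f x := fun y => by
      by_cases hy : y ∈ cyl (x.node n)
      · rw [H.eigenspace_congr hf (node_eq_of_le (Nat.succ_le_of_lt hn) (mem_cyl_node.1 hy))]
      · rw [cylInd_of_notMem hy, zero_mul, zero_mul]
    simp only [h]
    rw [integral_mul_const, integral_cylInd]
  -- At or above the level of γ, the cylinder either contains [γ], where `f` has mean zero, or is
  -- disjoint from it.
  · by_cases hx : ∃ y ∈ cyl γ, y ∈ cyl (x.node n)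
    · obtain ⟨y, hy, hyx⟩ := hx
      have h : ∀ z, cylInd (x.node n) z * f z = f z := fun z => by
        by_cases hz : z ∈ cyl γ
        · rw [cylInd_of_mem, one_mul]
          rw [mem_cyl_node] at hyx ⊢
          rw [mem_cyl_iff] at hy hz
          rw [← hyx]
          exact node_eq_of_le (not_lt.1 hn) (hz.trans hy.symm)
        · rw [H.eigenspace_eq_zero hf hz, mul_zero]
      simp only [h]
      exact H.integral_eigenspace hf
    · push Not at hx
      have h : ∀ z, cylInd (x.node n) z * f z = 0 := fun z => by
        by_cases hz : z ∈ cyl γ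
        · rw [cylInd_of_notMem (hx z hz), zero_mul]
        · rw [H.eigenspace_eq_zero hf hz, mul_zero]
      simp [h]

/-- The reproducing property: the averages of `f` over consecutive cylinders of the branch differ
only when passing from level |γ| to the next. -/
lemma integral_mul_projKernel {γ : Node A} {f : InfPath A → ℝ} (hf : f ∈ eigenspace μ γ)
    (x : InfPath A) (n : ℕ) : ∫ y, projKernel μ (x.node n) x y * f y ∂μ =
      if n = γ.level then f x else 0 := by
  have := H.isProbabilityMeasure
  obtain ⟨M, hM⟩ := H.eigenspace_bounded hf
  have hint (n : ℕ) : Integrable (fun y => cylInd (x.node n) y * f y) μ := by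
    refine (H.integrable_eigenspace hf).bdd_mul (c := 1)
      (measurable_cylInd _).aestronglyMeasurable (ae_of_all _ fun y => ?_)
    rw [Real.norm_of_nonneg (cylInd_nonneg _ _)]
    exact cylInd_le_one _ _
  simp only [projKernel_node, sub_mul, div_mul_eq_mul_div]
  rw [integral_sub ((hint _).div_const _) ((hint _).div_const _), integral_div, integral_div,
    H.integral_cylInd_mul hf, H.integral_cylInd_mul hf]
  have h1 := (H.measure_pos (x.node n)).ne'
  have h2 := (H.measure_pos (x.node (n + 1))).ne'
  rcases lt_trichotomy n γ.level with h | h | h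
  · simp [h.ne, show ¬ γ.level < n + 1 by omega, h.not_gt]
  · rw [if_pos (by omega), if_neg (by omega), if_pos h, zero_div, sub_zero,
      mul_div_cancel_left₀ _ h2]
  · rw [if_pos (by omega), if_pos h, if_neg h.ne']
    field_simp
    ring

variable {m : Node A → ℕ} {ψ : (γ : Node A) → Fin (m γ) → InfPath A → ℝ}
  (hψ : IsEigenbasis μ m ψ)
include hψ

/-- The kernel at `x` lies in E_γ, and by the reproducing property its coefficient along ψ_i is
ψ_i(x). -/
lemma sum_eigenbasis (γ : Node A) (x y : InfPath A) :
    ∑ j, ψ γ j x * ψ γ j y = projKernel μ γ x y := by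
  have := H.isProbabilityMeasure
  obtain ⟨hspan, horth⟩ := hψ γ
  have hmem (j : Fin (m γ)) : ψ γ j ∈ eigenspace μ γ := by
    rw [← hspan]
    exact Submodule.subset_span ⟨j, rfl⟩
  by_cases hx : x ∈ cyl γ
  swap
  · rw [projKernel_eq_zero μ hx]
    exact Finset.sum_eq_zero fun j _ => by rw [H.eigenspace_eq_zero (hmem j) hx, zero_mul]
  have hK := projKernel_mem μ (fun γ => (H.measure_pos γ).ne') γ x
  rw [← hspan, Submodule.mem_span_range_iff_exists_fun] at hK
  obtain ⟨c, hc⟩ := hK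
  have hc' (i : Fin (m γ)) : c i = ψ γ i x := by
    have h1 := H.integral_mul_projKernel (hmem i) x γ.level
    rw [mem_cyl_iff.1 hx, if_pos rfl, ← hc] at h1
    rw [← h1]
    simp only [Finset.sum_apply, Pi.smul_apply, smul_eq_mul, Finset.sum_mul, mul_assoc]
    rw [integral_finsetSum]
    · simp only [integral_const_mul, horth]
      simp
    · intro j _
      refine Integrable.const_mul ?_ _
      obtain ⟨M, hM⟩ := H.eigenspace_bounded (hmem j)
      exact (H.integrable_eigenspace (hmem i)).bdd_mul (c := M)
        (H.measurable_eigenspace (hmem j)).aestronglyMeasurable (ae_of_all _ hM)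
  rw [← hc]
  simp [hc']

lemma heatTerm_eq (t : ℝ) (x y : InfPath A) (γ : Node A) : heatTerm κ δ s μ ψ t x y γ =
    Real.exp (eigenvalue κ δ s μ γ * t) * projKernel μ γ x y := by
  rw [heatTerm, H.sum_eigenbasis hψ]

end IsAdmissible

end Kernel

/-! ### Convergence, continuity and two-sided bounds of the heat kernel. -/

section HeatKernel

variable {k : ℕ} [NeZero k] {V : Type*} {A : Fin k → Matrix V V ℕ} [Fintype V]
  {κ : V → ℝ} {μ : Measure (InfPath A)} {δ s : ℝ}

/-- The summand of the heat kernel at the initial sub-path of `x` of level `n`. -/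
noncomputable def levelTerm (κ : V → ℝ) (δ s : ℝ) (μ : Measure (InfPath A)) (t : ℝ)
    (x y : InfPath A) (n : ℕ) : ℝ :=
  Real.exp (eigenvalue κ δ s μ (x.node n) * t) * projKernel μ (x.node n) x y

omit [Fintype V] in
lemma isLocallyConstant_levelCoeff (F : Node A → Node A → Node A → Node A → ℝ) (n : ℕ) :
    IsLocallyConstant fun z : ℝ × InfPath A × InfPath A =>
      F (z.2.1.node n) (z.2.1.node (n + 1)) (z.2.2.node n) (z.2.2.node (n + 1)) := by
  have hx (n : ℕ) : IsLocallyConstant fun z : ℝ × InfPath A × InfPath A => z.2.1.node n :=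
    (isLocallyConstant_node n).comp_continuous (f := fun z : ℝ × InfPath A × InfPath A => z.2.1)
      (by fun_prop)
  have hy (n : ℕ) : IsLocallyConstant fun z : ℝ × InfPath A × InfPath A => z.2.2.node n :=
    (isLocallyConstant_node n).comp_continuous (f := fun z : ℝ × InfPath A × InfPath A => z.2.2)
      (by fun_prop)
  exact (((hx n).prodMk (hx (n + 1))).prodMk ((hy n).prodMk (hy (n + 1)))).comp
    fun p => F p.1.1 p.1.2 p.2.1 p.2.2

omit [Fintype V] in
lemma cylInd_node (x y : InfPath A) (n : ℕ) [Decidable (y.node n = x.node n)] :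
    cylInd (x.node n) y = if y.node n = x.node n then 1 else 0 := by
  split_ifs with h
  · exact cylInd_of_mem (mem_cyl_node.2 h)
  · exact cylInd_of_notMem fun h' => h (mem_cyl_node.1 h')

lemma continuous_levelTerm (κ : V → ℝ) (δ s : ℝ) (μ : Measure (InfPath A)) (n : ℕ) :
    Continuous fun z : ℝ × InfPath A × InfPath A => levelTerm κ δ s μ z.1 z.2.1 z.2.2 n := by
  classical
  have h1 := (isLocallyConstant_levelCoeff
    (fun γ _ _ _ : Node A => eigenvalue κ δ s μ γ) n).continuous
  have h2 := (isLocallyConstant_levelCoeff (fun γ γ' ζ ζ' : Node A =>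
    (if ζ' = γ' then 1 else 0) / μ.real (cyl γ') - (if ζ = γ then 1 else 0) / μ.real (cyl γ))
    n).continuous
  simp only [levelTerm, projKernel_node, cylInd_node]
  exact (Real.continuous_exp.comp (h1.mul continuous_fst)).mul h2

lemma eigenvalue_eq (κ : V → ℝ) (δ s : ℝ) (μ : Measure (InfPath A)) (γ : Node A) :
    eigenvalue κ δ s μ γ = -(-nodeSum κ δ s μ γ + μ.real (cyl γ) / G κ δ s μ γ) := by
  rw [eigenvalue]
  ring

lemma levelTerm_of_node_eq {x y : InfPath A} {n : ℕ} (h : x.node (n + 1) = y.node (n + 1))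
    (t : ℝ) : levelTerm κ δ s μ t x y n =
      Real.exp (-(-nodeSum κ δ s μ (x.node n) + μ.real (cyl (x.node n)) / G κ δ s μ (x.node n)) * t)
        * (1 / μ.real (cyl (x.node (n + 1))) - 1 / μ.real (cyl (x.node n))) := by
  rw [levelTerm, projKernel_node, cylInd_of_mem (mem_cyl_node.2 h.symm),
    cylInd_of_mem (mem_cyl_node.2 (node_eq_of_le n.le_succ h).symm), eigenvalue_eq]

namespace IsAdmissible

variable (H : IsAdmissible κ μ δ s)
include H

lemma abs_projKernel_le (x y : InfPath A) (n : ℕ) : |projKernel μ (x.node n) x y| ≤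
    1 / μ.real (cyl (x.node (n + 1))) + 1 / μ.real (cyl (x.node n)) := by
  have h1 := H.measure_pos (x.node n)
  have h2 := H.measure_pos (x.node (n + 1))
  rw [projKernel_node]
  refine (abs_sub _ _).trans (add_le_add ?_ ?_)
  all_goals
    rw [abs_of_nonneg (div_nonneg (cylInd_nonneg _ _) (by positivity))]
    exact div_le_div_of_nonneg_right (cylInd_le_one _ _) (by positivity)

/-- The Weierstrass majorant behind summability, continuity and all interchanges of sum and
integral. Eigenvalues are nonpositive, so the bound at `t₀` serves for all later times. -/
lemma exists_levelTerm_bound {t₀ : ℝ} (ht₀ : 0 < t₀) : ∃ B : ℕ → ℝ, Summable B ∧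
    ∀ t ≥ t₀, ∀ x y n, ‖levelTerm κ δ s μ t x y n‖ ≤ B n := by
  obtain ⟨b, hb, hb1, c, hc, C, hC, hprof⟩ := H.exists_profile
  have hθ := H.growthExp_pos
  obtain ⟨K, hK, hbound⟩ := IsProfile.exists_level_bound (C := C) hb hb1 hc hθ
  refine ⟨fun n => K * (1 + 1 / (t₀ ^ (growthExp δ s)⁻¹) ^ 2) * (1 - b) ^ n,
    (summable_geometric_of_lt_one (by linarith) (by linarith)).mul_left _,
    fun t ht x y n => ?_⟩
  have h := hbound (hprof x).1 (t₀ ^ (growthExp δ s)⁻¹) (by positivity) n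
  rw [Real.rpow_inv_rpow ht₀.le hθ.ne'] at h
  refine le_trans ?_ h
  rw [levelTerm, norm_mul, Real.norm_of_nonneg (Real.exp_pos _).le, Real.norm_eq_abs, eigenvalue_eq]
  refine mul_le_mul (Real.exp_le_exp.2 ?_) (H.abs_projKernel_le x y n) (abs_nonneg _)
    (Real.exp_pos _).le
  have h1 := (hprof x).1.sum_nonneg n
  have h2 := (hprof x).1.nonneg n
  nlinarith

lemma summable_levelTerm {t : ℝ} (ht : 0 < t) (x y : InfPath A) :
    Summable (levelTerm κ δ s μ t x y) := by
  obtain ⟨B, hB, hle⟩ := H.exists_levelTerm_bound ht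
  exact Summable.of_norm_bounded hB fun n => hle t le_rfl x y n

lemma integral_levelTerm_eigenspace {γ : Node A} {f : InfPath A → ℝ} (hf : f ∈ eigenspace μ γ)
    (t : ℝ) (x : InfPath A) (n : ℕ) : ∫ y, levelTerm κ δ s μ t x y n * f y ∂μ =
      if n = γ.level then Real.exp (eigenvalue κ δ s μ γ * t) * f x else 0 := by
  simp only [levelTerm, mul_assoc]
  rw [integral_const_mul, H.integral_mul_projKernel hf]
  split_ifs with h
  · by_cases hx : x ∈ cyl γ
    · rw [h, mem_cyl_iff.1 hx]
    · rw [H.eigenspace_eq_zero hf hx, mul_zero, mul_zero]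
  · rw [mul_zero]

lemma integral_levelTerm (t : ℝ) (x : InfPath A) (n : ℕ) :
    ∫ y, levelTerm κ δ s μ t x y n ∂μ = 0 := by
  have := H.isProbabilityMeasure
  have hint (n : ℕ) : Integrable (cylInd (x.node n)) μ :=
    Integrable.of_bound (measurable_cylInd _).aestronglyMeasurable 1 (ae_of_all _ fun y => by
      rw [Real.norm_of_nonneg (cylInd_nonneg _ _)]; exact cylInd_le_one _ _)
  simp only [levelTerm, projKernel_node]
  rw [integral_const_mul, integral_sub ((hint _).div_const _) ((hint _).div_const _), integral_div,
    integral_div, integral_cylInd, integral_cylInd, div_self (H.measure_pos _).ne',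
    div_self (H.measure_pos _).ne', sub_self, mul_zero]

variable {m : Node A → ℕ} {ψ : (γ : Node A) → Fin (m γ) → InfPath A → ℝ}
  (hψ : IsEigenbasis μ m ψ)
include hψ

lemma heatTerm_node (t : ℝ) (x y : InfPath A) :
    heatTerm κ δ s μ ψ t x y ∘ x.node = levelTerm κ δ s μ t x y :=
  funext fun n => H.heatTerm_eq hψ t x y (x.node n)

lemma heatTerm_eq_zero (t : ℝ) (x y : InfPath A) (γ : Node A) (hγ : γ ∉ Set.range x.node) :
    heatTerm κ δ s μ ψ t x y γ = 0 := by
  rw [H.heatTerm_eq hψ, projKernel_eq_zero μ fun h : x ∈ cyl γ => hγ h, mul_zero]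

lemma summable_heatTerm {t : ℝ} (ht : 0 < t) (x y : InfPath A) :
    Summable (heatTerm κ δ s μ ψ t x y) := by
  rw [← (node_injective x).summable_iff (H.heatTerm_eq_zero hψ t x y), H.heatTerm_node hψ]
  exact H.summable_levelTerm ht x y

lemma heatKernel_eq (t : ℝ) (x y : InfPath A) :
    heatKernel κ δ s μ ψ t x y = 1 + ∑' n, levelTerm κ δ s μ t x y n := by
  rw [heatKernel, ← (node_injective x).tsum_eq, ← H.heatTerm_node hψ]
  · rfl
  · exact Function.support_subset_iff'.2 (H.heatTerm_eq_zero hψ t x y)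

/-- Below level N the terms agree with those on the diagonal; at N only the negative half of the
projection kernel survives, and beyond N nothing does. -/
lemma heatKernel_of_ne (t : ℝ) {x y : InfPath A} {N : ℕ}
    (hN : ∀ n, x.node n = y.node n ↔ n ≤ N) : heatKernel κ δ s μ ψ t x y =
      offDiag (fun n => μ.real (cyl (x.node n)))
        (fun n => μ.real (cyl (x.node n)) / G κ δ s μ (x.node n))
        (fun n => -nodeSum κ δ s μ (x.node n)) t N := by
  have hzero (n : ℕ) (hn : N < n) : cylInd (x.node n) y = 0 :=
    cylInd_of_notMem fun h => by
      have := (hN n).1 (mem_cyl_node.1 h).symm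
      omega
  rw [H.heatKernel_eq hψ, tsum_eq_sum (s := Finset.range (N + 1)), Finset.sum_range_succ,
    offDiag, diagSum, add_sub_assoc, sub_eq_add_neg]
  · congr 2
    · exact Finset.sum_congr rfl fun n hn =>
        levelTerm_of_node_eq ((hN _).2 (Finset.mem_range.1 hn)) t
    · rw [levelTerm, projKernel_node, hzero _ N.lt_succ_self,
        cylInd_of_mem (mem_cyl_node.2 ((hN N).2 le_rfl).symm), eigenvalue_eq]
      ring
  · intro n hn
    rw [Finset.mem_range, not_lt] at hn
    rw [levelTerm, projKernel_node, hzero n hn, hzero (n + 1) (by omega)]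
    simp

lemma tendsto_diagSum {t : ℝ} (ht : 0 < t) (x : InfPath A) :
    Tendsto (diagSum (fun n => μ.real (cyl (x.node n)))
        (fun n => μ.real (cyl (x.node n)) / G κ δ s μ (x.node n))
        (fun n => -nodeSum κ δ s μ (x.node n)) t) atTop (𝓝 (heatKernel κ δ s μ ψ t x x)) := by
  rw [H.heatKernel_eq hψ]
  refine ((H.summable_levelTerm ht x x).hasSum.tendsto_sum_nat.const_add 1).congr fun n => ?_
  rw [diagSum]
  congr 1
  exact Finset.sum_congr rfl fun n _ => levelTerm_of_node_eq rfl t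

lemma continuousOn_heatKernel : ContinuousOn (fun z : ℝ × InfPath A × InfPath A =>
    heatKernel κ δ s μ ψ z.1 z.2.1 z.2.2) (Set.Ioi 0 ×ˢ Set.univ) := by
  simp only [H.heatKernel_eq hψ]
  intro z hz
  have hz0 : 0 < z.1 := hz.1
  obtain ⟨B, hB, hle⟩ := H.exists_levelTerm_bound (half_pos hz0)
  have hc : ContinuousOn (fun z : ℝ × InfPath A × InfPath A =>
      ∑' n, levelTerm κ δ s μ z.1 z.2.1 z.2.2 n) (Set.Ioi (z.1 / 2) ×ˢ Set.univ) :=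
    continuousOn_tsum (fun n => (continuous_levelTerm κ δ s μ n).continuousOn) hB
      fun n w hw => hle w.1 (le_of_lt hw.1) _ _ n
  exact ((continuousAt_const.add (hc.continuousAt ((isOpen_Ioi.prod isOpen_univ).mem_nhds
    ⟨half_lt_self hz0, trivial⟩)))).continuousWithinAt

lemma measurable_heatKernel {t : ℝ} (ht : 0 < t) (x : InfPath A) :
    Measurable (heatKernel κ δ s μ ψ t x) :=
  ((H.continuousOn_heatKernel hψ).comp_continuous (f := fun y : InfPath A => (t, x, y))
    (by fun_prop) fun y => ⟨ht, trivial⟩).measurable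

lemma exists_heatKernel_bound {t : ℝ} (ht : 0 < t) :
    ∃ M, ∀ x y, ‖heatKernel κ δ s μ ψ t x y‖ ≤ M := by
  obtain ⟨B, hB, hle⟩ := H.exists_levelTerm_bound ht
  refine ⟨1 + ∑' n, B n, fun x y => ?_⟩
  rw [H.heatKernel_eq hψ]
  refine (norm_add_le _ _).trans (add_le_add (by simp) ?_)
  exact tsum_of_norm_bounded hB.hasSum fun n => hle t le_rfl x y n

lemma integrable_heatKernel {t : ℝ} (ht : 0 < t) (x : InfPath A) :
    Integrable (heatKernel κ δ s μ ψ t x) μ := by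
  have := H.isProbabilityMeasure
  obtain ⟨M, hM⟩ := H.exists_heatKernel_bound hψ ht
  exact Integrable.of_bound (H.measurable_heatKernel hψ ht x).aestronglyMeasurable M
    (ae_of_all _ (hM x))

lemma integral_heatKernel_mul {t : ℝ} (ht : 0 < t) (x : InfPath A) {f : InfPath A → ℝ}
    (hfm : Measurable f) {M : ℝ} (hM : ∀ y, |f y| ≤ M) :
    ∫ y, heatKernel κ δ s μ ψ t x y * f y ∂μ =
      ∫ y, f y ∂μ + ∑' n, ∫ y, levelTerm κ δ s μ t x y n * f y ∂μ := by
  have := H.isProbabilityMeasure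
  obtain ⟨B, hB, hle⟩ := H.exists_levelTerm_bound ht
  have hf : Integrable f μ := Integrable.of_bound hfm.aestronglyMeasurable M (ae_of_all _ hM)
  have hm (n : ℕ) : Measurable fun y => levelTerm κ δ s μ t x y n :=
    ((continuous_levelTerm κ δ s μ n).comp (f := fun y : InfPath A => (t, x, y))
      (by fun_prop)).measurable
  have hsum := hasSum_integral_of_dominated_convergence (μ := μ)
    (F := fun n y => levelTerm κ δ s μ t x y n * f y)
    (f := fun y => (∑' n, levelTerm κ δ s μ t x y n) * f y) (fun n _ => B n * M)
    (fun n => ((hm n).mul hfm).aestronglyMeasurable)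
    (fun n => ae_of_all _ fun y => by
      rw [norm_mul]
      exact mul_le_mul (hle t le_rfl x y n) (hM y) (norm_nonneg _)
        ((norm_nonneg _).trans (hle t le_rfl x y n)))
    (ae_of_all _ fun _ => hB.mul_right M) (integrable_const _)
    (ae_of_all _ fun y => (H.summable_levelTerm ht x y).hasSum.mul_right _)
  have hp : Integrable (fun y => heatKernel κ δ s μ ψ t x y * f y) μ := by
    obtain ⟨M', hM'⟩ := H.exists_heatKernel_bound hψ ht
    exact hf.bdd_mul (H.measurable_heatKernel hψ ht x).aestronglyMeasurable (ae_of_all _ (hM' x))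
  rw [hsum.tsum_eq, ← sub_eq_iff_eq_add', ← integral_sub hp hf]
  refine integral_congr_ae (ae_of_all _ fun y => ?_)
  simp only [H.heatKernel_eq hψ]
  ring

lemma integral_heatKernel_mul_eigenspace {t : ℝ} (ht : 0 < t) (x : InfPath A) {γ : Node A}
    {f : InfPath A → ℝ} (hf : f ∈ eigenspace μ γ) :
    ∫ y, heatKernel κ δ s μ ψ t x y * f y ∂μ = Real.exp (eigenvalue κ δ s μ γ * t) * f x := by
  obtain ⟨M, hM⟩ := H.eigenspace_bounded hf
  rw [H.integral_heatKernel_mul hψ ht x (H.measurable_eigenspace hf) hM,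
    H.integral_eigenspace hf, zero_add, tsum_eq_single γ.level]
  · rw [H.integral_levelTerm_eigenspace hf, if_pos rfl]
  · intro n hn
    rw [H.integral_levelTerm_eigenspace hf, if_neg hn]

lemma integral_heatKernel {t : ℝ} (ht : 0 < t) (x : InfPath A) :
    ∫ y, heatKernel κ δ s μ ψ t x y ∂μ = 1 := by
  have := H.isProbabilityMeasure
  have h := H.integral_heatKernel_mul hψ ht x (f := fun _ => 1) measurable_const (M := 1) (by simp)
  simpa [H.integral_levelTerm] using h

/-- In the far regime the bounds are those of `offDiag`. In the near regime, with t = u^θ, the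
kernel and the reciprocal of the ball's measure are each compared with 1 + 1/u. -/
lemma heatKernel_bounds : ∃ c₁ > 0, ∃ c₂ > 0, ∀ t > 0, ∀ x y,
    (t ≤ dIntrinsic κ δ s μ x y →
      c₁ * (t / (dIntrinsic κ δ s μ x y * μ.real (cyl (meet x y)))) ≤ heatKernel κ δ s μ ψ t x y ∧
      heatKernel κ δ s μ ψ t x y ≤
        c₂ * (t / (dIntrinsic κ δ s μ x y * μ.real (cyl (meet x y))))) ∧
    (dIntrinsic κ δ s μ x y < t →
      c₁ * (1 / μ.real (ballS κ δ s μ x t)) ≤ heatKernel κ δ s μ ψ t x y ∧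
      heatKernel κ δ s μ ψ t x y ≤ c₂ * (1 / μ.real (ballS κ δ s μ x t))) := by
  have := H.isProbabilityMeasure
  obtain ⟨b, hb, hb1, c, hc, C, hC, hprof⟩ := H.exists_profile
  have hθ := H.growthExp_pos
  obtain ⟨K₁, hK₁, hup⟩ := IsProfile.exists_diagSum_le (C := C) hb hb1 hc hθ
  obtain ⟨L₁, hL₁, hlow⟩ := IsProfile.exists_le_diagSum (c := c) hb hb1 hθ hC.le
  obtain ⟨L₂, hL₂, hfar⟩ := IsProfile.exists_le_offDiag_of_le hb hb1 hc hθ hC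
  obtain ⟨L₃, hL₃, hnear⟩ := IsProfile.exists_le_offDiag_of_lt hb hb1 hc hθ hC
  obtain ⟨L₄, hL₄, hball⟩ := IsProfile.exists_ball_lower (C := C) hb hb1 hc hθ
  obtain ⟨K₄, hK₄, hball'⟩ := IsProfile.exists_ball_upper (c := c) hb hb1 hθ hC
  have hmeet {x y : InfPath A} (hxy : x ≠ y) : ∃ N, meet x y = x.node N ∧
      (∀ n, x.node n = y.node n ↔ n ≤ N) ∧ Nontrivial (Child (x.node N)) ∧
      0 < -nodeSum κ δ s μ (x.node N) + μ.real (cyl (x.node N)) / G κ δ s μ (x.node N) ∧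
      dIntrinsic κ δ s μ x y =
        1 / (-nodeSum κ δ s μ (x.node N) + μ.real (cyl (x.node N)) / G κ δ s μ (x.node N)) := by
    obtain ⟨N, hN, hiff⟩ := exists_meet hxy
    have hnt : Nontrivial (Child (x.node N)) := hN ▸ (separates_meet hxy).nontrivial
    have h1 := (hprof x).1.sum_nonneg N
    have h2 := div_pos (H.measure_pos (x.node N)) (H.G_pos (x.node N))
    refine ⟨N, hN, hiff, hnt, add_pos_of_nonneg_of_pos h1 h2, ?_⟩
    rw [dIntrinsic, if_neg hxy, hN, eigenvalue_eq, neg_div_neg_eq]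
  refine ⟨min L₂ (min L₁ L₃ * L₄), by positivity, max 1 (K₁ * K₄), by positivity,
    fun t ht x y => ⟨fun htd => ?_, fun htd => ?_⟩⟩
  · have hxy : x ≠ y := by
      rintro rfl
      rw [dIntrinsic, if_pos rfl] at htd
      linarith
    obtain ⟨N, hN, hiff, hnt, hpos, hd⟩ := hmeet hxy
    rw [H.heatKernel_of_ne hψ t hiff, hd, hN]
    rw [hd, le_div_iff₀ hpos] at htd
    have ha := H.measure_pos (x.node N)
    have heq : t / (1 / (-nodeSum κ δ s μ (x.node N) +
        μ.real (cyl (x.node N)) / G κ δ s μ (x.node N)) * μ.real (cyl (x.node N))) =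
        t * (-nodeSum κ δ s μ (x.node N) + μ.real (cyl (x.node N)) / G κ δ s μ (x.node N)) /
          μ.real (cyl (x.node N)) := by
      rw [one_div_mul_eq_div, div_div_eq_mul_div]
    rw [heq]
    have h0 : 0 ≤ t * (-nodeSum κ δ s μ (x.node N) + μ.real (cyl (x.node N)) /
        G κ δ s μ (x.node N)) / μ.real (cyl (x.node N)) := by positivity
    exact ⟨(mul_le_mul_of_nonneg_right (min_le_left _ _) h0).trans
      (hfar (hprof x).1 t ht N ((hprof x).2 N hnt) htd),
      ((hprof x).1.offDiag_le ht.le N).trans (le_mul_of_one_le_left h0 (le_max_left _ _))⟩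
  · set u := t ^ (growthExp δ s)⁻¹ with hu
    have hu0 : 0 < u := by positivity
    have hut : u ^ growthExp δ s = t := Real.rpow_inv_rpow ht.le hθ.ne'
    have hU : 0 < 1 + 1 / u := by positivity
    have hker : min L₁ L₃ * (1 + 1 / u) ≤ heatKernel κ δ s μ ψ t x y ∧
        heatKernel κ δ s μ ψ t x y ≤ K₁ * (1 + 1 / u) := by
      by_cases hxy : x = y
      · subst hxy
        have hlim := H.tendsto_diagSum hψ ht x
        rw [← hut] at hlim ⊢
        refine ⟨ge_of_tendsto hlim ?_, le_of_tendsto' hlim fun n => hup (hprof x).1 u hu0 n⟩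
        obtain ⟨n₀, hn₀⟩ := (hprof x).1.exists_le hb hb1 hu0
        filter_upwards [eventually_ge_atTop n₀] with n hn
        exact (mul_le_mul_of_nonneg_right (min_le_left _ _) hU.le).trans
          (hlow (hprof x).1 u hu0 n (((hprof x).1.antitone hn).trans hn₀))
      · obtain ⟨N, hN, hiff, hnt, hpos, hd⟩ := hmeet hxy
        rw [H.heatKernel_of_ne hψ t hiff]
        rw [hd, div_lt_iff₀ hpos] at htd
        rw [← hut] at htd ⊢
        exact ⟨(mul_le_mul_of_nonneg_right (min_le_right _ _) hU.le).trans
          (hnear (hprof x).1 u hu0 N ((hprof x).2 N hnt) htd),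
          ((hprof x).1.offDiag_le_diagSum _ N).trans (hup (hprof x).1 u hu0 N)⟩
    have hB₁ : L₄ / (1 + 1 / u) ≤ μ.real (ballS κ δ s μ x t) := by
      obtain ⟨n, hn, hn'⟩ := hball (hprof x).1 u hu0
      refine hn.trans (measureReal_mono fun y hy => ?_)
      by_cases hxy : x = y
      · subst hxy
        simpa [ballS, dIntrinsic] using ht
      · obtain ⟨N, hN, hiff, hnt, hpos, hd⟩ := hmeet hxy
        change dIntrinsic κ δ s μ x y < t
        rw [hd, ← hut]
        exact hn' N ((hiff n).1 (mem_cyl_node.1 hy).symm) ((hprof x).2 N hnt)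
    have hB₂ : μ.real (ballS κ δ s μ x t) ≤ K₄ / (1 + 1 / u) := by
      obtain ⟨n, hn, hn'⟩ := hball' (hprof x).1 u hu0
      refine (measureReal_mono fun y hy => ?_).trans hn
      by_cases hxy : x = y
      · subst hxy
        exact self_mem_cyl_node x n
      · obtain ⟨N, hN, hiff, hnt, hpos, hd⟩ := hmeet hxy
        change dIntrinsic κ δ s μ x y < t at hy
        rw [hd, ← hut] at hy
        exact mem_cyl_node.2 ((hiff n).2 (hn' N
          (div_pos (H.measure_pos (x.node N)) (H.G_pos (x.node N))) hy)).symm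
    have hB : 0 < μ.real (ballS κ δ s μ x t) := lt_of_lt_of_le (by positivity) hB₁
    rw [div_le_iff₀ hU] at hB₁
    rw [le_div_iff₀ hU] at hB₂
    constructor
    · refine (mul_le_mul_of_nonneg_right (min_le_right _ _) (by positivity)).trans
        (le_trans ?_ hker.1)
      rw [mul_assoc, mul_one_div]
      refine mul_le_mul_of_nonneg_left ?_ (by positivity)
      rw [div_le_iff₀ hB]
      linarith
    · refine hker.2.trans (le_trans ?_
        (mul_le_mul_of_nonneg_right (le_max_right _ _) (by positivity)))
      rw [mul_assoc, mul_one_div]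
      refine mul_le_mul_of_nonneg_left ?_ hK₁.le
      rw [le_div_iff₀ hB]
      linarith

end IsAdmissible

end HeatKernel

/-! ### The Dirichlet form as a sum over nodes, and its eigenfunctions. -/

section Form

variable {k : ℕ} [NeZero k] {V : Type*} {A : Fin k → Matrix V V ℕ} [Fintype V]
  {κ : V → ℝ} {μ : Measure (InfPath A)} {δ s : ℝ}

/-- The indicator function of the pairs of paths passing through distinct children of `γ`. -/
noncomputable def sepInd (γ : Node A) (x y : InfPath A) : ℝ :=
  cylInd γ x * cylInd γ y - ∑ e, cylInd (extend γ e) x * cylInd (extend γ e) y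

lemma sepInd_comm (γ : Node A) (x y : InfPath A) : sepInd γ x y = sepInd γ y x := by
  simp only [sepInd, mul_comm]

lemma sepInd_node (x y : InfPath A) (n : ℕ) :
    sepInd (x.node n) x y = cylInd (x.node n) y - cylInd (x.node (n + 1)) y := by
  have hx : x ∈ cyl (extend (x.node n) (x.child n)) := by
    rw [← node_succ]; exact self_mem_cyl_node x _
  have h := sum_mul_cylInd_of_mem hx fun e => cylInd (extend (x.node n) e) y
  rw [sepInd, node_succ, cylInd_of_mem (self_mem_cyl_node x n), ← h, one_mul]
  simp only [mul_comm]

lemma sepInd_eq_zero {γ : Node A} {x : InfPath A} (hx : x ∉ cyl γ) (y : InfPath A) :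
    sepInd γ x y = 0 := by
  rw [sepInd, cylInd_of_notMem hx, Finset.sum_eq_zero]
  · simp
  · intro e _
    rw [cylInd_of_notMem fun h => hx (cyl_extend_subset _ _ h), zero_mul]

lemma sepInd_of_separates {γ : Node A} {x y : InfPath A} (h : Separates γ x y) :
    sepInd γ x y = 1 := by
  obtain ⟨e, e', hne, hx, hy⟩ := h
  rw [sepInd, cylInd_of_mem (cyl_extend_subset _ _ hx), cylInd_of_mem (cyl_extend_subset _ _ hy)]
  simp only [mul_comm (cylInd _ x)]
  rw [sum_mul_cylInd_of_mem hx fun e => cylInd (extend γ e) y,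
    cylInd_of_notMem fun h => hne (child_eq_of_mem h hy)]
  norm_num

lemma sepInd_of_not_separates {γ : Node A} {x y : InfPath A} (h : ¬ Separates γ x y) :
    sepInd γ x y = 0 := by
  by_cases hx : x ∈ cyl γ
  swap
  · exact sepInd_eq_zero hx y
  by_cases hy : y ∈ cyl γ
  swap
  · rw [sepInd_comm, sepInd_eq_zero hy]
  obtain ⟨e, he⟩ := exists_mem_cyl_extend hx
  obtain ⟨e', he'⟩ := exists_mem_cyl_extend hy
  have hee : e = e' := by
    by_contra hne
    exact h ⟨e, e', hne, he, he'⟩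
  subst hee
  rw [sepInd, cylInd_of_mem hx, cylInd_of_mem hy]
  simp only [mul_comm (cylInd _ x)]
  rw [sum_mul_cylInd_of_mem he fun e => cylInd (extend γ e) y, cylInd_of_mem he']
  norm_num

lemma abs_sepInd_le (γ : Node A) (x y : InfPath A) : |sepInd γ x y| ≤ 1 := by
  by_cases h : Separates γ x y
  · simp [sepInd_of_separates h]
  · simp [sepInd_of_not_separates h]

lemma measurable_sepInd (γ : Node A) :
    Measurable fun z : InfPath A × InfPath A => sepInd γ z.1 z.2 := by
  have h1 (γ : Node A) : Measurable fun z : InfPath A × InfPath A => cylInd γ z.1 :=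
    (measurable_cylInd γ).comp measurable_fst
  have h2 (γ : Node A) : Measurable fun z : InfPath A × InfPath A => cylInd γ z.2 :=
    (measurable_cylInd γ).comp measurable_snd
  exact ((h1 γ).mul (h2 γ)).sub (Finset.measurable_fun_sum _ fun e _ => (h1 _).mul (h2 _))

lemma measurableSet_separates (γ : Node A) :
    MeasurableSet {z : InfPath A × InfPath A | Separates γ z.1 z.2} := by
  convert measurable_sepInd γ (measurableSet_singleton (1 : ℝ)) using 1
  ext z
  refine ⟨fun h => sepInd_of_separates h, fun h => by_contra fun h' => ?_⟩
  have h1 : sepInd γ z.1 z.2 = 1 := h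
  rw [sepInd_of_not_separates h'] at h1
  exact zero_ne_one h1

lemma indicator_separates {E : Type*} [AddCommGroup E] [Module ℝ E] (γ : Node A)
    (F : InfPath A × InfPath A → E) : {z | Separates γ z.1 z.2}.indicator F =
      fun z => sepInd γ z.1 z.2 • F z := by
  funext z
  by_cases h : Separates γ z.1 z.2
  · rw [Set.indicator_of_mem (by exact h), sepInd_of_separates h, one_smul]
  · rw [Set.indicator_of_notMem (by exact h), sepInd_of_not_separates h, zero_smul]

omit [Fintype V] in
lemma integrable_cylInd (μ : Measure (InfPath A)) [IsFiniteMeasure μ] (γ : Node A) :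
    Integrable (cylInd γ) μ :=
  Integrable.of_bound (measurable_cylInd _).aestronglyMeasurable 1 (ae_of_all _ fun y => by
    rw [Real.norm_of_nonneg (cylInd_nonneg _ _)]; exact cylInd_le_one _ _)

/-- This is what makes each ν_γ a probability measure, so that the product measure and its marginals
are available. -/
lemma measure_separates (μ : Measure (InfPath A)) [IsFiniteMeasure μ] (γ : Node A) :
    (μ.prod μ) {z | Separates γ z.1 z.2} = ENNReal.ofReal (extSum μ γ) := by
  rw [← ofReal_measureReal, ← integral_indicator_one (measurableSet_separates γ),
    indicator_separates]
  congr 1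
  simp only [sepInd, Pi.one_apply, smul_eq_mul, mul_one]
  have hi (γ : Node A) : Integrable (fun z : InfPath A × InfPath A => cylInd γ z.1 * cylInd γ z.2)
      (μ.prod μ) := (integrable_cylInd μ γ).mul_prod (integrable_cylInd μ γ)
  rw [integral_sub (hi γ) (integrable_finsetSum _ fun e _ => hi _),
    integral_finsetSum _ fun e _ => hi _]
  simp only [integral_prod_mul, integral_cylInd]
  rw [extSum_eq, sum_measureReal_extend]
  simp only [sq]

lemma finite_level_lt (A : Fin k → Matrix V V ℕ) (L : ℕ) : {γ : Node A | γ.level < L}.Finite :=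
  ((Set.finite_lt_nat L).biUnion fun n _ => finite_level n).subset fun γ hγ => by
    simp only [Set.mem_iUnion]
    exact ⟨γ.level, hγ, rfl⟩

/-- The nodes of level less than `L`. -/
noncomputable def nodesBelow (A : Fin k → Matrix V V ℕ) (L : ℕ) : Finset (Node A) :=
  (finite_level_lt A L).toFinset

lemma mem_nodesBelow {L : ℕ} {γ : Node A} : γ ∈ nodesBelow A L ↔ γ.level < L := by
  simp [nodesBelow]

open Matrix in
lemma trace_commBlock (κ : V → ℝ) (δ s : ℝ) (g f : InfPath A → ℂ) (γ : Node A)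
    (z : InfPath A × InfPath A) :
    Matrix.trace (absDiracPowBlock κ δ s γ * (commBlock κ δ g γ z)ᴴ * commBlock κ δ f γ z) =
      2 * ((weight κ δ γ ^ s : ℝ) : ℂ) * ((weight κ δ γ : ℝ) : ℂ)⁻¹ ^ 2 *
        ((starRingEnd ℂ) (g z.1 - g z.2) * (f z.1 - f z.2)) := by
  simp [absDiracPowBlock, commBlock, diracBlock, repBlock, Matrix.trace, Matrix.mul_apply,
    Fin.sum_univ_two]
  ring

/-- The contribution of the node `γ` to the form, up to the factor `1 / G γ`. -/
noncomputable def nodeForm (μ : Measure (InfPath A)) (γ : Node A) (g f : InfPath A → ℂ) : ℂ :=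
  ∫ x, (starRingEnd ℂ) (g x) * ∫ y, (sepInd γ x y : ℂ) * (f x - f y) ∂μ ∂μ

/-- Separation is symmetric and f(x) - f(y) antisymmetric, so swapping the variables turns the g(y)
part into a second copy of the g(x) part. -/
lemma integral_separates (μ : Measure (InfPath A)) [IsFiniteMeasure μ] (γ : Node A)
    {g f : InfPath A → ℂ} (hg : Measurable g) (hf : Measurable f) {M N : ℝ}
    (hM : ∀ x, ‖g x‖ ≤ M) (hN : ∀ x, ‖f x‖ ≤ N) :
    ∫ z in {z : InfPath A × InfPath A | Separates γ z.1 z.2},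
      (starRingEnd ℂ) (g z.1 - g z.2) * (f z.1 - f z.2) ∂(μ.prod μ) = 2 * nodeForm μ γ g f := by
  have hs := Complex.measurable_ofReal.comp (measurable_sepInd γ)
  have hg1 : Measurable fun z : InfPath A × InfPath A => (starRingEnd ℂ) (g z.1) :=
    Complex.continuous_conj.measurable.comp (hg.comp measurable_fst)
  have hf12 : Measurable fun z : InfPath A × InfPath A => f z.1 - f z.2 :=
    (hf.comp measurable_fst).sub (hf.comp measurable_snd)
  set Φ : InfPath A × InfPath A → ℂ := fun z =>
    (starRingEnd ℂ) (g z.1) * ((sepInd γ z.1 z.2 : ℂ) * (f z.1 - f z.2)) with hΦ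
  have hint : Integrable Φ (μ.prod μ) := by
    refine Integrable.of_bound (hg1.mul (hs.mul hf12)).aestronglyMeasurable (M * (1 * (N + N)))
      (ae_of_all _ fun z => ?_)
    have h0 : 0 ≤ M := (norm_nonneg _).trans (hM z.1)
    rw [hΦ, norm_mul, norm_mul, RCLike.norm_conj, Complex.norm_real]
    exact mul_le_mul (hM _) (mul_le_mul (abs_sepInd_le _ _ _)
      ((norm_sub_le _ _).trans (add_le_add (hN _) (hN _))) (norm_nonneg _) zero_le_one)
      (by positivity) h0
  have hswap : ∀ z, sepInd γ z.1 z.2 • ((starRingEnd ℂ) (g z.1 - g z.2) * (f z.1 - f z.2)) =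
      Φ z + Φ z.swap := fun z => by
    simp only [hΦ, Prod.fst_swap, Prod.snd_swap, sepInd_comm γ z.2 z.1, map_sub,
      Complex.real_smul]
    ring
  rw [← integral_indicator (measurableSet_separates γ), indicator_separates]
  simp only [hswap]
  have hint' : Integrable (fun z => Φ z.swap) (μ.prod μ) := hint.swap
  rw [integral_add hint hint', integral_prod_swap, ← two_mul, integral_prod _ hint, nodeForm]
  simp only [hΦ, integral_const_mul]

lemma norm_sepInd_mul_le (γ : Node A) {f : InfPath A → ℂ} {N : ℝ} (hN : ∀ x, ‖f x‖ ≤ N)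
    (x y : InfPath A) : ‖(sepInd γ x y : ℂ) * (f x - f y)‖ ≤ N + N := by
  rw [norm_mul, Complex.norm_real]
  exact (mul_le_of_le_one_left (norm_nonneg _) (abs_sepInd_le _ _ _)).trans
    ((norm_sub_le _ _).trans (add_le_add (hN _) (hN _)))

lemma measurable_sepInd_mul (γ : Node A) {f : InfPath A → ℂ} (hf : Measurable f) :
    Measurable fun z : InfPath A × InfPath A => (sepInd γ z.1 z.2 : ℂ) * (f z.1 - f z.2) :=
  (Complex.measurable_ofReal.comp (measurable_sepInd γ)).mul
    ((hf.comp measurable_fst).sub (hf.comp measurable_snd))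

lemma integrable_sepInd_mul (μ : Measure (InfPath A)) [IsFiniteMeasure μ] (γ : Node A)
    {f : InfPath A → ℂ} (hf : Measurable f) {N : ℝ} (hN : ∀ x, ‖f x‖ ≤ N) (x : InfPath A) :
    Integrable (fun y => (sepInd γ x y : ℂ) * (f x - f y)) μ :=
  Integrable.of_bound ((measurable_sepInd_mul γ hf).comp measurable_prodMk_left).aestronglyMeasurable
    (N + N) (ae_of_all _ (norm_sepInd_mul_le γ hN x))

lemma integrable_nodeForm (μ : Measure (InfPath A)) [IsFiniteMeasure μ] (γ : Node A)
    {g f : InfPath A → ℂ} (hg : Measurable g) (hf : Measurable f) {M N : ℝ}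
    (hM : ∀ x, ‖g x‖ ≤ M) (hN : ∀ x, ‖f x‖ ≤ N) : Integrable (fun x => (starRingEnd ℂ) (g x) *
      ∫ y, (sepInd γ x y : ℂ) * (f x - f y) ∂μ) μ := by
  refine Integrable.of_bound ((Complex.continuous_conj.measurable.comp hg).aestronglyMeasurable.mul
    (measurable_sepInd_mul γ hf).stronglyMeasurable.integral_prod_right.aestronglyMeasurable)
    (M * ((N + N) * μ.real Set.univ)) (ae_of_all _ fun x => ?_)
  rw [norm_mul, RCLike.norm_conj]
  exact mul_le_mul (hM x)
    (norm_integral_le_of_norm_le_const (ae_of_all _ (norm_sepInd_mul_le γ hN x)))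
    (norm_nonneg _) ((norm_nonneg _).trans (hM x))

lemma nodeForm_sum (μ : Measure (InfPath A)) [IsFiniteMeasure μ] (γ : Node A) {ι : Type*}
    [Fintype ι] {g : InfPath A → ℂ} {f : ι → InfPath A → ℂ} (c : ι → ℂ) (hg : Measurable g)
    (hf : ∀ i, Measurable (f i)) {M : ℝ} {N : ι → ℝ} (hM : ∀ x, ‖g x‖ ≤ M)
    (hN : ∀ i x, ‖f i x‖ ≤ N i) :
    nodeForm μ γ g (fun x => ∑ i, c i * f i x) = ∑ i, c i * nodeForm μ γ g (f i) := by
  have hc (i : ι) : c i * nodeForm μ γ g (f i) = ∫ x, c i * ((starRingEnd ℂ) (g x) *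
      ∫ y, (sepInd γ x y : ℂ) * (f i x - f i y) ∂μ) ∂μ := (integral_const_mul _ _).symm
  simp only [hc]
  rw [← integral_finsetSum _ fun i _ =>
    (integrable_nodeForm μ γ hg (hf i) hM (hN i)).const_mul (c i), nodeForm]
  refine integral_congr_ae (ae_of_all _ fun x => ?_)
  have h : ∀ y, (sepInd γ x y : ℂ) * (∑ i, c i * f i x - ∑ i, c i * f i y) =
      ∑ i, c i * ((sepInd γ x y : ℂ) * (f i x - f i y)) := fun y => by
    rw [← Finset.sum_sub_distrib, Finset.mul_sum]
    exact Finset.sum_congr rfl fun i _ => by ring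
  simp only [h]
  rw [integral_finsetSum _ fun i _ =>
    (integrable_sepInd_mul μ γ (hf i) (hN i) x).const_mul (c i), Finset.mul_sum]
  refine Finset.sum_congr rfl fun i _ => ?_
  rw [integral_const_mul]
  ring

namespace IsAdmissible

variable (H : IsAdmissible κ μ δ s)
include H

lemma ofReal_extSum_ne_zero (γ : Node A) [Nontrivial (Child γ)] :
    ENNReal.ofReal (extSum μ γ) ≠ 0 := by
  rw [Ne, ENNReal.ofReal_eq_zero, not_le]
  have h := H.G_pos γ
  rw [G] at h
  exact pos_of_mul_pos_right h (mul_pos (by norm_num)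
    (Real.rpow_pos_of_pos (H.weight_pos γ) _)).le

lemma isProbabilityMeasure_nuAt (γ : Node A) [Nontrivial (Child γ)] :
    IsProbabilityMeasure (nuAt κ δ μ γ) := by
  have := H.isProbabilityMeasure
  constructor
  rw [nuAt, Measure.smul_apply, Measure.restrict_apply_univ, H.choiceSet_eq, measure_separates,
    smul_eq_mul, ENNReal.inv_mul_cancel (H.ofReal_extSum_ne_zero γ) ENNReal.ofReal_ne_top]

lemma ae_nuAt (γ : Node A) [Nontrivial (Child γ)] :
    ∀ᵐ z ∂(nuAt κ δ μ γ), Separates γ z.1 z.2 := by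
  rw [nuAt, H.choiceSet_eq]
  exact Measure.ae_smul_measure (ae_restrict_mem (measurableSet_separates γ)) _

lemma integral_nuAt (γ : Node A) [Nontrivial (Child γ)] {g f : InfPath A → ℂ} (hg : Measurable g)
    (hf : Measurable f) {M N : ℝ} (hM : ∀ x, ‖g x‖ ≤ M) (hN : ∀ x, ‖f x‖ ≤ N) :
    ∫ z, (starRingEnd ℂ) (g z.1 - g z.2) * (f z.1 - f z.2) ∂(nuAt κ δ μ γ) =
      (extSum μ γ : ℂ)⁻¹ * (2 * nodeForm μ γ g f) := by
  have := H.isProbabilityMeasure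
  rw [nuAt, H.choiceSet_eq, integral_smul_measure, integral_separates μ γ hg hf hM hN,
    ENNReal.toReal_inv, ENNReal.toReal_ofReal (extSum_nonneg μ γ), Complex.real_smul,
    Complex.ofReal_inv]

/-- The form as a finite sum over nodes, if the second argument only depends on the initial
sub-paths of level `L`. -/
lemma formQ_eq_sum {g f : InfPath A → ℂ} (hg : Measurable g) (hf : Measurable f) {M N : ℝ}
    (hM : ∀ x, ‖g x‖ ≤ M) (hN : ∀ x, ‖f x‖ ≤ N) {L : ℕ}
    (hL : ∀ x y, x.node L = y.node L → f x = f y) :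
    formQ κ δ s μ g f = ∑ γ ∈ nodesBelow A L, (G κ δ s μ γ : ℂ)⁻¹ * nodeForm μ γ g f := by
  classical
  have hprob (γ : Branching A) : IsProbabilityMeasure (nuAt κ δ μ γ.1) :=
    have := γ.2
    H.isProbabilityMeasure_nuAt γ.1
  set T : Finset (Branching A) := (nodesBelow A L).subtype fun γ => Nontrivial (Child γ)
  set F : Branching A → InfPath A × InfPath A → ℂ := fun γ z =>
    2 * ((weight κ δ γ.1 ^ s : ℝ) : ℂ) * ((weight κ δ γ.1 : ℝ) : ℂ)⁻¹ ^ 2 *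
        ((starRingEnd ℂ) (g z.1 - g z.2) * (f z.1 - f z.2)) with hF
  have hFm (γ : Branching A) : Measurable (F γ) :=
    ((Complex.continuous_conj.measurable.comp
      ((hg.comp measurable_fst).sub (hg.comp measurable_snd))).mul
      ((hf.comp measurable_fst).sub (hf.comp measurable_snd))).const_mul _
  have hFb (γ : Branching A) : ∃ B, ∀ z, ‖F γ z‖ ≤ B := by
    refine ⟨‖2 * ((weight κ δ γ.1 ^ s : ℝ) : ℂ) * ((weight κ δ γ.1 : ℝ) : ℂ)⁻¹ ^ 2‖ *
      ((M + M) * (N + N)), fun z => ?_⟩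
    have h0 : 0 ≤ M := (norm_nonneg _).trans (hM z.1)
    rw [hF, norm_mul, norm_mul (starRingEnd ℂ _), RCLike.norm_conj]
    exact mul_le_mul_of_nonneg_left (mul_le_mul ((norm_sub_le _ _).trans (add_le_add (hM _) (hM _)))
      ((norm_sub_le _ _).trans (add_le_add (hN _) (hN _))) (norm_nonneg _) (by positivity))
      (norm_nonneg _)
  -- There are countably many nodes, so almost surely every φ(γ) is a separated pair. At level `L`
  -- or deeper both entries share their level-`L` sub-path, where `f` takes equal values; the trace
  -- is thus a finite sum.
  have hae : ∀ᵐ φ ∂(nu κ δ μ), ∑' γ : Branching A, F γ (φ γ) = ∑ γ ∈ T, F γ (φ γ) := by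
    have h1 : ∀ᵐ φ ∂(nu κ δ μ), ∀ γ : Branching A, Separates γ.1 (φ γ).1 (φ γ).2 :=
      ae_all_iff.2 fun γ => by
        have := γ.2
        exact (measurePreserving_eval_infinitePi (fun γ : Branching A => nuAt κ δ μ γ.1)
          γ).quasiMeasurePreserving.ae (H.ae_nuAt γ.1)
    filter_upwards [h1] with φ hφ
    refine tsum_eq_sum fun γ hγ => ?_
    have hlevel : L ≤ γ.1.level := by
      rw [Finset.mem_subtype, mem_nodesBelow] at hγ
      omega
    obtain ⟨e, e', -, hx, hy⟩ := hφ γ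
    have hx' := mem_cyl_iff.1 (cyl_extend_subset _ _ hx)
    have hy' := mem_cyl_iff.1 (cyl_extend_subset _ _ hy)
    simp only [hF]
    rw [hL _ _ (node_eq_of_le hlevel (hx'.trans hy'.symm)), sub_self, mul_zero, mul_zero]
  have hint (γ : Branching A) : ∫ φ, F γ (φ γ) ∂(nu κ δ μ) = ∫ z, F γ z ∂(nuAt κ δ μ γ.1) := by
    rw [← Measure.infinitePi_map_eval (fun γ : Branching A => nuAt κ δ μ γ.1) γ,
      integral_map (measurable_pi_apply γ).aemeasurable (hFm γ).aestronglyMeasurable]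
    rfl
  have hprob' : IsProbabilityMeasure (nu κ δ μ) := by
    unfold nu
    infer_instance
  have hsum (p : Node A → ℂ) (hp : ∀ γ, ¬ Nontrivial (Child γ) → p γ = 0) :
      ∑ γ ∈ T, p γ.1 = ∑ γ ∈ nodesBelow A L, p γ := by
    rw [Finset.sum_subtype_eq_sum_filter]
    exact Finset.sum_filter_of_ne fun γ _ h => by_contra fun h' => h (hp γ h')
  rw [formQ]
  simp only [trace_commBlock]
  rw [integral_congr_ae hae, integral_finsetSum, ← hsum, Finset.mul_sum]
  · refine Finset.sum_congr rfl fun γ _ => ?_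
    have := γ.2
    rw [hint, hF, integral_const_mul, H.integral_nuAt γ.1 hg hf hM hN, G]
    have hw := H.weight_pos γ.1
    -- The factor ½, the 2 from the trace, the 2 from symmetrisation, w^{s-2} and the normalisation
    -- of ν_γ combine to 1/G(γ).
    have h1 : weight κ δ γ.1 ^ (2 - s) = weight κ δ γ.1 ^ 2 / weight κ δ γ.1 ^ s := by
      rw [Real.rpow_sub hw, Real.rpow_two]
    rw [h1]
    push_cast
    simp only [mul_inv, inv_inv, div_eq_mul_inv]
    ring
  -- At a non-branching node G vanishes and its inverse is 0 by convention, so such nodes may be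
  -- included.
  · intro γ hγ
    rw [G, extSum_eq_zero μ γ hγ]
    simp
  · intro γ _
    obtain ⟨B, hB⟩ := hFb γ
    exact Integrable.of_bound ((hFm γ).comp (measurable_pi_apply γ)).aestronglyMeasurable B
      (ae_of_all _ fun φ => hB _)

omit H in
lemma nodeSum_node (κ : V → ℝ) (δ s : ℝ) (μ : Measure (InfPath A)) (x : InfPath A) (n : ℕ) :
    nodeSum κ δ s μ (x.node n) = ∑ j ∈ Finset.range n,
      (μ.real (cyl (x.node (j + 1))) - μ.real (cyl (x.node j))) / G κ δ s μ (x.node j) := by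
  induction n with
  | zero => simp [InfPath.node, nodeSum]
  | succ n ih => rw [nodeSum_node_succ, ih, Finset.sum_range_succ]

/-- Before γ the part containing f(y) integrates to zero by the mean-zero property. At γ the mass of
the child through x cancels. After γ the function `f` is constant on the cylinder. -/
lemma integral_sepInd_mul {γ : Node A} {f : InfPath A → ℝ} (hf : f ∈ eigenspace μ γ)
    (x : InfPath A) (n : ℕ) : ∫ y, sepInd (x.node n) x y * (f x - f y) ∂μ =
      (if n < γ.level then μ.real (cyl (x.node n)) - μ.real (cyl (x.node (n + 1)))
        else if n = γ.level then μ.real (cyl (x.node n)) else 0) * f x := by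
  have := H.isProbabilityMeasure
  have hint (n : ℕ) : Integrable (fun y => cylInd (x.node n) y * f y) μ := by
    refine (H.integrable_eigenspace hf).bdd_mul (c := 1)
      (measurable_cylInd _).aestronglyMeasurable (ae_of_all _ fun y => ?_)
    rw [Real.norm_of_nonneg (cylInd_nonneg _ _)]
    exact cylInd_le_one _ _
  have hc (n : ℕ) : Integrable (fun y => cylInd (x.node n) y * f x) μ :=
    (integrable_cylInd μ _).mul_const _
  have h : ∀ y, sepInd (x.node n) x y * (f x - f y) =
      (cylInd (x.node n) y * f x - cylInd (x.node (n + 1)) y * f x) -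
        (cylInd (x.node n) y * f y - cylInd (x.node (n + 1)) y * f y) := fun y => by
    rw [sepInd_node]; ring
  simp only [h]
  have h1 : Integrable (fun y => cylInd (x.node n) y * f x - cylInd (x.node (n + 1)) y * f x) μ :=
    (hc _).sub (hc _)
  have h2 : Integrable (fun y => cylInd (x.node n) y * f y - cylInd (x.node (n + 1)) y * f y) μ :=
    (hint _).sub (hint _)
  rw [integral_sub h1 h2, integral_sub (hc _) (hc _),
    integral_sub (hint _) (hint _), integral_mul_const, integral_mul_const, integral_cylInd,
    integral_cylInd, H.integral_cylInd_mul hf, H.integral_cylInd_mul hf]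
  rcases lt_trichotomy n γ.level with h | h | h
  · rw [if_neg (by omega), if_neg (by omega), if_pos h]; ring
  · rw [if_neg (by omega), if_pos (by omega), if_neg (by omega), if_pos h]; ring
  · rw [if_pos (by omega), if_pos (by omega), if_neg (by omega), if_neg (by omega)]; ring

lemma sum_integral_sepInd_mul {γ : Node A} {f : InfPath A → ℝ} (hf : f ∈ eigenspace μ γ)
    (x : InfPath A) : ∑ ζ ∈ nodesBelow A (γ.level + 1), (G κ δ s μ ζ)⁻¹ *
      ∫ y, sepInd ζ x y * (f x - f y) ∂μ = -eigenvalue κ δ s μ γ * f x := by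
  classical
  have hsub : (Finset.range (γ.level + 1)).image x.node ⊆ nodesBelow A (γ.level + 1) := by
    intro ζ hζ
    obtain ⟨n, hn, rfl⟩ := Finset.mem_image.1 hζ
    rw [mem_nodesBelow, level_node]
    exact Finset.mem_range.1 hn
  rw [← Finset.sum_subset hsub, Finset.sum_image fun _ _ _ _ h => node_injective x h]
  · simp only [H.integral_sepInd_mul hf, ← mul_assoc, ← Finset.sum_mul]
    by_cases hx : x ∈ cyl γ
    · congr 1
      rw [eigenvalue, ← mem_cyl_iff.1 hx, level_node, nodeSum_node, Finset.sum_range_succ, neg_sub,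
        if_neg (lt_irrefl _), if_pos rfl, sub_eq_add_neg, ← Finset.sum_neg_distrib, add_comm]
      congr 1
      · ring
      · refine Finset.sum_congr rfl fun n hn => ?_
        rw [if_pos (Finset.mem_range.1 hn)]
        ring
    · rw [H.eigenspace_eq_zero hf hx, mul_zero, mul_zero]
  · intro ζ hζ hζ'
    have hx : x ∉ cyl ζ := fun hx => hζ' (Finset.mem_image.2
      ⟨ζ.level, Finset.mem_range.2 (mem_nodesBelow.1 hζ), mem_cyl_iff.1 hx⟩)
    simp [sepInd_eq_zero hx]

lemma formQ_eigenspace {g : InfPath A → ℂ} (hg : Measurable g) {M : ℝ} (hM : ∀ x, ‖g x‖ ≤ M)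
    {γ : Node A} {f : InfPath A → ℝ} (hf : f ∈ eigenspace μ γ) :
    formQ κ δ s μ g (fun x => (f x : ℂ)) =
      -(eigenvalue κ δ s μ γ : ℂ) * ∫ x, (starRingEnd ℂ) (g x) * (f x : ℂ) ∂μ := by
  have := H.isProbabilityMeasure
  obtain ⟨N, hN⟩ := H.eigenspace_bounded hf
  have hfm := H.measurable_eigenspace hf
  have hI (ζ : Node A) (x : InfPath A) : ∫ y, (sepInd ζ x y : ℂ) * ((f x : ℂ) - f y) ∂μ =
      ((∫ y, sepInd ζ x y * (f x - f y) ∂μ : ℝ) : ℂ) := by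
    rw [← integral_complex_ofReal]
    push_cast
    rfl
  have hfc : Measurable fun x => (f x : ℂ) := Complex.measurable_ofReal.comp hfm
  rw [H.formQ_eq_sum hg hfc hM
    (fun x => (Complex.norm_real _).trans_le (hN x)) (L := γ.level + 1)
    fun x y hxy => congrArg Complex.ofReal (H.eigenspace_congr hf hxy)]
  have hi (ζ : Node A) := integrable_nodeForm μ ζ hg hfc hM
    (fun x => (Complex.norm_real _).trans_le (hN x))
  have hc (ζ : Node A) : (G κ δ s μ ζ : ℂ)⁻¹ * nodeForm μ ζ g (fun x => (f x : ℂ)) =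
      ∫ x, (G κ δ s μ ζ : ℂ)⁻¹ * ((starRingEnd ℂ) (g x) *
        ∫ y, (sepInd ζ x y : ℂ) * ((f x : ℂ) - f y) ∂μ) ∂μ := (integral_const_mul _ _).symm
  simp only [hc]
  rw [← integral_finsetSum _ fun ζ _ => (hi ζ).const_mul _, ← integral_const_mul]
  refine integral_congr_ae (ae_of_all _ fun x => ?_)
  have h := congrArg (fun r : ℝ => (starRingEnd ℂ) (g x) * (r : ℂ))
    (H.sum_integral_sepInd_mul hf x)
  simp only [Complex.ofReal_sum, Complex.ofReal_mul, Complex.ofReal_inv, Complex.ofReal_neg,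
    Finset.mul_sum] at h
  simp only [hI]
  rw [mul_left_comm, ← h]
  exact Finset.sum_congr rfl fun ζ _ => by ring

omit H in
lemma formQ_const (κ : V → ℝ) (δ s : ℝ) (μ : Measure (InfPath A)) (g : InfPath A → ℂ) (c : ℂ) :
    formQ κ δ s μ g (fun _ => c) = 0 := by
  simp [formQ, trace_commBlock]

end IsAdmissible

end Form

/-! ### Eigenfunction expansion and the heat equation. -/

section HeatEquation

variable {k : ℕ} [NeZero k] {V : Type*} {A : Fin k → Matrix V V ℕ}

lemma indicator_eq_cylInd (γ : Node A) :
    ((cyl γ).indicator fun _ => (1 : ℂ)) = fun x => (cylInd γ x : ℂ) := by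
  funext x
  by_cases hx : x ∈ cyl γ
  · rw [Set.indicator_of_mem hx, cylInd_of_mem hx, Complex.ofReal_one]
  · rw [Set.indicator_of_notMem hx, cylInd_of_notMem hx, Complex.ofReal_zero]

lemma cylInd_mem_domQ (γ : Node A) : (fun x => (cylInd γ x : ℂ)) ∈ domQ A := by
  rw [← indicator_eq_cylInd]
  exact Submodule.subset_span ⟨γ, rfl⟩

/-- Functions in the domain of the form are measurable, bounded, and determined by initial
sub-paths of some fixed level. -/
lemma domQ_properties {f : InfPath A → ℂ} (hf : f ∈ domQ A) :
    Measurable f ∧ (∃ M, ∀ x, ‖f x‖ ≤ M) ∧ ∃ L, ∀ x y, x.node L = y.node L → f x = f y := by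
  induction hf using Submodule.span_induction with
  | mem f hf =>
    obtain ⟨γ, rfl⟩ := hf
    simp only [indicator_eq_cylInd]
    exact ⟨Complex.measurable_ofReal.comp (measurable_cylInd γ), ⟨1, fun x => by
      rw [Complex.norm_real, Real.norm_of_nonneg (cylInd_nonneg _ _)]; exact cylInd_le_one _ _⟩,
      γ.level, fun x y h => by rw [cylInd_congr h]⟩
  | zero => exact ⟨measurable_const, ⟨0, by simp⟩, 0, by simp⟩
  | add f g _ _ hf hg =>
    obtain ⟨hfm, ⟨M, hM⟩, L, hL⟩ := hf
    obtain ⟨hgm, ⟨N, hN⟩, K, hK⟩ := hg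
    refine ⟨hfm.add hgm, ⟨M + N, fun x => (norm_add_le _ _).trans (add_le_add (hM x) (hN x))⟩,
      max L K, fun x y h => ?_⟩
    rw [Pi.add_apply, Pi.add_apply, hL x y (node_eq_of_le (le_max_left _ _) h),
      hK x y (node_eq_of_le (le_max_right _ _) h)]
  | smul c f _ hf =>
    obtain ⟨hfm, ⟨M, hM⟩, L, hL⟩ := hf
    refine ⟨hfm.const_smul c, ⟨‖c‖ * M, fun x => ?_⟩, L, fun x y h => ?_⟩
    · rw [Pi.smul_apply, norm_smul]
      exact mul_le_mul_of_nonneg_left (hM x) (norm_nonneg _)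
    · rw [Pi.smul_apply, Pi.smul_apply, hL x y h]

lemma integrable_of_mem_domQ (μ : Measure (InfPath A)) [IsFiniteMeasure μ] {f : InfPath A → ℂ}
    (hf : f ∈ domQ A) : Integrable f μ := by
  obtain ⟨hm, ⟨M, hM⟩, -⟩ := domQ_properties hf
  exact Integrable.of_bound hm.aestronglyMeasurable M (ae_of_all _ hM)

lemma integrable_conj_mul (μ : Measure (InfPath A)) [IsFiniteMeasure μ] {f g : InfPath A → ℂ}
    (hg : g ∈ domQ A) (hf : f ∈ domQ A) : Integrable (fun x => (starRingEnd ℂ) (g x) * f x) μ := by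
  obtain ⟨hm, ⟨M, hM⟩, -⟩ := domQ_properties hg
  exact (integrable_of_mem_domQ μ hf).bdd_mul (c := M)
    (Complex.continuous_conj.measurable.comp hm).aestronglyMeasurable
    (ae_of_all _ fun x => (RCLike.norm_conj _).trans_le (hM x))

lemma sum_mem_domQ {ι : Type*} [Fintype ι] {f : ι → InfPath A → ℂ} (c : ι → ℂ)
    (hf : ∀ i, f i ∈ domQ A) : (fun x => ∑ i, c i * f i x) ∈ domQ A := by
  have h : (fun x => ∑ i, c i * f i x) = ∑ i, c i • f i := by
    funext x
    simp
  rw [h]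
  exact Submodule.sum_mem _ fun i _ => Submodule.smul_mem _ _ (hf i)

variable [Fintype V] {κ : V → ℝ} {μ : Measure (InfPath A)} {δ s : ℝ}

/-- `f` is an eigenfunction with eigenvalue `l` of the semigroup with kernel `p`, and with
eigenvalue `-l` of the form. -/
structure IsEigenfunction (κ : V → ℝ) (δ s : ℝ) (μ : Measure (InfPath A))
    (p : ℝ → InfPath A → InfPath A → ℝ) (l : ℝ) (f : InfPath A → ℂ) : Prop where
  mem : f ∈ domQ A
  kernelOp_eq : ∀ t > 0, ∀ x, kernelOp μ p t f x = (Real.exp (l * t) : ℂ) * f x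
  formQ_eq : ∀ g ∈ domQ A,
    formQ κ δ s μ g f = -(l : ℂ) * ∫ x, (starRingEnd ℂ) (g x) * f x ∂μ

/-- `f` is a finite linear combination of eigenfunctions. -/
def HasEigenExpansion (κ : V → ℝ) (δ s : ℝ) (μ : Measure (InfPath A))
    (p : ℝ → InfPath A → InfPath A → ℝ) (f : InfPath A → ℂ) : Prop :=
  ∃ (ι : Type) (_ : Fintype ι) (c : ι → ℂ) (l : ι → ℝ) (h : ι → InfPath A → ℂ),
    (∀ i, IsEigenfunction κ δ s μ p (l i) (h i)) ∧ f = fun x => ∑ i, c i * h i x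

namespace HasEigenExpansion

variable {p : ℝ → InfPath A → InfPath A → ℝ} {f g : InfPath A → ℂ}

lemma of_isEigenfunction {l : ℝ} (h : IsEigenfunction κ δ s μ p l f) :
    HasEigenExpansion κ δ s μ p f :=
  ⟨Unit, inferInstance, fun _ => 1, fun _ => l, fun _ => f, fun _ => h, by simp⟩

lemma add (hf : HasEigenExpansion κ δ s μ p f) (hg : HasEigenExpansion κ δ s μ p g) :
    HasEigenExpansion κ δ s μ p (f + g) := by
  obtain ⟨ι, _, c, l, h, hh, rfl⟩ := hf
  obtain ⟨ι', _, c', l', h', hh', rfl⟩ := hg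
  refine ⟨ι ⊕ ι', inferInstance, Sum.elim c c', Sum.elim l l', Sum.elim h h', ?_, ?_⟩
  · rintro (i | i)
    · exact hh i
    · exact hh' i
  · funext x
    simp

lemma smul (a : ℂ) (hf : HasEigenExpansion κ δ s μ p f) : HasEigenExpansion κ δ s μ p (a • f) := by
  obtain ⟨ι, _, c, l, h, hh, rfl⟩ := hf
  refine ⟨ι, inferInstance, fun i => a * c i, l, h, hh, ?_⟩
  funext x
  simp [Finset.mul_sum, mul_assoc]

end HasEigenExpansion

namespace IsAdmissible

variable (H : IsAdmissible κ μ δ s)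
include H

/-- Linearity is not immediate for an integral of an infinite sum; it is read off from the finite
formula at a level common to all the functions. -/
lemma formQ_sum {ι : Type*} [Fintype ι] {g : InfPath A → ℂ} {f : ι → InfPath A → ℂ} (c : ι → ℂ)
    (hg : g ∈ domQ A) (hf : ∀ i, f i ∈ domQ A) :
    formQ κ δ s μ g (fun x => ∑ i, c i * f i x) = ∑ i, c i * formQ κ δ s μ g (f i) := by
  have := H.isProbabilityMeasure
  obtain ⟨hgm, ⟨M, hM⟩, -⟩ := domQ_properties hg
  choose hfm hN L' hL' using fun i => domQ_properties (hf i)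
  choose N hN using hN
  set L := Finset.univ.sup L'
  have hL (i : ι) (x y : InfPath A) (h : x.node L = y.node L) : f i x = f i y :=
    hL' i x y (node_eq_of_le (Finset.le_sup (Finset.mem_univ i)) h)
  obtain ⟨hsm, ⟨B, hB⟩, -⟩ := domQ_properties (sum_mem_domQ c hf)
  rw [H.formQ_eq_sum hgm hsm hM hB (L := L) fun x y h =>
    Finset.sum_congr rfl fun i _ => by rw [hL i x y h]]
  simp only [fun i => H.formQ_eq_sum hgm (hfm i) hM (hN i) (hL i),
    nodeForm_sum μ _ c hgm hfm hM hN, Finset.mul_sum]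
  rw [Finset.sum_comm]
  exact Finset.sum_congr rfl fun i _ => Finset.sum_congr rfl fun γ _ => by ring

lemma ofReal_mem_domQ {γ : Node A} {f : InfPath A → ℝ} (hf : f ∈ eigenspace μ γ) :
    (fun x => (f x : ℂ)) ∈ domQ A := by
  obtain ⟨v, -, hfv⟩ := H.exists_coeff hf
  simp only [hfv, Complex.ofReal_sum, Complex.ofReal_mul]
  exact sum_mem_domQ _ fun e => cylInd_mem_domQ _

variable {m : Node A → ℕ} {ψ : (γ : Node A) → Fin (m γ) → InfPath A → ℝ}
  (hψ : IsEigenbasis μ m ψ)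
include hψ

lemma isEigenfunction_of_mem {γ : Node A} {f : InfPath A → ℝ} (hf : f ∈ eigenspace μ γ) :
    IsEigenfunction κ δ s μ (heatKernel κ δ s μ ψ) (eigenvalue κ δ s μ γ)
      (fun x => (f x : ℂ)) where
  mem := H.ofReal_mem_domQ hf
  kernelOp_eq t ht x := by
    rw [kernelOp, ← Complex.ofReal_mul, ← H.integral_heatKernel_mul_eigenspace hψ ht x hf,
      ← integral_complex_ofReal]
    push_cast
    rfl
  formQ_eq g hg := by
    obtain ⟨hm, ⟨M, hM⟩, -⟩ := domQ_properties hg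
    exact H.formQ_eigenspace hm hM hf

lemma isEigenfunction_one :
    IsEigenfunction κ δ s μ (heatKernel κ δ s μ ψ) 0 (fun _ => (1 : ℂ)) where
  mem := by
    have h := cylInd_mem_domQ (.empty : Node A)
    simpa only [cylInd_empty, Complex.ofReal_one] using h
  kernelOp_eq t ht x := by
    simp only [kernelOp, mul_one, zero_mul, Real.exp_zero]
    rw [← H.integral_heatKernel hψ ht x, ← integral_complex_ofReal]
  formQ_eq g _ := by rw [formQ_const]; simp

/-- Induction along a branch: the indicator of [x_{n+1}] is (a_{n+1}/a_n) times that of [x_n] plus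
a_{n+1} times the projection kernel at x_n, which lies in the eigenspace. -/
lemma hasEigenExpansion {f : InfPath A → ℂ} (hf : f ∈ domQ A) :
    HasEigenExpansion κ δ s μ (heatKernel κ δ s μ ψ) f := by
  have := H.isProbabilityMeasure
  induction hf using Submodule.span_induction with
  | mem f hf =>
    obtain ⟨γ, rfl⟩ := hf
    simp only [indicator_eq_cylInd]
    obtain ⟨x, n, rfl⟩ := H.exists_node γ
    induction n with
    | zero =>
      simp only [InfPath.node, cylInd_empty, Complex.ofReal_one]
      exact .of_isEigenfunction (H.isEigenfunction_one hψ)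
    | succ n ih =>
      have hK := projKernel_mem μ (fun γ => (H.measure_pos γ).ne') (x.node n) x
      have h := (ih.smul ((μ.real (cyl (x.node (n + 1))) / μ.real (cyl (x.node n)) : ℝ) : ℂ)).add
        ((HasEigenExpansion.of_isEigenfunction (H.isEigenfunction_of_mem hψ hK)).smul
          (μ.real (cyl (x.node (n + 1))) : ℂ))
      refine cast (congrArg _ ?_) h
      funext y
      have h1 := (H.measure_pos (x.node n)).ne'
      have h2 := (H.measure_pos (x.node (n + 1))).ne'
      simp only [Pi.add_apply, Pi.smul_apply, smul_eq_mul, projKernel_node]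
      norm_cast
      field_simp
      ring
  | zero => exact ⟨Empty, inferInstance, Empty.elim, Empty.elim, fun i => i.elim,
      fun i => i.elim, by funext; simp⟩
  | add f g _ _ hf hg => exact hf.add hg
  | smul c f _ hf => exact hf.smul c

/-- On a finite eigenexpansion the operator multiplies each term by e^{λt} and the form by -λ, so
the equation holds termwise. The initial condition even holds uniformly, because the finitely many
eigenfunctions are bounded. -/
lemma isHeatKernel : IsHeatKernel κ δ s μ (heatKernel κ δ s μ ψ) := by
  have := H.isProbabilityMeasure
  refine ⟨fun t ht x => H.integrable_heatKernel hψ ht x, fun f hf => ?_⟩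
  obtain ⟨ι, _, c, l, h, hh, rfl⟩ := H.hasEigenExpansion hψ hf
  have hu (t : ℝ) (ht : 0 < t) : kernelOp μ (heatKernel κ δ s μ ψ) t (fun x => ∑ i, c i * h i x) =
      fun x => ∑ i, (c i * (Real.exp (l i * t) : ℂ)) * h i x := by
    funext x
    obtain ⟨M, hM⟩ := H.exists_heatKernel_bound hψ ht
    have hint (i : ι) : Integrable (fun y => (heatKernel κ δ s μ ψ t x y : ℂ) * h i y) μ :=
      (integrable_of_mem_domQ μ (hh i).mem).bdd_mul (c := M)
        (Complex.measurable_ofReal.comp (H.measurable_heatKernel hψ ht x)).aestronglyMeasurable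
        (ae_of_all _ fun y => (Complex.norm_real _).trans_le (hM x y))
    simp only [kernelOp, Finset.mul_sum, mul_left_comm _ (c _)]
    rw [integral_finsetSum _ fun i _ => (hint i).const_mul (c i)]
    refine Finset.sum_congr rfl fun i _ => ?_
    rw [integral_const_mul, mul_assoc, ← (hh i).kernelOp_eq t ht x]
    rfl
  have hmem (i : ι) := (hh i).mem
  refine ⟨fun t ht => ?_, fun g hg t ht => ?_, ?_⟩
  · rw [hu t ht]
    exact sum_mem_domQ _ hmem
  · have hinner (r : ℝ) (hr : 0 < r) : ∫ x, (starRingEnd ℂ) (g x) *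
        kernelOp μ (heatKernel κ δ s μ ψ) r (fun x => ∑ i, c i * h i x) x ∂μ =
        ∑ i, (c i * ∫ x, (starRingEnd ℂ) (g x) * h i x ∂μ) * (Real.exp (l i * r) : ℂ) := by
      rw [hu r hr]
      simp only [Finset.mul_sum, mul_left_comm _ (c _ * _)]
      rw [integral_finsetSum _ fun i _ => (integrable_conj_mul μ hg (hmem i)).const_mul _]
      refine Finset.sum_congr rfl fun i _ => ?_
      rw [integral_const_mul]
      ring
    have hexp (i : ι) : HasDerivAt (fun r : ℝ => (Real.exp (l i * r) : ℂ))
        ((Real.exp (l i * t) * l i : ℝ) : ℂ) t := by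
      have h1 : HasDerivAt (fun r : ℝ => Real.exp (l i * r)) (Real.exp (l i * t) * l i) t := by
        simpa using ((hasDerivAt_id t).const_mul (l i)).exp
      exact h1.ofReal_comp
    have hderiv := HasDerivAt.fun_sum (u := Finset.univ) fun i _ =>
      (hexp i).const_mul (c i * ∫ x, (starRingEnd ℂ) (g x) * h i x ∂μ)
    refine (hderiv.congr_of_eventuallyEq ?_).congr_deriv ?_
    · filter_upwards [lt_mem_nhds ht] with r hr
      exact hinner r hr
    · rw [hu t ht, H.formQ_sum _ hg hmem, ← Finset.sum_neg_distrib]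
      refine Finset.sum_congr rfl fun i _ => ?_
      rw [(hh i).formQ_eq g hg]
      push_cast
      ring
  · choose hm hM' _ using fun i => domQ_properties (hmem i)
    choose M hM using hM'
    have hlim : Tendsto (fun t : ℝ => (∑ i, ‖c i‖ * |Real.exp (l i * t) - 1| * M i) ^ 2)
        (𝓝[>] 0) (𝓝 0) := by
      have hc : Continuous fun t : ℝ => (∑ i, ‖c i‖ * |Real.exp (l i * t) - 1| * M i) ^ 2 := by
        fun_prop
      have h0 := hc.tendsto 0
      simp only [mul_zero, Real.exp_zero, sub_self, abs_zero, zero_mul, Finset.sum_const_zero,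
        ne_eq, OfNat.ofNat_ne_zero, not_false_eq_true, zero_pow] at h0
      exact h0.mono_left nhdsWithin_le_nhds
    refine squeeze_zero' (Eventually.of_forall fun t => integral_nonneg fun x => by positivity) ?_
      hlim
    filter_upwards [self_mem_nhdsWithin] with t ht
    have hbound (x : InfPath A) : ‖‖kernelOp μ (heatKernel κ δ s μ ψ) t
        (fun x => ∑ i, c i * h i x) x - ∑ i, c i * h i x‖ ^ 2‖ ≤
        (∑ i, ‖c i‖ * |Real.exp (l i * t) - 1| * M i) ^ 2 := by
      rw [norm_pow, norm_norm, hu t ht, ← Finset.sum_sub_distrib]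
      refine pow_le_pow_left₀ (norm_nonneg _) ((norm_sum_le _ _).trans
        (Finset.sum_le_sum fun i _ => ?_)) 2
      rw [show c i * (Real.exp (l i * t) : ℂ) * h i x - c i * h i x =
        c i * ((Real.exp (l i * t) - 1 : ℝ) : ℂ) * h i x by push_cast; ring, norm_mul, norm_mul,
        Complex.norm_real, Real.norm_eq_abs]
      exact mul_le_mul_of_nonneg_left (hM i x) (by positivity)
    have h1 := norm_integral_le_of_norm_le_const (μ := μ) (ae_of_all _ hbound)
    rw [probReal_univ, mul_one] at h1
    exact (le_abs_self _).trans h1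

end IsAdmissible

end HeatEquation

end KGraphHeat

theorem mainTheorem6 {k : ℕ} [NeZero k] {V : Type*} [SmallCategory V] [Fintype V]
    (Λ : KGraphHeat.KGraph k V) (hfin : Λ.IsFinite) (hconn : Λ.IsStronglyConnected)
    (hρ : ∀ i, 1 < KGraphHeat.rho Λ.vertexMatrix i)
    (κ : V → ℝ) (hκ : KGraphHeat.IsPerronFrobenius Λ.vertexMatrix κ)
    (μ : Measure (KGraphHeat.InfPath Λ.vertexMatrix)) (hμ : KGraphHeat.IsSelfSimilar κ μ)
    (δ : ℝ) (hδ₀ : 0 < δ) (hδ₁ : δ < 1) (s : ℝ) (hs : s < 2 + δ)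
    (hdiam : ∀ (n : ℕ) (v : V) (η : KGraphHeat.FinPath Λ.vertexMatrix n v),
      KGraphHeat.diamCyl κ δ (.path η) = KGraphHeat.weight κ δ (.path η))
    (m : KGraphHeat.Node Λ.vertexMatrix → ℕ)
    (ψ : (γ : KGraphHeat.Node Λ.vertexMatrix) → Fin (m γ) →
      KGraphHeat.InfPath Λ.vertexMatrix → ℝ)
    (hψ : KGraphHeat.IsEigenbasis μ m ψ) :
    (∀ t > 0, ∀ x y, Summable (KGraphHeat.heatTerm κ δ s μ ψ t x y)) ∧
    KGraphHeat.IsHeatKernel κ δ s μ (KGraphHeat.heatKernel κ δ s μ ψ) ∧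
    ContinuousOn
      (fun z : ℝ × KGraphHeat.InfPath Λ.vertexMatrix × KGraphHeat.InfPath Λ.vertexMatrix =>
        KGraphHeat.heatKernel κ δ s μ ψ z.1 z.2.1 z.2.2)
      (Set.Ioi 0 ×ˢ Set.univ) ∧
    ∃ c₁ > 0, ∃ c₂ > 0, ∀ t > 0, ∀ x y,
      (t ≤ KGraphHeat.dIntrinsic κ δ s μ x y →
        c₁ * (t / (KGraphHeat.dIntrinsic κ δ s μ x y *
            μ.real (KGraphHeat.cyl (KGraphHeat.meet x y))))
          ≤ KGraphHeat.heatKernel κ δ s μ ψ t x y ∧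
        KGraphHeat.heatKernel κ δ s μ ψ t x y
          ≤ c₂ * (t / (KGraphHeat.dIntrinsic κ δ s μ x y *
            μ.real (KGraphHeat.cyl (KGraphHeat.meet x y))))) ∧
      (KGraphHeat.dIntrinsic κ δ s μ x y < t →
        c₁ * (1 / μ.real (KGraphHeat.ballS κ δ s μ x t))
          ≤ KGraphHeat.heatKernel κ δ s μ ψ t x y ∧
        KGraphHeat.heatKernel κ δ s μ ψ t x y
          ≤ c₂ * (1 / μ.real (KGraphHeat.ballS κ δ s μ x t))) := by
  have H : KGraphHeat.IsAdmissible κ μ δ s := ⟨hρ, hκ, hμ, hδ₀, hδ₁, hs, hdiam⟩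
  exact ⟨fun t ht x y => H.summable_heatTerm hψ ht x y, H.isHeatKernel hψ,
    H.continuousOn_heatKernel hψ, H.heatKernel_bounds hψ⟩
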